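/- Theorem (Classification of minimal cycles). A 2-complex is a finite simplicial complex of dimension at most $2$; it is pure if each of its vertices and edges is contained in a $2$-dimensional face. A minimal cycle is a pure 2-complex $Z$ such that $b_2(Z)=1$ and $b_2(Z')=0$ for every proper subcomplex $Z'\subset Z$, where $b_2=\dim_{\mathbb Q}H_2(\,\cdot\,;\mathbb Q)$ is the second Betti number. Let $\mu(Z)=v/f$, where $v$ is the number of vertices and $f$ the number of $2$-dimensional faces of $Z$. Let $Z$ be a minimal cycle with $\mu(Z)>1/2$. Then (the geometric realization of) $Z$ is homeomorphic to one of the following spaces $Z_1,Z_2,Z_3,Z_4$: (1) $Z_1=S^2$; (2) $Z_2$ is the quotient of $S^2$ obtained by identifying two distinct points; (3) $Z_3$ is the quotient of $S^2$ obtained by identifying two adjacent arcs, that is, $Z_3=S^2/(\alpha(t)\sim\beta(t),\ t\in[0,1])$ where $\alpha,\beta:[0,1]\to S^2$ are topological embeddings with $\alpha(0)=\beta(0)$ and $\alpha([0,1])\cap\beta([0,1])=\{\alpha(0)\}$; (4) $Z_4=P^2\cup\Delta^2$ is the real projective plane $P^2$ with a closed disc $\Delta^2$ glued to it along a homeomorphism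 from the circle $\partial\Delta^2$ onto the projective line $P^1\subset P^2$. (Up to homeomorphism, $Z_2,Z_3,Z_4$ do not depend on the choice of the points, of the arcs, or of the gluing homeomorphism.) -/

import Mathlib

namespace MinimalCycles

/-! ### Finite simplicial complexes, their realizations and Betti numbers

A finite simplicial complex is a `PreAbstractSimplicialComplex V` on a finite type `V`; its simplices
are the nonempty finite sets in `K.faces`, and elements of `V` need not be vertices of `K`. -/

section Complexes

variable {V : Type*} [Fintype V]

/-- The geometric realization: barycentric coordinates supported on a simplex of `K`, with the
topology induced from `V → ℝ`. -/
def Realization (K : PreAbstractSimplicialComplex V) : Type _ :=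
  {x : V → ℝ // (∀ v, 0 ≤ x v) ∧ ∑ v, x v = 1 ∧ ∃ s ∈ K.faces, ∀ v, v ∉ s → x v = 0}

instance (K : PreAbstractSimplicialComplex V) : TopologicalSpace (Realization K) :=
  inferInstanceAs (TopologicalSpace
    {x : V → ℝ // (∀ v, 0 ≤ x v) ∧ ∑ v, x v = 1 ∧ ∃ s ∈ K.faces, ∀ v, v ∉ s → x v = 0})

/-- The number of `n`-dimensional simplices. -/
noncomputable def simplexCount (K : PreAbstractSimplicialComplex V) (n : ℕ) : ℕ :=
  {s : Finset V | s ∈ K.faces ∧ s.card = n + 1}.ncard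

/-- `μ(K) = v / f`, the number of vertices over the number of 2-dimensional faces. -/
noncomputable def mu (K : PreAbstractSimplicialComplex V) : ℝ :=
  (simplexCount K 0 : ℝ) / (simplexCount K 2 : ℝ)

/-- Dimension at most two. -/
def IsTwoComplex (K : PreAbstractSimplicialComplex V) : Prop :=
  ∀ s ∈ K.faces, s.card ≤ 3

/-- Every simplex (in particular every vertex and every edge) lies in a 2-dimensional face. -/
def IsPure (K : PreAbstractSimplicialComplex V) : Prop :=
  ∀ s ∈ K.faces, ∃ t ∈ K.faces, s ⊆ t ∧ t.card = 3

/-- Oriented simplicial `n`-chains with rational coefficients. A chain is recorded by its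
coefficients: `c x` is the coefficient of the oriented simplex `[x 0, …, x n]`, which changes by the
sign of the permutation when the vertices are permuted, and vanishes off the simplices of `K`
(it vanishes for repeated vertices by antisymmetry). -/
def chains (K : PreAbstractSimplicialComplex V) (n : ℕ) : Submodule ℚ ((Fin (n + 1) → V) → ℚ) where
  carrier := {c | (∀ (σ : Equiv.Perm (Fin (n + 1))) (x : Fin (n + 1) → V),
      c (x ∘ σ) = ((Equiv.Perm.sign σ : ℤ) : ℚ) * c x) ∧
    ∀ x : Fin (n + 1) → V, (¬ ∃ s ∈ K.faces, (s : Set V) = Set.range x) → c x = 0}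
  add_mem' := by
    rintro a b ⟨ha, ha'⟩ ⟨hb, hb'⟩
    refine ⟨fun σ x => ?_, fun x hx => ?_⟩
    · simp only [Pi.add_apply, ha σ x, hb σ x, mul_add]
    · simp only [Pi.add_apply, ha' x hx, hb' x hx, add_zero]
  zero_mem' := ⟨fun σ x => by simp, fun x _ => rfl⟩
  smul_mem' := by
    rintro r a ⟨ha, ha'⟩
    refine ⟨fun σ x => ?_, fun x hx => ?_⟩
    · simp only [Pi.smul_apply, ha σ x, smul_eq_mul]; ring
    · simp only [Pi.smul_apply, ha' x hx, smul_zero]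

/-- The simplicial boundary `∂[x₀, …, xₙ₊₁] = ∑ (-1)^i [x₀, …, x̂ᵢ, …, xₙ₊₁]`: in terms of coefficients,
the coefficient of `[x₀, …, xₙ]` in `∂c` is the sum over all `w` of that of `[w, x₀, …, xₙ]` in `c`. -/
def boundary (V : Type*) [Fintype V] (n : ℕ) :
    ((Fin (n + 2) → V) → ℚ) →ₗ[ℚ] ((Fin (n + 1) → V) → ℚ) where
  toFun c := fun x => ∑ w : V, c (Fin.cons w x)
  map_add' a b := by
    funext x
    simp [Finset.sum_add_distrib]
  map_smul' r a := by
    funext x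
    simp [Finset.mul_sum]

/-- The simplicial `(n + 1)`-cycles of `K`. -/
def cycles (K : PreAbstractSimplicialComplex V) (n : ℕ) : Submodule ℚ ((Fin (n + 2) → V) → ℚ) :=
  chains K (n + 1) ⊓ LinearMap.ker (boundary V n)

/-- The simplicial `n`-boundaries of `K`. -/
def boundaries (K : PreAbstractSimplicialComplex V) (n : ℕ) :
    Submodule ℚ ((Fin (n + 1) → V) → ℚ) :=
  (chains K (n + 1)).map (boundary V n)

lemma boundaries_le_chains (K : PreAbstractSimplicialComplex V) (n : ℕ) :
    boundaries K n ≤ chains K n := by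
  rintro _ ⟨c, hc, rfl⟩
  refine ⟨fun σ x => ?_, fun x hx => ?_⟩
  · change ∑ w : V, c (Fin.cons w (x ∘ σ)) = _ * ∑ w : V, c (Fin.cons w x)
    rw [Finset.mul_sum]
    refine Finset.sum_congr rfl fun w _ => ?_
    have h := hc.1 (Equiv.Perm.decomposeFin.symm (0, σ)) (Fin.cons w x)
    rw [Equiv.Perm.decomposeFin.symm_sign] at h
    simp only [if_true, one_mul] at h
    rw [← h]
    refine congrArg c (funext fun i => ?_)
    refine Fin.cases ?_ (fun j => ?_) i
    · simp
    · simp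
  · refine Finset.sum_eq_zero fun w _ => hc.2 _ ?_
    rintro ⟨s, hs, hsx⟩
    classical
    refine hx ⟨Finset.univ.image x, (K.isRelLowerSet_faces hs).2 ?_ ?_, by simp⟩
    · intro v hv
      obtain ⟨i, -, rfl⟩ := Finset.mem_image.1 hv
      have : x i ∈ (s : Set V) := hsx ▸ ⟨i.succ, by simp⟩
      exact this
    · exact Finset.univ_nonempty.image x

lemma boundaries_le_cycles (K : PreAbstractSimplicialComplex V) (n : ℕ) :
    boundaries K (n + 1) ≤ cycles K n := by
  refine le_inf (boundaries_le_chains K (n + 1)) ?_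
  rintro _ ⟨c, hc, rfl⟩
  rw [LinearMap.mem_ker]
  funext x
  change ∑ w : V, ∑ u : V, c (Fin.cons u (Fin.cons w x)) = 0
  have h : ∀ u w : V, c (Fin.cons u (Fin.cons w x)) = -c (Fin.cons w (Fin.cons u x)) := by
    intro u w
    have h := hc.1 (Equiv.swap 0 1) (Fin.cons w (Fin.cons u x))
    rw [Equiv.Perm.sign_swap (by simp)] at h
    have e : (Fin.cons w (Fin.cons u x : Fin (n + 2) → V) : Fin (n + 3) → V) ∘ Equiv.swap 0 1 =
        Fin.cons u (Fin.cons w x) := by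
      funext i
      refine Fin.cases ?_ (fun j => ?_) i
      · simp only [Function.comp, Equiv.swap_apply_left]; rfl
      · refine Fin.cases ?_ (fun k => ?_) j
        · simp only [Function.comp, Fin.succ_zero_eq_one, Equiv.swap_apply_right]; rfl
        · have h0 : k.succ.succ ≠ (0 : Fin (n + 3)) := Fin.succ_ne_zero _
          have h1 : k.succ.succ ≠ (1 : Fin (n + 3)) := by
            rw [← Fin.succ_zero_eq_one]
            exact fun h => Fin.succ_ne_zero _ (Fin.succ_injective _ h)
          simp only [Function.comp, Equiv.swap_apply_of_ne_of_ne h0 h1, Fin.cons_succ]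
    rw [e] at h
    simpa using h
  have h2 : ∑ w : V, ∑ u : V, c (Fin.cons u (Fin.cons w x)) =
      -∑ w : V, ∑ u : V, c (Fin.cons u (Fin.cons w x)) := by
    conv_lhs => rw [Finset.sum_comm]
    simp only [← Finset.sum_neg_distrib]
    exact Finset.sum_congr rfl fun u _ => Finset.sum_congr rfl fun w _ => h u w
  linarith

/-- The second Betti number: the dimension of `H₂(K; ℚ) = ker ∂₂ / im ∂₃`. -/
noncomputable def betti₂ (K : PreAbstractSimplicialComplex V) : ℕ :=
  Module.finrank ℚ (cycles K 1 ⧸ (boundaries K 2).submoduleOf (cycles K 1))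

/-- A minimal cycle: a finite pure 2-complex with `b₂ = 1` all of whose proper subcomplexes have
`b₂ = 0`. -/
structure IsMinimalCycle (K : PreAbstractSimplicialComplex V) : Prop where
  isTwoComplex : IsTwoComplex K
  isPure : IsPure K
  betti₂_eq_one : betti₂ K = 1
  betti₂_eq_zero_of_lt : ∀ L : PreAbstractSimplicialComplex V, L < K → betti₂ L = 0

end Complexes

/-! ### The model spaces -/

/-- The circle `S¹`, as the boundary of the unit disc. -/
abbrev S1 : Type := Metric.sphere (0 : EuclideanSpace ℝ (Fin 2)) 1

/-- The closed unit disc `Δ²`. -/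
abbrev Disc : Type := Metric.closedBall (0 : EuclideanSpace ℝ (Fin 2)) 1

/-- The sphere `S²`. -/
abbrev S2 : Type := Metric.sphere (0 : EuclideanSpace ℝ (Fin 3)) 1

/-- The sphere with the points `p` and `q` identified. -/
abbrev SphereWithPointsIdentified (p q : S2) : Type :=
  Quot fun x y : S2 => x = p ∧ y = q

/-- Two parametrized arcs in `S²` that have exactly one point in common, the initial point of
both. -/
structure AreAdjacentArcs (α β : unitInterval → S2) : Prop where
  isEmbedding_left : Topology.IsEmbedding α
  isEmbedding_right : Topology.IsEmbedding β
  source_eq : α 0 = β 0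
  inter_eq : Set.range α ∩ Set.range β = {α 0}

/-- The sphere with `α t` identified with `β t` for every `t`. -/
abbrev SphereWithArcsIdentified (α β : unitInterval → S2) : Type :=
  Quot fun x y : S2 => ∃ t, x = α t ∧ y = β t

/-- The real projective plane `P²`: the sphere with antipodal points identified. -/
abbrev P2 : Type := Quot fun x y : S2 => y = -x

/-- The projective line `P¹ ⊂ P²`: the image of the equator. -/
def P1 : Set P2 := {l | ∃ x : S2, x.1 2 = 0 ∧ l = Quot.mk _ x}

/-- `P² ∪ Δ²`, the disc glued to the projective plane along a homeomorphism `φ` from the boundary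
circle of the disc onto `P¹`. -/
abbrev ProjectivePlaneWithDisc (φ : S1 ≃ₜ P1) : Type :=
  Quot fun a b : P2 ⊕ Disc =>
    ∃ z : S1, a = Sum.inl (φ z).1 ∧ b = Sum.inr ⟨z.1, Metric.sphere_subset_closedBall z.2⟩

end MinimalCycles

/-! Write v, e, f for the numbers of vertices, edges and triangles of Z. Let c be a nonzero rational
2-cycle. By minimality every triangle has a nonzero coefficient in c, and no nonzero cycle is
supported on a proper subset of the triangles (`IsMinimalCycle.exists_isFundamentalCycle`). Hence Z
is connected, and with b₂ = 1 this gives v − e + f ≤ 2 (`IsMinimalCycle.card_verts_add_le`).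

Call the number of triangles at an edge its degree. It is at least two, since ∂c = 0. The total
excess Σ (deg − 2) = 3f − 2e is at most f − 2v + 4, hence at most three because f < 2v. At each
vertex the number of edges of odd degree is even. So either all degrees are two, or there is one
singular edge, of degree four, or the singular edges are three edges of degree three that form a
triangle. The same inequality bounds v − e + f from below (`IsFundamentalCycle.edgeDeg_cases`).

The topology is read off from a disc. Starting with one triangle, one attaches the missing neighbour
across edges of degree two (`IsRegion.attach`, which rests on `BoundsCell.merge`). The result is an
open 2-cell with a closed walk as boundary word; oriented along the cell, c has the same coefficient
on all its triangles, so the boundary of the restricted chain is a multiple of the 1-chain of the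
word. When no more triangle can be attached, this boundary is supported on singular edges. With at
most one singular edge it vanishes by ∂∂ = 0, and by minimality the region is all of Z.

Leaves of the boundary graph whose edge has degree two are folded into the cell
(`IsRegion.exists_isReduced`, which rests on `BoundsCell.fold`). The Euler characteristic of a
region is that of its boundary graph plus one (`IsRegion.card_wordVerts`). The lower bound above and
the absence of such leaves then leave only these words. Without singular edges the word is d d⁻¹,
which gives the sphere, or u u⁻¹ for a simple loop u, which gives the sphere with two points
identified. With one edge of degree four it is d d⁻¹ d d⁻¹, which gives the sphere with two arcs
identified. With a singular triangle T a region cannot be everything, by parity; its boundary is a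
multiple of T, and a second such region completes the cycle. The two words are T, which bounds the
disc, and T T, which gives the projective plane with T as projective line. -/

namespace MinimalCycles

open Set

/-! ### Cells: discs mapped into a space with a prescribed boundary word -/

section Cells

/-- A continuous map from a compact set to a Hausdorff space is closed, hence a quotient map onto
its image. All maps on the disc and the sphere below are built this way from polar or similar
coordinates. -/
theorem exists_continuousOn_descend {A B X : Type*} [TopologicalSpace A] [T2Space A] [Nonempty A]
    [TopologicalSpace B] [T2Space B] [TopologicalSpace X] {K : Set A} (hK : IsCompact K)
    {f : A → B} {g : A → X} (hf : ContinuousOn f K) (hg : ContinuousOn g K)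
    (hfg : ∀ a ∈ K, ∀ b ∈ K, f a = f b → g a = g b) :
    ∃ h : B → X, ContinuousOn h (f '' K) ∧ ∀ a ∈ K, h (f a) = g a := by
  classical
  have key : ∀ a ∈ K, g (Function.invFunOn f K (f a)) = g a := fun a ha =>
    hfg _ (Function.invFunOn_mem ⟨a, ha, rfl⟩) _ ha (Function.invFunOn_eq ⟨a, ha, rfl⟩)
  refine ⟨fun b => g (Function.invFunOn f K b), ?_, key⟩
  rw [continuousOn_iff_isClosed]
  intro t ht
  -- On `f '' K` the preimage of the closed set `t` under the descended map is this image of a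
  -- compact set.
  refine ⟨f '' (K ∩ g ⁻¹' t), ?_, ?_⟩
  · refine IsCompact.isClosed (IsCompact.image_of_continuousOn ?_ (hf.mono inter_subset_left))
    exact hK.of_isClosed_subset (hg.preimage_isClosed_of_isClosed hK.isClosed ht)
      inter_subset_left
  · ext b
    constructor
    · rintro ⟨hb, a, ha, rfl⟩
      exact ⟨⟨a, ⟨ha, by simpa [key a ha] using hb⟩, rfl⟩, a, ha, rfl⟩
    · rintro ⟨⟨a, ⟨ha, hat⟩, rfl⟩, -⟩
      exact ⟨by simpa [key a ha] using hat, a, ha, rfl⟩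

/-- A parametrization of the unit circle by `[0, n]`, injective up to the coincidence of the
endpoints. -/
structure IsBoundaryParam (b : ℝ → ℂ) (n : ℕ) : Prop where
  cont : ContinuousOn b (Icc 0 n)
  norm : ∀ s ∈ Icc (0 : ℝ) n, ‖b s‖ = 1
  closed : b 0 = b n
  inj : InjOn b (Ico 0 n)
  surj : ∀ z : ℂ, ‖z‖ = 1 → ∃ s ∈ Ico (0 : ℝ) n, b s = z

variable {X δ : Type*} [TopologicalSpace X]

/-- `π` maps the open unit disc injectively onto `S`, and the boundary circle, parametrized by `b`,
along the word `w` of paths, off `S`. -/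
structure IsCell (P : δ → ℝ → X) (b : ℝ → ℂ) (w : List δ) (π : ℂ → X) (S : Set X) : Prop where
  cont : ContinuousOn π (Metric.closedBall 0 1)
  inj : InjOn π (Metric.ball 0 1)
  image : π '' Metric.ball 0 1 = S
  trace : ∀ (k : ℕ) (hk : k < w.length), ∀ t ∈ Icc (0 : ℝ) 1, π (b (k + t)) = P w[k] t
  disj : ∀ z : ℂ, ‖z‖ = 1 → π z ∉ S

/-- The word `w` of paths bounds an open 2-cell with underlying set `S`. -/
def BoundsCell (P : δ → ℝ → X) (w : List δ) (S : Set X) : Prop :=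
  ∃ b π, IsBoundaryParam b w.length ∧ IsCell P b w π S

theorem IsBoundaryParam.eq_or {b : ℝ → ℂ} {n : ℕ} (hb : IsBoundaryParam b n) {s s' : ℝ}
    (hs : s ∈ Icc (0 : ℝ) n) (hs' : s' ∈ Icc (0 : ℝ) n) (h : b s = b s') :
    s = s' ∨ (s = 0 ∧ s' = n) ∨ (s = n ∧ s' = 0) := by
  rcases eq_or_lt_of_le hs.2 with h1 | h1 <;> rcases eq_or_lt_of_le hs'.2 with h2 | h2
  · left; rw [h1, h2]
  · rw [h1, ← hb.closed] at h
    by_cases hn : (0 : ℝ) < n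
    · exact Or.inr (Or.inr ⟨h1, (hb.inj ⟨le_rfl, hn⟩ ⟨hs'.1, h2⟩ h).symm⟩)
    · exact absurd (hs'.1.trans_lt h2) hn
  · rw [h2, ← hb.closed] at h
    by_cases hn : (0 : ℝ) < n
    · exact Or.inr (Or.inl ⟨hb.inj ⟨hs.1, h1⟩ ⟨le_rfl, hn⟩ h, h2⟩)
    · exact absurd (hs.1.trans_lt h1) hn
  · exact Or.inl (hb.inj ⟨hs.1, h1⟩ ⟨hs'.1, h2⟩ h)

theorem IsBoundaryParam.eq_of_eq {b b' : ℝ → ℂ} {n : ℕ} (hb : IsBoundaryParam b n)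
    (hb' : IsBoundaryParam b' n) {s s' : ℝ} (hs : s ∈ Icc (0 : ℝ) n) (hs' : s' ∈ Icc (0 : ℝ) n)
    (h : b s = b s') : b' s = b' s' := by
  rcases hb.eq_or hs hs' h with rfl | ⟨rfl, rfl⟩ | ⟨rfl, rfl⟩
  · rfl
  · exact hb'.closed
  · exact hb'.closed.symm

theorem IsBoundaryParam.polar {b : ℝ → ℂ} {n : ℕ} (hb : IsBoundaryParam b n) (z : ℂ) :
    ∃ s ∈ Ico (0 : ℝ) n, z = ‖z‖ * b s := by
  by_cases hz : z = 0
  · obtain ⟨s, hs, -⟩ := hb.surj 1 (by simp)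
    exact ⟨s, hs, by simp [hz]⟩
  · obtain ⟨s, hs, h⟩ := hb.surj (z / ‖z‖) (by simp [hz])
    refine ⟨s, hs, ?_⟩
    rw [h]
    field_simp [norm_ne_zero_iff.2 hz]

theorem IsBoundaryParam.mul_eq_mul {b : ℝ → ℂ} {n : ℕ} (hb : IsBoundaryParam b n) {r r' s s' : ℝ}
    (hr : 0 ≤ r) (hr' : 0 ≤ r') (hs : s ∈ Icc (0 : ℝ) n) (hs' : s' ∈ Icc (0 : ℝ) n)
    (h : (r : ℂ) * b s = r' * b s') : r = r' ∧ (r = 0 ∨ b s = b s') := by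
  have h1 : r = r' := by
    have := congrArg (fun z : ℂ => ‖z‖) h
    simpa [hb.norm s hs, hb.norm s' hs', abs_of_nonneg hr, abs_of_nonneg hr'] using this
  subst h1
  refine ⟨rfl, ?_⟩
  rcases mul_eq_mul_left_iff.1 h with h2 | h2
  · exact Or.inr h2
  · exact Or.inl (by exact_mod_cast h2)

theorem mem_Icc_length {w : List δ} {k : ℕ} (hk : k < w.length) {t : ℝ} (ht : t ∈ Icc (0 : ℝ) 1) :
    (k : ℝ) + t ∈ Icc (0 : ℝ) w.length := by
  have : (k : ℝ) + 1 ≤ w.length := by exact_mod_cast hk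
  exact ⟨by have := ht.1; positivity, by linarith [ht.2]⟩

/-- The boundary parametrization of a cell can be chosen at will. -/
theorem BoundsCell.exists_isCell {P : δ → ℝ → X} {w : List δ} {S : Set X} (h : BoundsCell P w S)
    {b' : ℝ → ℂ} (hb' : IsBoundaryParam b' w.length) : ∃ π, IsCell P b' w π S := by
  obtain ⟨b, π, hb, hπ⟩ := h
  set n := w.length with hn
  have hmem : ∀ x : ℝ × ℝ, x ∈ Icc (0 : ℝ) 1 ×ˢ Icc (0 : ℝ) n →
      (x.1 : ℂ) * b x.2 ∈ Metric.closedBall (0 : ℂ) 1 := by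
    rintro ⟨r, s⟩ ⟨hr, hs⟩
    simpa [hb.norm s hs, abs_of_nonneg hr.1] using hr.2
  have hpol : ∀ {b : ℝ → ℂ}, IsBoundaryParam b n →
      ContinuousOn (fun x : ℝ × ℝ => (x.1 : ℂ) * b x.2) (Icc (0 : ℝ) 1 ×ˢ Icc (0 : ℝ) n) := by
    intro b hb
    refine ContinuousOn.mul (by fun_prop) ?_
    exact hb.cont.comp continuousOn_snd fun x hx => hx.2
  -- The change of boundary parameter is extended radially, r·b'(s) ↦ r·b(s), and followed by `π`.
  -- It is well defined because `b` and `b'` make the same identifications.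
  obtain ⟨φ, hφ, hφ'⟩ := exists_continuousOn_descend (K := Icc (0 : ℝ) 1 ×ˢ Icc (0 : ℝ) n)
    (f := fun x : ℝ × ℝ => (x.1 : ℂ) * b' x.2) (g := fun x : ℝ × ℝ => π ((x.1 : ℂ) * b x.2))
    (isCompact_Icc.prod isCompact_Icc) (hpol hb') (hπ.cont.comp (hpol hb) hmem) (by
      rintro ⟨r, s⟩ ⟨hr, hs⟩ ⟨r', s'⟩ ⟨hr', hs'⟩ h
      obtain ⟨h1, h2⟩ := hb'.mul_eq_mul hr.1 hr'.1 hs hs' h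
      simp only at h1 h2 ⊢
      subst h1
      rcases h2 with rfl | h2
      · simp
      · rw [hb'.eq_of_eq hb hs hs' h2])
  have hval : ∀ r ∈ Icc (0 : ℝ) 1, ∀ s ∈ Icc (0 : ℝ) n, φ (r * b' s) = π (r * b s) :=
    fun r hr s hs => hφ' (r, s) ⟨hr, hs⟩
  have hval1 : ∀ s ∈ Icc (0 : ℝ) n, φ (b' s) = π (b s) := fun s hs => by
    simpa using hval 1 (by simp) s hs
  refine ⟨φ, ?_, ?_, ?_, ?_, ?_⟩
  · refine hφ.mono fun z hz => ?_
    obtain ⟨s, hs, h⟩ := hb'.polar z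
    exact ⟨(‖z‖, s), ⟨⟨norm_nonneg _, by simpa using hz⟩, hs.1, hs.2.le⟩, h.symm⟩
  · intro z hz z' hz' h
    obtain ⟨s, hs, e⟩ := hb'.polar z
    obtain ⟨s', hs', e'⟩ := hb'.polar z'
    have hz1 : ‖z‖ < 1 := by simpa using hz
    have hz2 : ‖z'‖ < 1 := by simpa using hz'
    have i1 := Ico_subset_Icc_self hs
    have i2 := Ico_subset_Icc_self hs'
    rw [e, e', hval _ ⟨norm_nonneg _, hz1.le⟩ _ i1, hval _ ⟨norm_nonneg _, hz2.le⟩ _ i2] at h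
    have h3 := hπ.inj (by simpa [hb.norm s i1] using hz1) (by simpa [hb.norm s' i2] using hz2) h
    obtain ⟨h4, h5⟩ := hb.mul_eq_mul (norm_nonneg _) (norm_nonneg _) i1 i2 h3
    rcases h5 with h5 | h5
    · rw [e, e', ← h4, h5]; simp
    · rw [e, e', ← h4, hb.eq_of_eq hb' i1 i2 h5]
  · rw [← hπ.image]
    ext x
    constructor
    · rintro ⟨z, hz, rfl⟩
      have hz1 : ‖z‖ < 1 := by simpa using hz
      obtain ⟨s, hs, e⟩ := hb'.polar z
      have i1 := Ico_subset_Icc_self hs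
      rw [e, hval _ ⟨norm_nonneg _, hz1.le⟩ _ i1]
      exact ⟨_, by simpa [hb.norm s i1] using hz1, rfl⟩
    · rintro ⟨z, hz, rfl⟩
      have hz1 : ‖z‖ < 1 := by simpa using hz
      obtain ⟨s, hs, e⟩ := hb.polar z
      have i1 := Ico_subset_Icc_self hs
      rw [e, ← hval _ ⟨norm_nonneg _, hz1.le⟩ _ i1]
      exact ⟨_, by simpa [hb'.norm s i1] using hz1, rfl⟩
  · intro k hk t ht
    rw [hval1 _ (mem_Icc_length hk ht), hπ.trace k hk t ht]
  · intro z hz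
    obtain ⟨s, hs, rfl⟩ := hb'.surj z hz
    rw [hval1 s (Ico_subset_Icc_self hs)]
    exact hπ.disj _ (hb.norm s (Ico_subset_Icc_self hs))

/-- The point of the upper unit semicircle over `x`. -/
noncomputable def up (x : ℝ) : ℂ := ⟨x, √(1 - x ^ 2)⟩

/-- The point of the lower unit semicircle over `x`. -/
noncomputable def lo (x : ℝ) : ℂ := ⟨x, -√(1 - x ^ 2)⟩

theorem continuous_mk {Y : Type*} [TopologicalSpace Y] {f g : Y → ℝ} (hf : Continuous f)
    (hg : Continuous g) : Continuous fun y => (⟨f y, g y⟩ : ℂ) :=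
  Complex.equivRealProdCLM.symm.continuous.comp (hf.prodMk hg)

@[fun_prop] theorem continuous_up : Continuous up := continuous_mk (by fun_prop) (by fun_prop)

@[fun_prop] theorem continuous_lo : Continuous lo := continuous_mk (by fun_prop) (by fun_prop)

theorem norm_eq_one_iff {z : ℂ} : ‖z‖ = 1 ↔ z.re ^ 2 + z.im ^ 2 = 1 := by
  have h : ‖z‖ ^ 2 = z.re ^ 2 + z.im ^ 2 := by rw [Complex.sq_norm, Complex.normSq_apply]; ring
  rw [← h]
  constructor
  · intro h; rw [h]; norm_num
  · intro h; nlinarith [norm_nonneg z]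

theorem norm_le_one_iff {z : ℂ} : ‖z‖ ≤ 1 ↔ z.re ^ 2 + z.im ^ 2 ≤ 1 := by
  have h : ‖z‖ ^ 2 = z.re ^ 2 + z.im ^ 2 := by rw [Complex.sq_norm, Complex.normSq_apply]; ring
  rw [← h]
  constructor <;> intro h <;> nlinarith [norm_nonneg z]

theorem norm_lt_one_iff {z : ℂ} : ‖z‖ < 1 ↔ z.re ^ 2 + z.im ^ 2 < 1 := by
  have h : ‖z‖ ^ 2 = z.re ^ 2 + z.im ^ 2 := by rw [Complex.sq_norm, Complex.normSq_apply]; ring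
  rw [← h]
  constructor <;> intro h <;> nlinarith [norm_nonneg z]

theorem one_sub_sq_nonneg {x : ℝ} (hx : x ∈ Icc (-1 : ℝ) 1) : 0 ≤ 1 - x ^ 2 := by
  nlinarith [hx.1, hx.2]

theorem norm_up {x : ℝ} (hx : x ∈ Icc (-1 : ℝ) 1) : ‖up x‖ = 1 := by
  rw [norm_eq_one_iff]; simp [up, Real.sq_sqrt (one_sub_sq_nonneg hx)]

theorem norm_lo {x : ℝ} (hx : x ∈ Icc (-1 : ℝ) 1) : ‖lo x‖ = 1 := by
  rw [norm_eq_one_iff]; simp [lo, Real.sq_sqrt (one_sub_sq_nonneg hx)]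

theorem neg_up (x : ℝ) : -up x = lo (-x) := by apply Complex.ext <;> simp [up, lo]

theorem neg_lo (x : ℝ) : -lo x = up (-x) := by apply Complex.ext <;> simp [up, lo]

theorem re_mem_Icc {z : ℂ} (hz : ‖z‖ ≤ 1) : z.re ∈ Icc (-1 : ℝ) 1 := by
  have := norm_le_one_iff.1 hz
  constructor <;> nlinarith [sq_nonneg z.im]

theorem eq_up_re {z : ℂ} (hz : ‖z‖ = 1) (h : 0 ≤ z.im) : z = up z.re := by
  apply Complex.ext
  · rfl
  · have := norm_eq_one_iff.1 hz
    have e : 1 - z.re ^ 2 = z.im ^ 2 := by linarith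
    simp only [up]
    rw [e, Real.sqrt_sq h]

theorem eq_lo_re {z : ℂ} (hz : ‖z‖ = 1) (h : z.im ≤ 0) : z = lo z.re := by
  have h1 := eq_up_re (z := -z) (by simpa using hz) (by simpa using h)
  rw [neg_eq_iff_eq_neg, neg_up] at h1
  simpa using h1

theorem up_neg_one : up (-1) = -1 := by apply Complex.ext <;> simp [up]
theorem up_one : up 1 = 1 := by apply Complex.ext <;> simp [up]
theorem lo_neg_one : lo (-1) = -1 := by apply Complex.ext <;> simp [lo]
theorem lo_one : lo 1 = 1 := by apply Complex.ext <;> simp [lo]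

/-- The circle parametrized by its upper and its lower semicircle, of lengths `m` and `l`. -/
noncomputable def arcs (m l : ℕ) (s : ℝ) : ℂ :=
  if s ≤ m then up (1 - 2 * s / m) else lo (-1 + 2 * (s - m) / l)

theorem isBoundaryParam_arcs {m l : ℕ} (hm : 0 < m) (hl : 0 < l) :
    IsBoundaryParam (arcs m l) (m + l) := by
  have hm' : (0 : ℝ) < m := by exact_mod_cast hm
  have hl' : (0 : ℝ) < l := by exact_mod_cast hl
  have hu : ∀ s : ℝ, 0 ≤ s → s ≤ m → 1 - 2 * s / m ∈ Icc (-1 : ℝ) 1 := fun s h0 h1 => by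
    have a1 : 0 ≤ 2 * s / m := by positivity
    have a2 : 2 * s / m ≤ 2 := by rw [div_le_iff₀ hm']; linarith
    constructor <;> linarith
  have hv : ∀ s : ℝ, m < s → s ≤ m + l → -1 < -1 + 2 * (s - m) / l ∧ -1 + 2 * (s - m) / l ≤ 1 :=
    fun s h0 h1 => by
    have a1 : 0 < 2 * (s - m) / l := by have := sub_pos.2 h0; positivity
    have a2 : 2 * (s - m) / l ≤ 2 := by rw [div_le_iff₀ hl']; linarith
    constructor <;> linarith
  have hv' : ∀ s : ℝ, m < s → s < m + l → -1 + 2 * (s - m) / l < 1 := fun s h0 h1 => by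
    have a2 : 2 * (s - m) / l < 2 := by rw [div_lt_iff₀ hl']; linarith
    linarith
  -- The imaginary part separates the closed upper semicircle from the open lower one.
  have hmix : ∀ s s' : ℝ, 0 ≤ s → s ≤ m → m < s' → s' < m + l →
      up (1 - 2 * s / m) ≠ lo (-1 + 2 * (s' - m) / l) := by
    intro s s' _ _ h3 h4 h
    have e1 := congrArg Complex.re h
    have e2 := congrArg Complex.im h
    simp only [up, lo] at e1 e2
    have := hv s' h3 h4.le
    have := hv' s' h3 h4
    have : 0 < √(1 - (-1 + 2 * (s' - m) / l) ^ 2) := Real.sqrt_pos.2 (by nlinarith)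
    linarith [Real.sqrt_nonneg (1 - (1 - 2 * s / m) ^ 2)]
  refine ⟨?_, ?_, ?_, ?_, ?_⟩
  · refine Continuous.continuousOn ?_
    unfold arcs
    refine Continuous.if_le (by fun_prop) (by fun_prop) continuous_id continuous_const ?_
    rintro s rfl
    have : 1 - 2 * (m : ℝ) / m = -1 := by field_simp; norm_num
    simp only [this, sub_self, mul_zero, zero_div, add_zero, up_neg_one, lo_neg_one]
  · intro s hs
    push_cast at hs
    unfold arcs
    split_ifs with h
    · exact norm_up (hu s hs.1 h)
    · obtain ⟨h1, h2⟩ := hv s (not_le.1 h) hs.2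
      exact norm_lo ⟨h1.le, h2⟩
  · have h2 : ¬ ((m : ℝ) + l ≤ m) := by linarith
    have h3 : -1 + 2 * ((m : ℝ) + l - m) / l = 1 := by field_simp; ring
    simp only [arcs, Nat.cast_add, if_pos hm'.le, if_neg h2, mul_zero, zero_div, sub_zero, up_one,
      h3, lo_one]
  · intro s hs s' hs' h
    push_cast at hs hs'
    unfold arcs at h
    split_ifs at h with h1 h2 h2
    · have := congrArg Complex.re h
      simp only [up] at this
      field_simp at this
      linarith
    · exact absurd h (hmix s s' hs.1 h1 (not_le.1 h2) hs'.2)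
    · exact absurd h.symm (hmix s' s hs'.1 h2 (not_le.1 h1) hs.2)
    · have := congrArg Complex.re h
      simp only [lo] at this
      field_simp at this
      linarith
  · intro z hz
    have hre := re_mem_Icc hz.le
    rcases le_or_gt 0 z.im with h | h
    · have h0 : 0 ≤ (1 - z.re) / 2 := by linarith [hre.2]
      have h1 : (1 - z.re) / 2 ≤ 1 := by linarith [hre.1]
      refine ⟨m * ((1 - z.re) / 2), ⟨by positivity, ?_⟩, ?_⟩
      · push_cast; nlinarith
      · rw [arcs, if_pos (by nlinarith), eq_up_re hz h]
        congr 1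
        simp only [up]
        field_simp; ring
    · have hlt : z.re ^ 2 < 1 := by have := norm_eq_one_iff.1 hz; nlinarith
      have h0 : 0 < (1 + z.re) / 2 := by nlinarith
      have h1 : (1 + z.re) / 2 < 1 := by nlinarith
      refine ⟨m + l * ((1 + z.re) / 2), ⟨by positivity, ?_⟩, ?_⟩
      · push_cast; nlinarith
      · rw [arcs, if_neg (by nlinarith [mul_pos hl' h0]), eq_lo_re hz h.le]
        congr 1
        simp only [lo]
        field_simp; ring

/-- A cell whose boundary is divided into the upper semicircle, along `u`, and the lower one,
along `v`. -/
structure IsBigon (P : δ → ℝ → X) (u v : List δ) (π : ℂ → X) (S : Set X) : Prop where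
  cont : ContinuousOn π (Metric.closedBall 0 1)
  inj : InjOn π (Metric.ball 0 1)
  image : π '' Metric.ball 0 1 = S
  upper : ∀ (k : ℕ) (hk : k < u.length), ∀ t ∈ Icc (0 : ℝ) 1,
    π (up (1 - 2 * (k + t) / u.length)) = P u[k] t
  lower : ∀ (k : ℕ) (hk : k < v.length), ∀ t ∈ Icc (0 : ℝ) 1,
    π (lo (-1 + 2 * (k + t) / v.length)) = P v[k] t
  disj : ∀ z : ℂ, ‖z‖ = 1 → π z ∉ S

theorem arcs_left {m l k : ℕ} (hk : k < m) {t : ℝ} (ht : t ∈ Icc (0 : ℝ) 1) :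
    arcs m l (k + t) = up (1 - 2 * (k + t) / m) := by
  have : (k : ℝ) + 1 ≤ m := by exact_mod_cast hk
  rw [arcs, if_pos (by linarith [ht.2])]

theorem arcs_right {m l k : ℕ} (hm : 0 < m) {t : ℝ} (ht : t ∈ Icc (0 : ℝ) 1) :
    arcs m l ((m + k : ℕ) + t) = lo (-1 + 2 * (k + t) / l) := by
  rw [arcs]
  have hm' : (0 : ℝ) < m := by exact_mod_cast hm
  -- For k = t = 0 the parameter is `m`, where `arcs` takes its upper branch; both branches give −1
  -- there.
  split_ifs with h
  · push_cast at h
    have h0 := ht.1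
    have hk0 : (0 : ℝ) ≤ k := by positivity
    have hk : (k : ℝ) = 0 := by linarith
    have ht : t = 0 := by linarith
    have : 1 - 2 * (m : ℝ) / m = -1 := by field_simp; norm_num
    push_cast
    simp only [hk, ht, add_zero, this, mul_zero, zero_div, up_neg_one, lo_neg_one]
  · congr 3
    push_cast; ring

/-- Splitting the boundary into two semicircles gives explicit formulas for the operations on words:
a rotation becomes z ↦ −z, a fold becomes squaring on a half disc, and a merger glues two half discs
along the diameter. -/
theorem BoundsCell.exists_isBigon {P : δ → ℝ → X} {u v : List δ} {S : Set X}
    (h : BoundsCell P (u ++ v) S) (hu : u ≠ []) (hv : v ≠ []) : ∃ π, IsBigon P u v π S := by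
  have hm := List.length_pos_iff.2 hu
  have hl := List.length_pos_iff.2 hv
  have hb := isBoundaryParam_arcs hm hl
  rw [← List.length_append] at hb
  obtain ⟨π, hπ⟩ := h.exists_isCell hb
  refine ⟨π, hπ.cont, hπ.inj, hπ.image, ?_, ?_, hπ.disj⟩
  · intro k hk t ht
    have := hπ.trace k (by simp; omega) t ht
    rwa [arcs_left hk ht, List.getElem_append_left hk] at this
  · intro k hk t ht
    have := hπ.trace (u.length + k) (by simp; omega) t ht
    rw [arcs_right hm ht, List.getElem_append_right (by omega)] at this
    simpa using this

theorem IsBigon.boundsCell {P : δ → ℝ → X} {u v : List δ} {S : Set X} {π : ℂ → X}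
    (h : IsBigon P u v π S) (hu : u ≠ []) (hv : v ≠ []) : BoundsCell P (u ++ v) S := by
  have hm := List.length_pos_iff.2 hu
  have hl := List.length_pos_iff.2 hv
  have hb := isBoundaryParam_arcs hm hl
  rw [← List.length_append] at hb
  refine ⟨_, π, hb, h.cont, h.inj, h.image, ?_, h.disj⟩
  intro k hk t ht
  by_cases hku : k < u.length
  · rw [arcs_left hku ht, List.getElem_append_left hku, h.upper k hku t ht]
  · obtain ⟨j, rfl⟩ := Nat.exists_eq_add_of_le (not_lt.1 hku)
    rw [List.length_append] at hk
    rw [arcs_right hm ht, List.getElem_append_right (by omega), h.lower j (by omega) t ht]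
    simp

/-- The word of a cell may be rotated. -/
theorem BoundsCell.rotate {P : δ → ℝ → X} {u v : List δ} {S : Set X}
    (h : BoundsCell P (u ++ v) S) : BoundsCell P (v ++ u) S := by
  by_cases hu : u = []
  · simpa [hu] using h
  by_cases hv : v = []
  · simpa [hv] using h
  obtain ⟨π, hπ⟩ := h.exists_isBigon hu hv
  -- A half turn of the disc exchanges the two semicircles and keeps their cyclic direction.
  refine IsBigon.boundsCell (π := fun z => π (-z)) ⟨?_, ?_, ?_, ?_, ?_, ?_⟩ hv hu
  · exact hπ.cont.comp continuous_neg.continuousOn fun z hz => by simpa using hz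
  · intro z hz z' hz' h
    exact neg_injective (hπ.inj (by simpa using hz) (by simpa using hz') h)
  · rw [← hπ.image]
    ext x
    constructor
    · rintro ⟨z, hz, rfl⟩
      exact ⟨-z, by simpa using hz, rfl⟩
    · rintro ⟨z, hz, rfl⟩
      exact ⟨-z, by simpa using hz, by simp⟩
  · intro k hk t ht
    rw [neg_up, ← hπ.lower k hk t ht]
    congr 2; ring
  · intro k hk t ht
    rw [neg_lo, ← hπ.upper k hk t ht]
    congr 2; ring
  · intro z hz
    exact hπ.disj _ (by simpa using hz)

/-- The upper half disc stretched to the disc: the identity on the upper semicircle, the diameter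
goes to the lower one. -/
noncomputable def stretch (z : ℂ) : ℂ := ⟨z.re, 2 * z.im - √(1 - z.re ^ 2)⟩

theorem continuous_stretch : Continuous stretch :=
  continuous_mk Complex.continuous_re (by fun_prop)

theorem stretch_ofReal (x : ℝ) : stretch x = lo x := by simp [stretch, lo]

theorem stretch_up (x : ℝ) : stretch (up x) = up x := by
  apply Complex.ext
  · rfl
  · simp only [stretch, up]; ring

theorem stretch_injective : Function.Injective stretch := by
  intro z z' h
  have h1 := congrArg Complex.re h
  have h2 := congrArg Complex.im h
  simp only [stretch] at h1 h2
  rw [h1] at h2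
  exact Complex.ext h1 (by linarith)

theorem stretch_mem_closedBall {z : ℂ} (hz : ‖z‖ ≤ 1) (h : 0 ≤ z.im) : ‖stretch z‖ ≤ 1 := by
  have h1 := norm_le_one_iff.1 hz
  have h2 : 0 ≤ 1 - z.re ^ 2 := by nlinarith [sq_nonneg z.im]
  have h3 := Real.sq_sqrt h2
  have h4 := Real.sqrt_nonneg (1 - z.re ^ 2)
  have h5 : z.im ≤ √(1 - z.re ^ 2) := Real.le_sqrt_of_sq_le (by linarith)
  rw [norm_le_one_iff]
  simp only [stretch]
  nlinarith

theorem stretch_mem_ball {z : ℂ} (hz : ‖z‖ < 1) (h : 0 < z.im) : ‖stretch z‖ < 1 := by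
  have h1 := norm_lt_one_iff.1 hz
  have h2 : 0 ≤ 1 - z.re ^ 2 := by nlinarith [sq_nonneg z.im]
  have h3 := Real.sq_sqrt h2
  have h4 := Real.sqrt_nonneg (1 - z.re ^ 2)
  have h5 : z.im < √(1 - z.re ^ 2) := Real.lt_sqrt_of_sq_lt (by linarith)
  rw [norm_lt_one_iff]
  simp only [stretch]
  nlinarith

theorem exists_stretch_eq {z : ℂ} (hz : ‖z‖ < 1) : ∃ y : ℂ, ‖y‖ < 1 ∧ 0 < y.im ∧ stretch y = z := by
  have h1 := norm_lt_one_iff.1 hz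
  have h2 : 0 < 1 - z.re ^ 2 := by nlinarith [sq_nonneg z.im]
  have h3 := Real.sq_sqrt h2.le
  have h4 := Real.sqrt_pos.2 h2
  have h5 : |z.im| < √(1 - z.re ^ 2) := Real.lt_sqrt_of_sq_lt (by rw [sq_abs]; linarith)
  obtain ⟨h6, h7⟩ := abs_lt.1 h5
  refine ⟨⟨z.re, (z.im + √(1 - z.re ^ 2)) / 2⟩, ?_, ?_, ?_⟩
  · rw [norm_lt_one_iff]; simp only; nlinarith
  · simp only; linarith
  · apply Complex.ext <;> simp [stretch]; ring

theorem isCompact_upperHalfDisc : IsCompact {z : ℂ | ‖z‖ ≤ 1 ∧ 0 ≤ z.im} := by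
  refine (isCompact_closedBall (0 : ℂ) 1).of_isClosed_subset ?_ fun z hz => by simpa using hz.1
  exact (isClosed_le continuous_norm continuous_const).inter
    (isClosed_le continuous_const Complex.continuous_im)

theorem exists_sq_eq (ζ : ℂ) : ∃ z : ℂ, 0 ≤ z.im ∧ z ^ 2 = ζ := by
  obtain ⟨z, hz⟩ := IsAlgClosed.exists_pow_nat_eq ζ (n := 2) (by norm_num)
  rcases le_total 0 z.im with h | h
  · exact ⟨z, h, hz⟩
  · exact ⟨-z, by simpa using h, by rw [← hz]; ring⟩

/-- Squaring is injective on the closed upper half plane except for the pairs x, −x on the real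
axis. So it turns the upper half disc into a disc in which the diameter has been folded to a radius.
-/
theorem eq_or_of_sq_eq_sq {z z' : ℂ} (h : 0 ≤ z.im) (h' : 0 ≤ z'.im) (e : z ^ 2 = z' ^ 2) :
    z = z' ∨ (z = (z.re : ℂ) ∧ z' = ((-z.re : ℝ) : ℂ)) := by
  rcases sq_eq_sq_iff_eq_or_eq_neg.1 e with e | e
  · exact Or.inl e
  · have h1 := congrArg Complex.im e
    have h2 := congrArg Complex.re e
    simp only [Complex.neg_im, Complex.neg_re] at h1 h2
    refine Or.inr ⟨Complex.ext ?_ ?_, Complex.ext ?_ ?_⟩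
    · simp
    · simp; linarith
    · simp; linarith
    · simp; linarith

theorem norm_sq_le_one_iff {z : ℂ} : ‖z ^ 2‖ ≤ 1 ↔ ‖z‖ ≤ 1 := by
  rw [norm_pow]; exact pow_le_one_iff_of_nonneg (norm_nonneg z) (by norm_num)

theorem norm_sq_lt_one_iff {z : ℂ} : ‖z ^ 2‖ < 1 ↔ ‖z‖ < 1 := by
  rw [norm_pow]; exact pow_lt_one_iff_of_nonneg (norm_nonneg z) (by norm_num)

theorem norm_sq_eq_one_iff {z : ℂ} : ‖z ^ 2‖ = 1 ↔ ‖z‖ = 1 := by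
  rw [norm_pow]; exact pow_eq_one_iff_of_nonneg (norm_nonneg z) (by norm_num)

/-- Squaring doubles the argument: the upper semicircle wraps once around the circle, and its ends
±1 meet at 1. -/
theorem isBoundaryParam_up_sq {m : ℕ} (hm : 0 < m) :
    IsBoundaryParam (fun s => up (1 - 2 * s / m) ^ 2) m := by
  have hm' : (0 : ℝ) < m := by exact_mod_cast hm
  have hu : ∀ s : ℝ, 0 ≤ s → s ≤ m → 1 - 2 * s / m ∈ Icc (-1 : ℝ) 1 := fun s h0 h1 => by
    have a1 : 0 ≤ 2 * s / m := by positivity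
    have a2 : 2 * s / m ≤ 2 := by rw [div_le_iff₀ hm']; linarith
    constructor <;> linarith
  have hend : 1 - 2 * (m : ℝ) / m = -1 := by field_simp; norm_num
  refine ⟨by fun_prop, ?_, ?_, ?_, ?_⟩
  · intro s hs
    rw [norm_sq_eq_one_iff]
    exact norm_up (hu s hs.1 hs.2)
  · simp only [hend, mul_zero, zero_div, sub_zero, up_one, up_neg_one]
    norm_num
  · intro s hs s' hs' h
    simp only at h
    have i : ∀ x, 0 ≤ (up x).im := fun x => Real.sqrt_nonneg _
    rcases eq_or_of_sq_eq_sq (i _) (i _) h with h | ⟨h0, h⟩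
    · have := congrArg Complex.re h
      simp only [up] at this
      field_simp at this
      linarith
    · have h1 := congrArg Complex.re h
      simp only [up, Complex.ofReal_re] at h1
      have h2 := congrArg Complex.im h0
      simp only [up, Complex.ofReal_im] at h2
      rw [Real.sqrt_eq_zero (one_sub_sq_nonneg (hu s hs.1 hs.2.le))] at h2
      field_simp at h1 h2
      have h3 : s * (m - s) = 0 := by linarith
      rcases mul_eq_zero.1 h3 with h3 | h3
      · linarith [hs'.2]
      · linarith [hs.2]
  · intro ζ hζ
    obtain ⟨z, hz, rfl⟩ := exists_sq_eq ζ
    rw [norm_sq_eq_one_iff] at hζ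
    have hre := re_mem_Icc hζ.le
    have aux : ∀ x ∈ Ioc (-1 : ℝ) 1, (m : ℝ) * ((1 - x) / 2) ∈ Ico (0 : ℝ) m ∧
        1 - 2 * (m * ((1 - x) / 2)) / m = x := fun x hx => by
      refine ⟨⟨?_, ?_⟩, by field_simp; ring⟩
      · have : 0 ≤ (1 - x) / 2 := by linarith [hx.2]
        positivity
      · have : (1 - x) / 2 < 1 := by linarith [hx.1]
        nlinarith
    rcases eq_or_lt_of_le hre.1 with h | h
    -- The root −1 corresponds to the excluded parameter `m`; its square is also reached from the
    -- root 1, at parameter 0.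
    · refine ⟨m * ((1 - 1) / 2), (aux 1 (by norm_num)).1, ?_⟩
      simp only [(aux 1 (by norm_num)).2]
      rw [eq_up_re hζ hz, ← h, up_one, up_neg_one]
      norm_num
    · refine ⟨m * ((1 - z.re) / 2), (aux _ ⟨h, hre.2⟩).1, ?_⟩
      simp only [(aux _ ⟨h, hre.2⟩).2]
      rw [← eq_up_re hζ hz]

theorem exists_eq_one_sub {n : ℕ} (hn : 0 < n) {x : ℝ} (hx : x ∈ Icc (-1 : ℝ) 1) :
    ∃ k, ∃ _ : k < n, ∃ t ∈ Icc (0 : ℝ) 1, x = 1 - 2 * (k + t) / n := by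
  have hn' : (0 : ℝ) < n := by exact_mod_cast hn
  rcases eq_or_lt_of_le hx.1 with h | h
  -- At x = −1 the floor would be the index `n`, which is no letter; the end of the last letter is
  -- used instead.
  · refine ⟨n - 1, by omega, 1, by simp, ?_⟩
    rw [Nat.cast_sub hn, ← h]
    field_simp
    push_cast; ring
  · set s := n * ((1 - x) / 2) with hs
    have h0 : 0 ≤ s := by
      have : 0 ≤ (1 - x) / 2 := by linarith [hx.2]
      positivity
    have h1 : s < n := by
      have : (1 - x) / 2 < 1 := by linarith
      nlinarith
    refine ⟨⌊s⌋₊, (Nat.floor_lt h0).2 h1, s - ⌊s⌋₊, ⟨sub_nonneg.2 (Nat.floor_le h0), ?_⟩, ?_⟩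
    · linarith [Nat.lt_floor_add_one s]
    · rw [add_sub_cancel, hs]; field_simp; ring

theorem one_sub_mem_Icc {n k : ℕ} (hk : k < n) {t : ℝ} (ht : t ∈ Icc (0 : ℝ) 1) :
    1 - 2 * ((k : ℝ) + t) / n ∈ Icc (-1 : ℝ) 1 := by
  have hn' : (0 : ℝ) < n := by exact_mod_cast (Nat.zero_le k).trans_lt hk
  have hk' : (k : ℝ) + 1 ≤ n := by exact_mod_cast hk
  have a1 : 0 ≤ 2 * ((k : ℝ) + t) / n := by have := ht.1; positivity
  have a2 : 2 * ((k : ℝ) + t) / n ≤ 2 := by rw [div_le_iff₀ hn']; linarith [ht.2]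
  constructor <;> linarith

/-- An adjacent pair of mutually inverse letters can be folded into the interior of the cell. -/
theorem BoundsCell.fold {P : δ → ℝ → X} {w : List δ} {d d' : δ} {S : Set X}
    (h : BoundsCell P (w ++ [d, d']) S) (hw : w ≠ [])
    (hd : ∀ t ∈ Icc (0 : ℝ) 1, P d' t = P d (1 - t)) (hinj : InjOn (P d) (Ioc 0 1))
    (hdisj : ∀ t ∈ Ioc (0 : ℝ) 1, ∀ e ∈ w, ∀ t' ∈ Icc (0 : ℝ) 1, P e t' ≠ P d t) :
    BoundsCell P w (S ∪ P d '' Ioc 0 1) := by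
  obtain ⟨π, hπ⟩ := h.exists_isBigon hw (by simp)
  have hm := List.length_pos_iff.2 hw
  -- Along the diameter the path `d` is run from −1 to 0 and run back from 0 to 1, so opposite
  -- points of the diameter agree. The tip `P d 1` sits at the centre, and only `P d 0` stays on the
  -- boundary.
  have hdiam : ∀ x ∈ Icc (-1 : ℝ) 1, π (stretch x) = P d (1 - |x|) := by
    intro x hx
    rw [stretch_ofReal]
    rcases le_total x 0 with h0 | h0
    · have := hπ.lower 0 (by simp) (1 + x) ⟨by linarith [hx.1], by linarith⟩
      simp only [List.length_cons, List.length_nil, List.getElem_cons_zero] at this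
      rw [abs_of_nonpos h0, sub_neg_eq_add, ← this]
      congr 2; push_cast; ring
    · have := hπ.lower 1 (by simp) x ⟨h0, hx.2⟩
      simp only [List.length_cons, List.length_nil, List.getElem_cons_succ,
        List.getElem_cons_zero] at this
      rw [abs_of_nonneg h0, ← hd x ⟨h0, hx.2⟩, ← this]
      congr 2; push_cast; ring
  -- The new cell is z² ↦ π (stretch z); squaring identifies exactly the points of the diameter that
  -- `hdiam` allows.
  obtain ⟨φ, hφ, hφ'⟩ := exists_continuousOn_descend isCompact_upperHalfDisc
    (f := fun z : ℂ => z ^ 2) (g := fun z => π (stretch z)) (by fun_prop)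
    (hπ.cont.comp continuous_stretch.continuousOn fun z hz => by
      simpa using stretch_mem_closedBall hz.1 hz.2) (by
      rintro z ⟨hz, hz0⟩ z' ⟨hz', hz0'⟩ e
      rcases eq_or_of_sq_eq_sq hz0 hz0' e with e | ⟨e1, e2⟩
      · rw [e]
      · have hre := re_mem_Icc hz
        rw [e2, e1, hdiam _ (by simpa using hre), hdiam _ ⟨by simpa using hre.2, by
          simpa using neg_le.1 hre.1⟩]
        simp)
  have hslit : ∀ t ∈ Ioc (0 : ℝ) 1, P d t ∉ S := by
    intro t ht
    have := hdiam (1 - t) ⟨by linarith [ht.2], by linarith [ht.1]⟩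
    rw [abs_of_nonneg (by linarith [ht.2]), sub_sub_cancel, stretch_ofReal] at this
    rw [← this]
    exact hπ.disj _ (norm_lo ⟨by linarith [ht.2], by linarith [ht.1]⟩)
  have hin : ∀ z : ℂ, ‖z‖ < 1 → 0 < z.im → π (stretch z) ∈ S := fun z h1 h2 => by
    rw [← hπ.image]; exact ⟨_, by simpa using stretch_mem_ball h1 h2, rfl⟩
  have hreal : ∀ z : ℂ, ‖z‖ < 1 → 0 = z.im →
      1 - |z.re| ∈ Ioc (0 : ℝ) 1 ∧ π (stretch z) = P d (1 - |z.re|) := fun z h1 h2 => by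
    have e : z = (z.re : ℂ) := Complex.ext (by simp) (by simp [← h2])
    have h3 : |z.re| < 1 := by
      rw [e, Complex.norm_real] at h1; exact h1
    refine ⟨⟨by linarith, by linarith [abs_nonneg z.re]⟩, ?_⟩
    rw [← hdiam z.re (abs_le.1 h3.le), ← e]
  refine ⟨_, φ, isBoundaryParam_up_sq hm, ?_, ?_, ?_, ?_, ?_⟩
  · refine hφ.mono fun ζ hζ => ?_
    obtain ⟨z, hz, rfl⟩ := exists_sq_eq ζ
    exact ⟨z, ⟨norm_sq_le_one_iff.1 (by simpa using hζ), hz⟩, rfl⟩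
  · intro ζ hζ ζ' hζ' e
    obtain ⟨z, hz, rfl⟩ := exists_sq_eq ζ
    obtain ⟨z', hz', rfl⟩ := exists_sq_eq ζ'
    have n1 : ‖z‖ < 1 := norm_sq_lt_one_iff.1 (by simpa using hζ)
    have n2 : ‖z'‖ < 1 := norm_sq_lt_one_iff.1 (by simpa using hζ')
    rw [hφ' z ⟨n1.le, hz⟩, hφ' z' ⟨n2.le, hz'⟩] at e
    rcases eq_or_lt_of_le hz with hz | hz <;> rcases eq_or_lt_of_le hz' with hz' | hz'
    · obtain ⟨i1, e1⟩ := hreal z n1 hz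
      obtain ⟨i2, e2⟩ := hreal z' n2 hz'
      rw [e1, e2] at e
      have := hinj i1 i2 e
      have h3 : |z.re| = |z'.re| := by linarith
      have h4 : z.re ^ 2 = z'.re ^ 2 := by rw [← sq_abs, h3, sq_abs]
      apply Complex.ext <;> simp [pow_two, ← hz, ← hz']
      nlinarith
    · obtain ⟨i1, e1⟩ := hreal z n1 hz
      exact absurd (hin z' n2 hz') (by rw [← e, e1]; exact hslit _ i1)
    · obtain ⟨i1, e1⟩ := hreal z' n2 hz'
      exact absurd (hin z n1 hz) (by rw [e, e1]; exact hslit _ i1)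
    · have := hπ.inj (by simpa using stretch_mem_ball n1 hz)
        (by simpa using stretch_mem_ball n2 hz') e
      rw [stretch_injective this]
  · ext x
    constructor
    · rintro ⟨ζ, hζ, rfl⟩
      obtain ⟨z, hz, rfl⟩ := exists_sq_eq ζ
      have n1 : ‖z‖ < 1 := norm_sq_lt_one_iff.1 (by simpa using hζ)
      rw [hφ' z ⟨n1.le, hz⟩]
      rcases eq_or_lt_of_le hz with hz | hz
      · obtain ⟨i1, e1⟩ := hreal z n1 hz
        exact Or.inr ⟨_, i1, e1.symm⟩
      · exact Or.inl (hin z n1 hz)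
    · rintro (hx | ⟨t, ht, rfl⟩)
      · rw [← hπ.image] at hx
        obtain ⟨y, hy, rfl⟩ := hx
        obtain ⟨z, hz, hz', rfl⟩ := exists_stretch_eq (z := y) (by simpa using hy)
        refine ⟨z ^ 2, by simpa using hz, ?_⟩
        exact hφ' z ⟨hz.le, hz'.le⟩
      · have n1 : ‖((1 - t : ℝ) : ℂ)‖ < 1 := by
          rw [Complex.norm_real, Real.norm_eq_abs, abs_of_nonneg (by linarith [ht.2])]
          linarith [ht.1]
        refine ⟨((1 - t : ℝ) : ℂ) ^ 2, by simpa using norm_sq_lt_one_iff.2 n1, ?_⟩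
        have := hφ' ((1 - t : ℝ) : ℂ) ⟨n1.le, by simp⟩
        rw [this, (hreal _ n1 (by simp)).2]
        simp only [Complex.ofReal_re]
        rw [abs_of_nonneg (by linarith [ht.2]), sub_sub_cancel]
  · intro k hk t ht
    have h1 := mem_Icc_length hk ht
    have hm' : (0 : ℝ) < w.length := by exact_mod_cast hm
    have h2 : 1 - 2 * ((k : ℝ) + t) / w.length ∈ Icc (-1 : ℝ) 1 := by
      have a1 : 0 ≤ 2 * ((k : ℝ) + t) / w.length := by have := h1.1; positivity
      have a2 : 2 * ((k : ℝ) + t) / w.length ≤ 2 := by rw [div_le_iff₀ hm']; linarith [h1.2]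
      constructor <;> linarith
    rw [hφ' (up _) ⟨(norm_up h2).le, Real.sqrt_nonneg _⟩, stretch_up, hπ.upper k hk t ht]
  · intro ζ hζ
    obtain ⟨s, hs, e⟩ := (isBoundaryParam_up_sq hm).surj ζ hζ
    have hk : ⌊s⌋₊ < w.length := (Nat.floor_lt hs.1).2 hs.2
    have ht : s - ⌊s⌋₊ ∈ Icc (0 : ℝ) 1 :=
      ⟨sub_nonneg.2 (Nat.floor_le hs.1), by linarith [Nat.lt_floor_add_one s]⟩
    have hm' : (0 : ℝ) < w.length := by exact_mod_cast hm
    have h2 : 1 - 2 * s / w.length ∈ Icc (-1 : ℝ) 1 := by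
      have a1 : 0 ≤ 2 * s / w.length := by have := hs.1; positivity
      have a2 : 2 * s / w.length ≤ 2 := by rw [div_le_iff₀ hm']; linarith [hs.2]
      constructor <;> linarith
    have e2 : φ ζ = π (up (1 - 2 * s / w.length)) := by
      rw [← e, hφ' (up _) ⟨(norm_up h2).le, Real.sqrt_nonneg _⟩, stretch_up]
    have e3 := hπ.upper _ hk _ ht
    rw [add_sub_cancel] at e3
    rintro (h3 | ⟨t', ht', h3⟩)
    · rw [e2] at h3
      exact hπ.disj _ (norm_up h2) h3
    · rw [e2, e3] at h3
      exact hdisj t' ht' _ (List.getElem_mem hk) _ ht h3.symm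

/-- Two cells with a common edge merge to one. -/
theorem BoundsCell.merge {P : δ → ℝ → X} {u v : List δ} {d d' : δ} {S T : Set X}
    (hS : BoundsCell P (u ++ [d]) S) (hT : BoundsCell P (v ++ [d']) T) (hu : u ≠ []) (hv : v ≠ [])
    (hd : ∀ t ∈ Icc (0 : ℝ) 1, P d' t = P d (1 - t)) (hinj : InjOn (P d) (Ioo 0 1))
    (hST : Disjoint S T)
    (huT : ∀ e ∈ u, ∀ t ∈ Icc (0 : ℝ) 1, P e t ∉ T) (hvS : ∀ e ∈ v, ∀ t ∈ Icc (0 : ℝ) 1, P e t ∉ S)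
    (hdisj : ∀ t ∈ Ioo (0 : ℝ) 1, ∀ e ∈ u ++ v, ∀ t' ∈ Icc (0 : ℝ) 1, P e t' ≠ P d t) :
    BoundsCell P (u ++ v) (S ∪ T ∪ P d '' Ioo 0 1) := by
  obtain ⟨π, hπ⟩ := hS.exists_isBigon hu (by simp)
  obtain ⟨ρ, hρ⟩ := hT.exists_isBigon hv (by simp)
  have hdiam : ∀ x ∈ Icc (-1 : ℝ) 1, π (stretch x) = P d ((1 + x) / 2) := by
    intro x hx
    have := hπ.lower 0 (by simp) ((1 + x) / 2) ⟨by linarith [hx.1], by linarith [hx.2]⟩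
    simp only [List.length_cons, List.length_nil, List.getElem_cons_zero] at this
    rw [stretch_ofReal, ← this]
    congr 2; push_cast; ring
  have hdiam' : ∀ x ∈ Icc (-1 : ℝ) 1, ρ (stretch (-x : ℝ)) = P d ((1 + x) / 2) := by
    intro x hx
    have i : (1 - x) / 2 ∈ Icc (0 : ℝ) 1 := ⟨by linarith [hx.2], by linarith [hx.1]⟩
    have := hρ.lower 0 (by simp) ((1 - x) / 2) i
    simp only [List.length_cons, List.length_nil, List.getElem_cons_zero] at this
    rw [hd _ i] at this
    rw [stretch_ofReal, show (1 + x) / 2 = 1 - (1 - x) / 2 by ring, ← this]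
    congr 2; push_cast; ring
  have hSd : ∀ t ∈ Icc (0 : ℝ) 1, P d t ∉ S := by
    intro t ht
    have i : 2 * t - 1 ∈ Icc (-1 : ℝ) 1 := ⟨by linarith [ht.1], by linarith [ht.2]⟩
    have := hdiam (2 * t - 1) i
    rw [stretch_ofReal, show (1 + (2 * t - 1)) / 2 = t by ring] at this
    rw [← this]; exact hπ.disj _ (norm_lo i)
  have hTd : ∀ t ∈ Icc (0 : ℝ) 1, P d t ∉ T := by
    intro t ht
    have i : 2 * t - 1 ∈ Icc (-1 : ℝ) 1 := ⟨by linarith [ht.1], by linarith [ht.2]⟩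
    have := hdiam' (2 * t - 1) i
    rw [stretch_ofReal, show (1 + (2 * t - 1)) / 2 = t by ring] at this
    rw [← this]; exact hρ.disj _ (norm_lo ⟨by linarith [i.2], by linarith [i.1]⟩)
  have hinS : ∀ z : ℂ, ‖z‖ < 1 → 0 < z.im → π (stretch z) ∈ S := fun z h1 h2 => by
    rw [← hπ.image]; exact ⟨_, by simpa using stretch_mem_ball h1 h2, rfl⟩
  have hinT : ∀ z : ℂ, ‖z‖ < 1 → z.im < 0 → ρ (stretch (-z)) ∈ T := fun z h1 h2 => by
    rw [← hρ.image]
    exact ⟨_, by simpa using stretch_mem_ball (z := -z) (by simpa using h1) (by simpa using h2),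
      rfl⟩
  have hreal : ∀ z : ℂ, ‖z‖ ≤ 1 → z.im = 0 → π (stretch z) = P d ((1 + z.re) / 2) ∧
      ρ (stretch (-z)) = P d ((1 + z.re) / 2) := fun z h1 h2 => by
    have e : z = (z.re : ℂ) := Complex.ext (by simp) (by simp [h2])
    have e' : -z = ((-z.re : ℝ) : ℂ) := by rw [e]; simp
    refine ⟨?_, ?_⟩
    · conv_lhs => rw [e]
      exact hdiam _ (re_mem_Icc h1)
    · rw [e', hdiam' _ (re_mem_Icc h1)]
  have hI : ∀ z : ℂ, ‖z‖ < 1 → z.im = 0 → (1 + z.re) / 2 ∈ Ioo (0 : ℝ) 1 := fun z h1 h2 => by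
    have := norm_lt_one_iff.1 h1
    rw [h2] at this
    constructor <;> nlinarith
  -- The upper half disc carries the first cell and the lower one the second, turned by a half turn.
  -- They agree on the diameter because `d'` is `d` reversed.
  set φ : ℂ → X := fun z => if 0 ≤ z.im then π (stretch z) else ρ (stretch (-z)) with hφ
  have hpos : ∀ z : ℂ, 0 ≤ z.im → φ z = π (stretch z) := fun z h => if_pos h
  have hneg : ∀ z : ℂ, ‖z‖ ≤ 1 → z.im ≤ 0 → φ z = ρ (stretch (-z)) := fun z h1 h => by
    rcases eq_or_lt_of_le h with h | h
    · rw [hpos z h.ge, (hreal z h1 h).1, (hreal z h1 h).2]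
    · exact if_neg (not_le.2 h)
  have hcont : ContinuousOn φ (Metric.closedBall 0 1) := by
    have e : Metric.closedBall (0 : ℂ) 1 = {z : ℂ | ‖z‖ ≤ 1 ∧ 0 ≤ z.im} ∪
        {z : ℂ | ‖z‖ ≤ 1 ∧ z.im ≤ 0} := by
      ext z
      simp only [mem_closedBall_zero_iff, mem_union, mem_ofPred_eq]
      have := le_total 0 z.im
      tauto
    rw [e]
    refine ContinuousOn.union_of_isClosed ?_ ?_ ?_ ?_
    · refine ContinuousOn.congr (f := fun z => π (stretch z)) ?_ fun z hz => hpos z hz.2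
      exact hπ.cont.comp continuous_stretch.continuousOn fun z hz => by
        simpa using stretch_mem_closedBall hz.1 hz.2
    · refine ContinuousOn.congr (f := fun z => ρ (stretch (-z))) ?_ fun z hz => hneg z hz.1 hz.2
      exact hρ.cont.comp (continuous_stretch.comp continuous_neg).continuousOn fun z hz => by
        simpa using stretch_mem_closedBall (z := -z) (by simpa using hz.1) (by simpa using hz.2)
    · exact (isClosed_le continuous_norm continuous_const).inter
        (isClosed_le continuous_const Complex.continuous_im)
    · exact (isClosed_le continuous_norm continuous_const).inter
        (isClosed_le Complex.continuous_im continuous_const)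
  refine IsBigon.boundsCell (π := φ) ⟨hcont, ?_, ?_, ?_, ?_, ?_⟩ hu hv
  · intro z hz z' hz' e
    have n1 : ‖z‖ < 1 := by simpa using hz
    have n2 : ‖z'‖ < 1 := by simpa using hz'
    -- Points below, on and above the diameter go to `T`, to the path `d` and to `S`, which are
    -- disjoint in pairs; each stratum is mapped injectively.
    rcases lt_trichotomy z.im 0 with h1 | h1 | h1 <;>
      rcases lt_trichotomy z'.im 0 with h2 | h2 | h2
    · rw [hneg z n1.le h1.le, hneg z' n2.le h2.le] at e
      have := hρ.inj
        (by simpa using stretch_mem_ball (z := -z) (by simpa using n1) (by simpa using h1))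
        (by simpa using stretch_mem_ball (z := -z') (by simpa using n2) (by simpa using h2)) e
      exact neg_injective (stretch_injective this)
    · rw [hneg z n1.le h1.le, hpos z' h2.ge, (hreal z' n2.le h2).1] at e
      exact absurd (hinT z n1 h1) (by rw [e]; exact hTd _ (Ioo_subset_Icc_self (hI _ n2 h2)))
    · rw [hneg z n1.le h1.le, hpos z' h2.le] at e
      exact absurd (hinT z n1 h1) (by rw [e]; exact hST.notMem_of_mem_left (hinS z' n2 h2))
    · rw [hpos z h1.ge, hneg z' n2.le h2.le, (hreal z n1.le h1).1] at e
      exact absurd (hinT z' n2 h2) (by rw [← e]; exact hTd _ (Ioo_subset_Icc_self (hI _ n1 h1)))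
    · rw [hpos z h1.ge, hpos z' h2.ge, (hreal z n1.le h1).1, (hreal z' n2.le h2).1] at e
      have := hinj (hI _ n1 h1) (hI _ n2 h2) e
      exact Complex.ext (by linarith) (by rw [h1, h2])
    · rw [hpos z h1.ge, hpos z' h2.le, (hreal z n1.le h1).1] at e
      exact absurd (hinS z' n2 h2) (by rw [← e]; exact hSd _ (Ioo_subset_Icc_self (hI _ n1 h1)))
    · rw [hpos z h1.le, hneg z' n2.le h2.le] at e
      exact absurd (hinT z' n2 h2) (by rw [← e]; exact hST.notMem_of_mem_left (hinS z n1 h1))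
    · rw [hpos z h1.le, hpos z' h2.ge, (hreal z' n2.le h2).1] at e
      exact absurd (hinS z n1 h1) (by rw [e]; exact hSd _ (Ioo_subset_Icc_self (hI _ n2 h2)))
    · rw [hpos z h1.le, hpos z' h2.le] at e
      exact stretch_injective (hπ.inj (by simpa using stretch_mem_ball n1 h1)
        (by simpa using stretch_mem_ball n2 h2) e)
  · ext x
    constructor
    · rintro ⟨z, hz, rfl⟩
      have n1 : ‖z‖ < 1 := by simpa using hz
      rcases lt_trichotomy z.im 0 with h1 | h1 | h1
      · rw [hneg z n1.le h1.le]; exact Or.inl (Or.inr (hinT z n1 h1))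
      · rw [hpos z h1.ge, (hreal z n1.le h1).1]; exact Or.inr ⟨_, hI z n1 h1, rfl⟩
      · rw [hpos z h1.le]; exact Or.inl (Or.inl (hinS z n1 h1))
    · rintro ((hx | hx) | ⟨t, ht, rfl⟩)
      · rw [← hπ.image] at hx
        obtain ⟨y, hy, rfl⟩ := hx
        obtain ⟨z, hz, hz', rfl⟩ := exists_stretch_eq (z := y) (by simpa using hy)
        exact ⟨z, by simpa using hz, hpos z hz'.le⟩
      · rw [← hρ.image] at hx
        obtain ⟨y, hy, rfl⟩ := hx
        obtain ⟨z, hz, hz', rfl⟩ := exists_stretch_eq (z := y) (by simpa using hy)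
        refine ⟨-z, by simpa using hz, ?_⟩
        rw [hneg (-z) (by simpa using hz.le) (by simpa using hz'.le), neg_neg]
      · have n1 : ‖((2 * t - 1 : ℝ) : ℂ)‖ < 1 := by
          rw [Complex.norm_real, Real.norm_eq_abs, abs_lt]
          constructor <;> linarith [ht.1, ht.2]
        refine ⟨((2 * t - 1 : ℝ) : ℂ), by simpa using n1, ?_⟩
        rw [hpos _ (by simp), (hreal _ n1.le (by simp)).1]
        simp
  · intro k hk t ht
    rw [hpos _ (Real.sqrt_nonneg _), stretch_up, hπ.upper k hk t ht]
  · intro k hk t ht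
    have h1 := mem_Icc_length hk ht
    have hm' : (0 : ℝ) < v.length := by exact_mod_cast List.length_pos_iff.2 hv
    have h2 : -1 + 2 * ((k : ℝ) + t) / v.length ∈ Icc (-1 : ℝ) 1 := by
      have a1 : 0 ≤ 2 * ((k : ℝ) + t) / v.length := by have := h1.1; positivity
      have a2 : 2 * ((k : ℝ) + t) / v.length ≤ 2 := by rw [div_le_iff₀ hm']; linarith [h1.2]
      constructor <;> linarith
    rw [hneg _ (norm_lo h2).le (by simp [lo]), neg_lo, stretch_up, ← hρ.upper k hk t ht]
    congr 2; ring
  · intro z hz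
    have hre := re_mem_Icc hz.le
    rcases le_total 0 z.im with h | h
    · obtain ⟨k, hk, t, ht, e⟩ := exists_eq_one_sub (List.length_pos_iff.2 hu) hre
      have e1 : φ z = P u[k] t := by
        rw [eq_up_re hz h, hpos _ (Real.sqrt_nonneg _), stretch_up, e, hπ.upper k hk t ht]
      have e2 : π z = P u[k] t := by
        rw [eq_up_re hz h, e, hπ.upper k hk t ht]
      rintro ((h3 | h3) | ⟨t', ht', h3⟩)
      · rw [e1, ← e2] at h3; exact hπ.disj z hz h3
      · rw [e1] at h3; exact huT _ (List.getElem_mem hk) t ht h3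
      · rw [e1] at h3
        exact hdisj t' ht' _ (List.mem_append_left _ (List.getElem_mem hk)) t ht h3.symm
    · have hz' : ‖-z‖ = 1 := by simpa using hz
      obtain ⟨k, hk, t, ht, e⟩ := exists_eq_one_sub (List.length_pos_iff.2 hv) (re_mem_Icc hz'.le)
      have h' : 0 ≤ (-z).im := by simpa using h
      have e1 : φ z = P v[k] t := by
        rw [hneg z hz.le h, eq_up_re hz' h', stretch_up, e, hρ.upper k hk t ht]
      have e2 : ρ (-z) = P v[k] t := by
        rw [eq_up_re hz' h', e, hρ.upper k hk t ht]
      rintro ((h3 | h3) | ⟨t', ht', h3⟩)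
      · rw [e1] at h3; exact hvS _ (List.getElem_mem hk) t ht h3
      · rw [e1, ← e2] at h3; exact hρ.disj _ hz' h3
      · rw [e1] at h3
        exact hdisj t' ht' _ (List.mem_append_right _ (List.getElem_mem hk)) t ht h3.symm

end Cells

/-! ### Recognition of the model spaces -/

section Models

variable {X δ : Type*} [TopologicalSpace X]

/-- The induced map from the compact quotient to the Hausdorff space is a continuous bijection.
Injectivity is asked for in the quotient, because `r` only generates the equivalence relation. -/
theorem nonempty_homeomorph_quot {K Y : Type*} [TopologicalSpace K] [CompactSpace K]
    [TopologicalSpace Y] [T2Space Y] {f : K → Y} (hf : Continuous f) (hs : Function.Surjective f)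
    (r : K → K → Prop) (h1 : ∀ a b, r a b → f a = f b)
    (h2 : ∀ a b, f a = f b → Quot.mk r a = Quot.mk r b) : Nonempty (Y ≃ₜ Quot r) := by
  have hb : Function.Bijective (Quot.lift f h1) := by
    refine ⟨?_, fun y => ?_⟩
    · rintro ⟨a⟩ ⟨b⟩ h
      exact h2 a b h
    · obtain ⟨a, rfl⟩ := hs y
      exact ⟨Quot.mk r a, rfl⟩
  have hc : Continuous (Equiv.ofBijective _ hb) := continuous_quot_lift h1 hf
  exact ⟨(hc.homeoOfEquivCompactToT2).symm⟩

/-- The points of the paths of the word `w`. -/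
def trail (P : δ → ℝ → X) (w : List δ) : Set X := {x | ∃ e ∈ w, ∃ t ∈ Icc (0 : ℝ) 1, P e t = x}

theorem IsBigon.image_up {P : δ → ℝ → X} {u v : List δ} {π : ℂ → X} {S : Set X}
    (h : IsBigon P u v π S) (hu : u ≠ []) :
    (fun x => π (up x)) '' Icc (-1 : ℝ) 1 = trail P u := by
  have hm := List.length_pos_iff.2 hu
  ext y
  constructor
  · rintro ⟨x, hx, rfl⟩
    obtain ⟨k, hk, t, ht, rfl⟩ := exists_eq_one_sub hm hx
    exact ⟨u[k], List.getElem_mem hk, t, ht, (h.upper k hk t ht).symm⟩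
  · rintro ⟨e, he, t, ht, rfl⟩
    obtain ⟨k, hk, rfl⟩ := List.getElem_of_mem he
    exact ⟨_, one_sub_mem_Icc hk ht, h.upper k hk t ht⟩

/-- The point of a meridian of the sphere with first coordinate `x`. -/
noncomputable def slit (x : Icc (-1 : ℝ) 1) : S2 :=
  ⟨!₂[(x : ℝ), -√(1 - (x : ℝ) ^ 2), 0], by
    rw [mem_sphere_zero_iff_norm, EuclideanSpace.norm_eq, Real.sqrt_eq_one]
    simp [Fin.sum_univ_three, Real.sq_sqrt (one_sub_sq_nonneg x.2)]⟩

theorem continuous_slit : Continuous slit := by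
  refine Continuous.subtype_mk ?_ _
  refine (PiLp.continuous_toLp 2 _).comp ?_
  refine continuous_pi fun i => ?_
  fin_cases i <;> simp <;> fun_prop

theorem slit_injective : Function.Injective slit := by
  intro x y h
  have := congrArg (fun p : S2 => p.1 0) h
  simpa [slit, Subtype.ext_iff] using this

theorem mem_S2_iff {p : EuclideanSpace ℝ (Fin 3)} :
    p ∈ Metric.sphere (0 : EuclideanSpace ℝ (Fin 3)) 1 ↔ p 0 ^ 2 + p 1 ^ 2 + p 2 ^ 2 = 1 := by
  rw [mem_sphere_zero_iff_norm, EuclideanSpace.norm_eq, Real.sqrt_eq_one]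
  simp [Fin.sum_univ_three]

theorem exists_angle {a b : ℝ} (h : a ^ 2 + b ^ 2 = 1) :
    ∃ t ∈ Icc (-1 : ℝ) 1, Real.cos (Real.pi * t) = a ∧ Real.sin (Real.pi * t) = b := by
  set z : ℂ := ⟨a, b⟩
  have hz : ‖z‖ = 1 := norm_eq_one_iff.2 h
  have hz0 : z ≠ 0 := by rw [← norm_ne_zero_iff, hz]; norm_num
  have hpi := Real.pi_pos
  refine ⟨z.arg / Real.pi, ⟨?_, ?_⟩, ?_, ?_⟩
  · rw [le_div_iff₀ hpi]; linarith [Complex.neg_pi_lt_arg z]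
  · rw [div_le_iff₀ hpi]; linarith [Complex.arg_le_pi z]
  · rw [mul_div_cancel₀ _ hpi.ne', Complex.cos_arg hz0, hz, div_one]
  · rw [mul_div_cancel₀ _ hpi.ne', Complex.sin_arg, hz, div_one]

theorem eq_or_of_angle_eq {t t' : ℝ} (ht : t ∈ Icc (-1 : ℝ) 1) (ht' : t' ∈ Icc (-1 : ℝ) 1)
    (hc : Real.cos (Real.pi * t) = Real.cos (Real.pi * t'))
    (hs : Real.sin (Real.pi * t) = Real.sin (Real.pi * t')) :
    t = t' ∨ (|t| = 1 ∧ |t'| = 1) := by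
  have hpi := Real.pi_pos
  -- The argument takes values in (−π, π] and inverts the angle except at −π, so t = −1 is treated
  -- apart.
  rcases eq_or_lt_of_le ht.1 with h | h
  · rcases eq_or_lt_of_le ht'.1 with h' | h'
    · left; rw [← h, ← h']
    · right
      rw [← h, abs_neg, abs_one]
      refine ⟨rfl, ?_⟩
      rw [← h] at hc hs
      have := Complex.arg_cos_add_sin_mul_I (θ := Real.pi * t') ⟨by nlinarith, by nlinarith [ht'.2]⟩
      rw [← Complex.ofReal_cos, ← Complex.ofReal_sin, ← hc, ← hs] at this
      simp at this
      rw [this, abs_one]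
  · rcases eq_or_lt_of_le ht'.1 with h' | h'
    · right
      rw [← h', abs_neg, abs_one]
      refine ⟨?_, rfl⟩
      rw [← h'] at hc hs
      have := Complex.arg_cos_add_sin_mul_I (θ := Real.pi * t) ⟨by nlinarith, by nlinarith [ht.2]⟩
      rw [← Complex.ofReal_cos, ← Complex.ofReal_sin, hc, hs] at this
      simp at this
      rw [this, abs_one]
    · left
      have h1 := Complex.arg_cos_add_sin_mul_I (θ := Real.pi * t) ⟨by nlinarith, by nlinarith [ht.2]⟩
      have h2 := Complex.arg_cos_add_sin_mul_I (θ := Real.pi * t')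
        ⟨by nlinarith, by nlinarith [ht'.2]⟩
      rw [← Complex.ofReal_cos, ← Complex.ofReal_sin] at h1 h2
      rw [hc, hs, h2] at h1
      exact (mul_left_cancel₀ hpi.ne' h1).symm

/-- A bigon with equal sides closes up to a map from the sphere, the sides becoming the slit. -/
theorem IsBigon.exists_sphere_map {P : δ → ℝ → X} {u v : List δ} {π : ℂ → X} {S : Set X}
    (h : IsBigon P u v π S) (hsym : ∀ x ∈ Icc (-1 : ℝ) 1, π (lo x) = π (up x)) :
    ∃ f : S2 → X, Continuous f ∧ range f = S ∪ (fun x => π (up x)) '' Icc (-1 : ℝ) 1 ∧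
      (∀ x : Icc (-1 : ℝ) 1, f (slit x) = π (up x)) ∧
      ∀ p q, f p = f q → p = q ∨ ∃ x y, p = slit x ∧ q = slit y := by
  set K : Set (ℝ × ℝ) := Icc (-1 : ℝ) 1 ×ˢ Icc (-1 : ℝ) 1
  -- Two coordinate systems on the square K: `E` covers the sphere by circles of latitude about the
  -- first axis, `D` covers the disc by vertical chords. The sides t = ±1 go to the slit under `E`
  -- and to the two semicircles under `D`; equality of the sides of the bigon makes `π ∘ D` descend
  -- along `E`.
  set E : ℝ × ℝ → EuclideanSpace ℝ (Fin 3) := fun y =>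
    !₂[y.1, √(1 - y.1 ^ 2) * Real.cos (Real.pi * y.2), √(1 - y.1 ^ 2) * Real.sin (Real.pi * y.2)]
    with hE
  set D : ℝ × ℝ → ℂ := fun y => ⟨y.1, y.2 * √(1 - y.1 ^ 2)⟩ with hD
  have hEc : Continuous E := by
    refine (PiLp.continuous_toLp 2 _).comp ?_
    refine continuous_pi fun i => ?_
    fin_cases i <;> simp <;> fun_prop
  have hDc : Continuous D := continuous_mk (by fun_prop) (by fun_prop)
  have hDn : ∀ y ∈ K, ‖D y‖ ≤ 1 := by
    rintro ⟨x, t⟩ ⟨hx, ht⟩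
    rw [norm_le_one_iff]
    simp only [hD, mul_pow]
    rw [Real.sq_sqrt (one_sub_sq_nonneg hx)]
    nlinarith [one_sub_sq_nonneg hx, one_sub_sq_nonneg ht]
  have hD1 : ∀ y ∈ K, ‖D y‖ = 1 → √(1 - y.1 ^ 2) = 0 ∨ |y.2| = 1 := by
    rintro ⟨x, t⟩ ⟨hx, ht⟩ hn
    rw [norm_eq_one_iff] at hn
    simp only [hD, mul_pow] at hn
    rw [Real.sq_sqrt (one_sub_sq_nonneg hx)] at hn
    have : (1 - x ^ 2) * (1 - t ^ 2) = 0 := by linarith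
    rcases mul_eq_zero.1 this with h0 | h0
    · left; simp only [h0, Real.sqrt_zero]
    · right
      rw [← sq_eq_sq₀ (abs_nonneg _) zero_le_one, sq_abs]
      simp only; linarith
  have hDbd : ∀ y ∈ K, (√(1 - y.1 ^ 2) = 0 ∨ |y.2| = 1) → π (D y) = π (up y.1) := by
    rintro ⟨x, t⟩ ⟨hx, ht⟩ h0
    simp only at hx ht h0 ⊢
    rcases h0 with h0 | h0
    · have : D (x, t) = up x := by apply Complex.ext <;> simp [hD, up, h0]
      rw [this]
    · rcases eq_or_eq_neg_of_abs_eq h0 with rfl | rfl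
      · have : D (x, 1) = up x := by apply Complex.ext <;> simp [hD, up]
        rw [this]
      · have : D (x, -1) = lo x := by apply Complex.ext <;> simp [hD, lo]
        rw [this, hsym x hx]
  have hEslit : ∀ y (hy : y ∈ K), (√(1 - y.1 ^ 2) = 0 ∨ |y.2| = 1) →
      E y = (slit ⟨y.1, hy.1⟩).1 := by
    rintro ⟨x, t⟩ ⟨hx, ht⟩ h0
    simp only at hx ht h0 ⊢
    rcases h0 with h0 | h0
    · simp [hE, slit, h0]
    · rcases eq_or_eq_neg_of_abs_eq h0 with rfl | rfl <;> simp [hE, slit]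
  have hEeq : ∀ y ∈ K, ∀ y' ∈ K, E y = E y' → y = y' ∨ (y.1 = y'.1 ∧
      (√(1 - y.1 ^ 2) = 0 ∨ |y.2| = 1) ∧ (√(1 - y'.1 ^ 2) = 0 ∨ |y'.2| = 1)) := by
    rintro ⟨x, t⟩ ⟨hx, ht⟩ ⟨x', t'⟩ ⟨hx', ht'⟩ e
    have e0 := congrArg (fun p : EuclideanSpace ℝ (Fin 3) => p 0) e
    have e1 := congrArg (fun p : EuclideanSpace ℝ (Fin 3) => p 1) e
    have e2 := congrArg (fun p : EuclideanSpace ℝ (Fin 3) => p 2) e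
    simp [hE] at e0 e1 e2
    subst e0
    by_cases h0 : √(1 - x ^ 2) = 0
    · exact Or.inr ⟨rfl, Or.inl h0, Or.inl h0⟩
    · replace e1 := mul_left_cancel₀ h0 e1
      replace e2 := mul_left_cancel₀ h0 e2
      rcases eq_or_of_angle_eq ht ht' e1 e2 with rfl | ⟨h1, h2⟩
      · exact Or.inl rfl
      · exact Or.inr ⟨rfl, Or.inr h1, Or.inr h2⟩
  have hEsurj : ∀ p : S2, ∃ y ∈ K, E y = p.1 := by
    rintro ⟨p, hp⟩
    rw [mem_S2_iff] at hp
    have hx : p 0 ∈ Icc (-1 : ℝ) 1 := by constructor <;> nlinarith [sq_nonneg (p 1), sq_nonneg (p 2)]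
    have hx2 := Real.sq_sqrt (one_sub_sq_nonneg hx)
    by_cases h0 : √(1 - p 0 ^ 2) = 0
    · refine ⟨(p 0, 0), ⟨hx, by simp⟩, ?_⟩
      rw [h0] at hx2
      have h1 : p 1 = 0 := by nlinarith [sq_nonneg (p 1), sq_nonneg (p 2)]
      have h2 : p 2 = 0 := by nlinarith [sq_nonneg (p 1), sq_nonneg (p 2)]
      ext i
      fin_cases i <;> simp [hE, h0, h1, h2]
    · obtain ⟨t, ht, hc, hs⟩ := exists_angle (a := p 1 / √(1 - p 0 ^ 2))
        (b := p 2 / √(1 - p 0 ^ 2)) (by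
          rw [div_pow, div_pow, hx2, ← add_div, div_eq_one_iff_eq]
          · linarith
          · rw [← hx2]; positivity)
      refine ⟨(p 0, t), ⟨hx, ht⟩, ?_⟩
      ext i
      fin_cases i
      · simp [hE]
      · simp [hE, hc]; field_simp
      · simp [hE, hs]; field_simp
  obtain ⟨φ, hφ, hφ'⟩ := exists_continuousOn_descend (K := K) (f := E) (g := fun y => π (D y))
    (isCompact_Icc.prod isCompact_Icc) hEc.continuousOn
    (h.cont.comp hDc.continuousOn fun y hy => by simpa using hDn y hy) (by
      intro y hy y' hy' e
      rcases hEeq y hy y' hy' e with rfl | ⟨e0, h1, h2⟩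
      · rfl
      · simp only [hDbd y hy h1, hDbd y' hy' h2, e0])
  have hball : ∀ y ∈ K, ¬ (√(1 - y.1 ^ 2) = 0 ∨ |y.2| = 1) → ‖D y‖ < 1 := fun y hy hn =>
    lt_of_le_of_ne (hDn y hy) fun e => hn (hD1 y hy e)
  have hdisj : ∀ y ∈ K, ∀ y' ∈ K, ¬ (√(1 - y.1 ^ 2) = 0 ∨ |y.2| = 1) →
      (√(1 - y'.1 ^ 2) = 0 ∨ |y'.2| = 1) → π (D y) ≠ π (D y') := by
    intro y hy y' hy' h1 h2 e
    rw [hDbd y' hy' h2] at e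
    refine h.disj _ (norm_up hy'.1) ?_
    rw [← e, ← h.image]
    exact ⟨_, by simpa using hball y hy h1, rfl⟩
  refine ⟨fun p => φ p.1, ?_, ?_, ?_, ?_⟩
  · refine hφ.comp_continuous continuous_subtype_val fun p => ?_
    obtain ⟨y, hy, e⟩ := hEsurj p
    exact ⟨y, hy, e⟩
  · ext a
    constructor
    · rintro ⟨p, rfl⟩
      obtain ⟨y, hy, e⟩ := hEsurj p
      simp only [← e, hφ' y hy]
      by_cases h0 : √(1 - y.1 ^ 2) = 0 ∨ |y.2| = 1
      · exact Or.inr ⟨y.1, hy.1, (hDbd y hy h0).symm⟩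
      · exact Or.inl (by rw [← h.image]; exact ⟨_, by simpa using hball y hy h0, rfl⟩)
    · rintro (ha | ⟨x, hx, rfl⟩)
      · rw [← h.image] at ha
        obtain ⟨z, hz, rfl⟩ := ha
        have hz1 : ‖z‖ < 1 := by simpa using hz
        have hz2 := norm_lt_one_iff.1 hz1
        have hpos : 0 < 1 - z.re ^ 2 := by nlinarith [sq_nonneg z.im]
        have hs := Real.sqrt_pos.2 hpos
        have hs2 := Real.sq_sqrt hpos.le
        have ht : z.im / √(1 - z.re ^ 2) ∈ Icc (-1 : ℝ) 1 := by
          rw [mem_Icc, le_div_iff₀ hs, div_le_iff₀ hs]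
          have : |z.im| ≤ √(1 - z.re ^ 2) := Real.le_sqrt_of_sq_le (by rw [sq_abs]; linarith)
          obtain ⟨h3, h4⟩ := abs_le.1 this
          constructor <;> linarith
        have hy : (z.re, z.im / √(1 - z.re ^ 2)) ∈ K := ⟨re_mem_Icc hz1.le, ht⟩
        have hDz : D (z.re, z.im / √(1 - z.re ^ 2)) = z := by
          apply Complex.ext
          · rfl
          · simp only [hD]; field_simp
        refine ⟨⟨E (z.re, z.im / √(1 - z.re ^ 2)), ?_⟩, ?_⟩
        · rw [mem_S2_iff]
          simp only [hE, PiLp.toLp_apply, Matrix.cons_val]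
          have := Real.sin_sq_add_cos_sq (Real.pi * (z.im / √(1 - z.re ^ 2)))
          rw [mul_pow, mul_pow, hs2]
          linear_combination (1 - z.re ^ 2) * this
        · simp only [hφ' _ hy, hDz]
      · have hy : (x, (1 : ℝ)) ∈ K := ⟨hx, by simp⟩
        refine ⟨slit ⟨x, hx⟩, ?_⟩
        simp only [← hEslit _ hy (Or.inr (by simp)), hφ' _ hy, hDbd _ hy (Or.inr (by simp))]
  · intro x
    have hy : ((x : ℝ), (1 : ℝ)) ∈ K := ⟨x.2, by simp⟩
    have := hEslit _ hy (Or.inr (by simp))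
    simp only [Subtype.coe_eta] at this
    simp only [← this, hφ' _ hy, hDbd _ hy (Or.inr (by simp))]
  · intro p q e
    obtain ⟨y, hy, e1⟩ := hEsurj p
    obtain ⟨y', hy', e2⟩ := hEsurj q
    simp only [← e1, ← e2, hφ' y hy, hφ' y' hy'] at e
    by_cases h1 : √(1 - y.1 ^ 2) = 0 ∨ |y.2| = 1 <;> by_cases h2 : √(1 - y'.1 ^ 2) = 0 ∨ |y'.2| = 1
    · right
      exact ⟨⟨y.1, hy.1⟩, ⟨y'.1, hy'.1⟩, Subtype.ext (by rw [← e1, hEslit y hy h1]),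
        Subtype.ext (by rw [← e2, hEslit y' hy' h2])⟩
    · exact absurd e.symm (hdisj y' hy' y hy h2 h1)
    · exact absurd e (hdisj y hy y' hy' h1 h2)
    · left
      have := h.inj (by simpa using hball y hy h1) (by simpa using hball y' hy' h2) e
      have f0 := congrArg Complex.re this
      have f1 := congrArg Complex.im this
      simp only [hD] at f0 f1
      rw [f0] at f1
      have f2 : y.2 = y'.2 := mul_right_cancel₀ (fun h0 => h2 (Or.inl h0)) f1
      apply Subtype.ext
      rw [← e1, ← e2, Prod.ext f0 f2]

/-- The letters of `u`, taken without their endpoints, run through distinct points. -/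
def IsSimpleLoop (P : δ → ℝ → X) (u : List δ) : Prop :=
  ∀ (j k : ℕ) (hj : j < u.length) (hk : k < u.length), ∀ s ∈ Ico (0 : ℝ) 1, ∀ t ∈ Ico (0 : ℝ) 1,
    P u[j] s = P u[k] t → j = k ∧ s = t

theorem exists_eq_one_sub_of_lt {n : ℕ} (hn : 0 < n) {x : ℝ} (hx : x ∈ Ioc (-1 : ℝ) 1) :
    ∃ k, ∃ _ : k < n, ∃ t ∈ Ico (0 : ℝ) 1, x = 1 - 2 * (k + t) / n := by
  have hn' : (0 : ℝ) < n := by exact_mod_cast hn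
  set s := n * ((1 - x) / 2) with hs
  have h0 : 0 ≤ s := by
    have : 0 ≤ (1 - x) / 2 := by linarith [hx.2]
    positivity
  have h1 : s < n := by
    have : (1 - x) / 2 < 1 := by linarith [hx.1]
    nlinarith
  refine ⟨⌊s⌋₊, (Nat.floor_lt h0).2 h1, s - ⌊s⌋₊, ⟨sub_nonneg.2 (Nat.floor_le h0), ?_⟩, ?_⟩
  · linarith [Nat.lt_floor_add_one s]
  · rw [add_sub_cancel, hs]; field_simp; ring

/-- The end −1 is left out, because it is the end of the last letter, about which `IsSimpleLoop`
says nothing. For a loop it coincides with the image of 1. -/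
theorem IsBigon.up_injOn {P : δ → ℝ → X} {u v : List δ} {π : ℂ → X} {S : Set X}
    (h : IsBigon P u v π S) (hu : u ≠ []) (hs : IsSimpleLoop P u) :
    InjOn (fun x => π (up x)) (Ioc (-1 : ℝ) 1) := by
  have hm := List.length_pos_iff.2 hu
  intro x hx y hy e
  obtain ⟨k, hk, t, ht, rfl⟩ := exists_eq_one_sub_of_lt hm hx
  obtain ⟨j, hj, r, hr, rfl⟩ := exists_eq_one_sub_of_lt hm hy
  simp only [h.upper k hk t (Ico_subset_Icc_self ht),
    h.upper j hj r (Ico_subset_Icc_self hr)] at e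
  obtain ⟨rfl, rfl⟩ := hs k j hk hj t ht r hr e
  rfl

/-- The word d d⁻¹ closes the bigon up to a sphere, and since `d` is an embedded arc nothing is
identified along the slit. -/
theorem nonempty_homeomorph_sphere [T2Space X] {P : δ → ℝ → X} {d d' : δ} {S : Set X}
    (h : BoundsCell P [d, d'] S) (hd : ∀ t ∈ Icc (0 : ℝ) 1, P d' t = P d (1 - t))
    (hinj : InjOn (P d) (Icc 0 1)) : Nonempty (↥(S ∪ trail P [d]) ≃ₜ S2) := by
  obtain ⟨π, hπ⟩ := BoundsCell.exists_isBigon (u := [d]) (v := [d']) h (by simp) (by simp)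
  have hup : ∀ x ∈ Icc (-1 : ℝ) 1, π (up x) = P d ((1 - x) / 2) := fun x hx => by
    have := hπ.upper 0 (by simp) ((1 - x) / 2) ⟨by linarith [hx.2], by linarith [hx.1]⟩
    simp only [List.length_cons, List.length_nil, List.getElem_cons_zero] at this
    rw [← this]
    congr 2; push_cast; ring
  have hlo : ∀ x ∈ Icc (-1 : ℝ) 1, π (lo x) = π (up x) := fun x hx => by
    have i : (1 + x) / 2 ∈ Icc (0 : ℝ) 1 := ⟨by linarith [hx.1], by linarith [hx.2]⟩
    have := hπ.lower 0 (by simp) ((1 + x) / 2) i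
    simp only [List.length_cons, List.length_nil, List.getElem_cons_zero] at this
    rw [hd _ i] at this
    rw [hup x hx, show (1 - x) / 2 = 1 - (1 + x) / 2 by ring, ← this]
    congr 2; push_cast; ring
  obtain ⟨f, hf, hr, hsl, hinj'⟩ := hπ.exists_sphere_map hlo
  rw [hπ.image_up (by simp)] at hr
  have hfi : Function.Injective f := by
    intro p q e
    rcases hinj' p q e with e' | ⟨x, y, rfl, rfl⟩
    · exact e'
    · rw [hsl, hsl, hup x x.2, hup y y.2] at e
      have := hinj ⟨by linarith [x.2.2], by linarith [x.2.1]⟩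
        ⟨by linarith [y.2.2], by linarith [y.2.1]⟩ e
      congr 1
      exact Subtype.ext (by linarith)
  rw [← hr]
  have hb : Function.Bijective (rangeFactorization f) :=
    ⟨fun a b e => hfi (congrArg Subtype.val e), rangeFactorization_surjective⟩
  have hc : Continuous (Equiv.ofBijective _ hb) := hf.subtype_mk _
  exact ⟨hc.homeoOfEquivCompactToT2.symm⟩

/-- The word u u⁻¹ closes the bigon up to a sphere whose slit runs along `u`. A simple loop
identifies just the two ends of the slit. The hypothesis `hd` says letter by letter that `v` is `u`
reversed. -/
theorem exists_homeomorph_pointsIdentified [T2Space X] {P : δ → ℝ → X} {u v : List δ} {S : Set X}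
    (h : BoundsCell P (u ++ v) S) (hu : u ≠ []) (huv : v.length = u.length)
    (hd : ∀ (k : ℕ) (hk : k < u.length) (hk' : u.length - 1 - k < v.length),
      ∀ t ∈ Icc (0 : ℝ) 1, P v[u.length - 1 - k] t = P u[k] (1 - t))
    (hs : IsSimpleLoop P u) (hc : P (u.getLast hu) 1 = P (u.head hu) 0) :
    ∃ p q : S2, p ≠ q ∧ Nonempty (↥(S ∪ trail P u) ≃ₜ SphereWithPointsIdentified p q) := by
  have hm := List.length_pos_iff.2 hu
  have hm' : (0 : ℝ) < u.length := by exact_mod_cast hm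
  obtain ⟨π, hπ⟩ := h.exists_isBigon hu (by rw [← List.length_pos_iff]; omega)
  have hlo : ∀ x ∈ Icc (-1 : ℝ) 1, π (lo x) = π (up x) := fun x hx => by
    obtain ⟨k, hk, t, ht, rfl⟩ := exists_eq_one_sub hm hx
    have i : 1 - t ∈ Icc (0 : ℝ) 1 := ⟨by linarith [ht.2], by linarith [ht.1]⟩
    have h1 := hπ.lower (u.length - 1 - k) (by omega) (1 - t) i
    rw [hd k hk _ _ i, sub_sub_cancel] at h1
    rw [hπ.upper k hk t ht, ← h1]
    congr 2
    rw [huv, Nat.cast_sub (by omega), Nat.cast_sub (by omega)]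
    field_simp; push_cast; ring
  have hend : π (up (-1)) = π (up 1) := by
    have h1 := hπ.upper 0 hm 0 (by simp)
    have h2 := hπ.upper (u.length - 1) (by omega) 1 (by simp)
    rw [← List.head_eq_getElem hu, ← hc] at h1
    rw [← List.getLast_eq_getElem hu, ← h1] at h2
    convert h2 using 2
    · congr 1
      rw [Nat.cast_sub hm]; field_simp; push_cast; ring
    · simp
  have hinj := hπ.up_injOn hu hs
  obtain ⟨f, hf, hr, hsl, hinj'⟩ := hπ.exists_sphere_map hlo
  rw [hπ.image_up hu] at hr
  rw [← hr]
  have i1 : (1 : ℝ) ∈ Icc (-1 : ℝ) 1 := by simp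
  have i2 : (-1 : ℝ) ∈ Icc (-1 : ℝ) 1 := by simp
  refine ⟨slit ⟨1, i1⟩, slit ⟨-1, i2⟩, ?_, ?_⟩
  · intro e
    have := congrArg Subtype.val (slit_injective e)
    norm_num at this
  · refine nonempty_homeomorph_quot (f := rangeFactorization f) (hf.subtype_mk _)
      rangeFactorization_surjective _ ?_ ?_
    · rintro a b ⟨rfl, rfl⟩
      exact Subtype.ext (by simp [hsl, hend])
    · intro a b e
      replace e := congrArg Subtype.val e
      simp only [rangeFactorization_coe] at e
      rcases hinj' a b e with rfl | ⟨x, y, rfl, rfl⟩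
      · rfl
      · rw [hsl, hsl] at e
        rcases eq_or_lt_of_le x.2.1 with hx | hx <;> rcases eq_or_lt_of_le y.2.1 with hy | hy
        · rw [show x = y from Subtype.ext (by rw [← hx, ← hy])]
        · rw [← hx, hend] at e
          have := hinj ⟨by norm_num, le_rfl⟩ ⟨hy, y.2.2⟩ e
          refine (Quot.sound ⟨?_, ?_⟩).symm
          · congr 1; exact Subtype.ext this.symm
          · congr 1; exact Subtype.ext hx.symm
        · rw [← hy, hend] at e
          have := hinj ⟨hx, x.2.2⟩ ⟨by norm_num, le_rfl⟩ e
          refine Quot.sound ⟨?_, ?_⟩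
          · congr 1; exact Subtype.ext this
          · congr 1; exact Subtype.ext hy.symm
        · rw [show x = y from Subtype.ext (hinj ⟨hx, x.2.2⟩ ⟨hy, y.2.2⟩ e)]

/-- Each side of the bigon d d⁻¹ d d⁻¹ runs along `d` and back. So the slit is folded at its
midpoint, and its two halves are the adjacent arcs to be identified. -/
theorem exists_homeomorph_arcsIdentified [T2Space X] {P : δ → ℝ → X} {d d' : δ} {S : Set X}
    (h : BoundsCell P [d, d', d, d'] S) (hd : ∀ t ∈ Icc (0 : ℝ) 1, P d' t = P d (1 - t))
    (hinj : InjOn (P d) (Icc 0 1)) :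
    ∃ α β : unitInterval → S2, AreAdjacentArcs α β ∧
      Nonempty (↥(S ∪ trail P [d, d']) ≃ₜ SphereWithArcsIdentified α β) := by
  obtain ⟨π, hπ⟩ := BoundsCell.exists_isBigon (u := [d, d']) (v := [d, d']) h (by simp) (by simp)
  have hup : ∀ x ∈ Icc (-1 : ℝ) 1, π (up x) = P d (1 - |x|) := fun x hx => by
    rcases le_total 0 x with h0 | h0
    · have := hπ.upper 0 (by simp) (1 - x) ⟨by linarith [hx.2], by linarith⟩
      simp only [List.length_cons, List.length_nil, List.getElem_cons_zero] at this
      rw [abs_of_nonneg h0, ← this]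
      congr 2; push_cast; ring
    · have i : -x ∈ Icc (0 : ℝ) 1 := ⟨by linarith, by linarith [hx.1]⟩
      have := hπ.upper 1 (by simp) (-x) i
      simp only [List.length_cons, List.length_nil, List.getElem_cons_succ,
        List.getElem_cons_zero] at this
      rw [abs_of_nonpos h0, ← hd _ i, ← this]
      congr 2; push_cast; ring
  have hlo : ∀ x ∈ Icc (-1 : ℝ) 1, π (lo x) = π (up x) := fun x hx => by
    rw [hup x hx]
    rcases le_total 0 x with h0 | h0
    · have i : x ∈ Icc (0 : ℝ) 1 := ⟨by linarith, by linarith [hx.2]⟩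
      have := hπ.lower 1 (by simp) x i
      simp only [List.length_cons, List.length_nil, List.getElem_cons_succ,
        List.getElem_cons_zero] at this
      rw [abs_of_nonneg h0, ← hd _ i, ← this]
      congr 2; push_cast; ring
    · have := hπ.lower 0 (by simp) (1 + x) ⟨by linarith [hx.1], by linarith⟩
      simp only [List.length_cons, List.length_nil, List.getElem_cons_zero] at this
      rw [abs_of_nonpos h0, sub_neg_eq_add, ← this]
      congr 2; push_cast; ring
  obtain ⟨f, hf, hr, hsl, hinj'⟩ := hπ.exists_sphere_map hlo
  rw [hπ.image_up (by simp)] at hr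
  rw [← hr]
  set ip : unitInterval → Icc (-1 : ℝ) 1 := fun t =>
    ⟨t, by linarith [t.2.1], t.2.2⟩ with hip
  set im : unitInterval → Icc (-1 : ℝ) 1 := fun t =>
    ⟨-t, by linarith [t.2.2], by linarith [t.2.1]⟩ with him
  have hipc : Continuous ip := by fun_prop
  have himc : Continuous im := by fun_prop
  have hipi : Function.Injective ip := fun s t e => by
    simpa [hip, Subtype.ext_iff] using e
  have himi : Function.Injective im := fun s t e => by
    simpa [him, Subtype.ext_iff] using e
  refine ⟨fun t => slit (ip t), fun t => slit (im t), ⟨?_, ?_, ?_, ?_⟩, ?_⟩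
  · exact ((continuous_slit.comp hipc).isClosedEmbedding
      (slit_injective.comp hipi)).isEmbedding
  · exact ((continuous_slit.comp himc).isClosedEmbedding
      (slit_injective.comp himi)).isEmbedding
  · congr 1; simp [hip, him]
  · ext p
    simp only [mem_inter_iff, mem_range, mem_singleton_iff]
    constructor
    · rintro ⟨⟨s, rfl⟩, ⟨t, e⟩⟩
      have := congrArg Subtype.val (slit_injective e)
      simp only [hip, him] at this
      congr 2
      exact Subtype.ext (by have := s.2.1; have := t.2.1; change (s : ℝ) = 0; linarith)
    · rintro rfl
      exact ⟨⟨0, rfl⟩, ⟨0, by congr 1; simp [hip, him]⟩⟩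
  · refine nonempty_homeomorph_quot (f := rangeFactorization f) (hf.subtype_mk _)
      rangeFactorization_surjective _ ?_ ?_
    · rintro a b ⟨t, rfl, rfl⟩
      exact Subtype.ext (by
        simp only [rangeFactorization_coe]
        rw [hsl, hsl, hup _ (ip t).2, hup _ (im t).2]; simp [hip, him])
    · intro a b e
      replace e := congrArg Subtype.val e
      simp only [rangeFactorization_coe] at e
      rcases hinj' a b e with rfl | ⟨x, y, rfl, rfl⟩
      · rfl
      · rw [hsl, hsl, hup x x.2, hup y y.2] at e
        have hx := abs_le.2 x.2
        have hy := abs_le.2 y.2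
        have e2 := hinj ⟨by linarith, by linarith [abs_nonneg (x : ℝ)]⟩
          ⟨by linarith, by linarith [abs_nonneg (y : ℝ)]⟩ e
        have e3 : |(x : ℝ)| = |(y : ℝ)| := by linarith
        rcases abs_eq_abs.1 e3 with e4 | e4
        · rw [show x = y from Subtype.ext e4]
        · rcases le_total 0 (x : ℝ) with h0 | h0
          · exact Quot.sound ⟨⟨x, h0, x.2.2⟩, by congr 1, by
              congr 1; exact Subtype.ext (by simp only [him]; linarith)⟩
          · refine (Quot.sound ⟨⟨y, by linarith, y.2.2⟩, by congr 1, ?_⟩).symm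
            congr 1; exact Subtype.ext (by simp only [him]; linarith)

/-- A point of the plane as a complex number. -/
noncomputable def planeToComplex (p : EuclideanSpace ℝ (Fin 2)) : ℂ := ⟨p 0, p 1⟩

theorem continuous_planeToComplex : Continuous planeToComplex :=
  continuous_mk (by fun_prop) (by fun_prop)

theorem norm_planeToComplex (p : EuclideanSpace ℝ (Fin 2)) : ‖planeToComplex p‖ = ‖p‖ := by
  rw [EuclideanSpace.norm_eq, Complex.norm_eq_sqrt_sq_add_sq]
  simp [planeToComplex, Fin.sum_univ_two]

theorem planeToComplex_injective : Function.Injective planeToComplex := by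
  intro p q e
  have h0 := congrArg Complex.re e
  have h1 := congrArg Complex.im e
  ext i
  fin_cases i
  · exact h0
  · exact h1

theorem exists_planeToComplex_eq (z : ℂ) : ∃ p, planeToComplex p = z :=
  ⟨!₂[z.re, z.im], by simp [planeToComplex]⟩

/-- The projection of the sphere to the equatorial plane. -/
noncomputable def equatorial (p : S2) : ℂ := ⟨p.1 0, p.1 1⟩

theorem continuous_equatorial : Continuous equatorial := by
  have h : ∀ i, Continuous fun p : S2 => p.1 i := fun i => by fun_prop
  exact continuous_mk (h 0) (h 1)

theorem sq_add_sq_add_sq (p : S2) : p.1 0 ^ 2 + p.1 1 ^ 2 + p.1 2 ^ 2 = 1 := mem_S2_iff.1 p.2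

theorem norm_equatorial_le (p : S2) : ‖equatorial p‖ ≤ 1 := by
  rw [norm_le_one_iff]
  have := sq_add_sq_add_sq p
  simp only [equatorial]
  nlinarith [sq_nonneg (p.1 2)]

theorem norm_equatorial_eq_one_iff {p : S2} : ‖equatorial p‖ = 1 ↔ p.1 2 = 0 := by
  rw [norm_eq_one_iff]
  have := sq_add_sq_add_sq p
  simp only [equatorial]
  constructor
  · intro h
    exact pow_eq_zero_iff (two_ne_zero) |>.1 (by linarith)
  · intro h
    rw [h] at this; linarith

theorem eq_of_equatorial_eq {p q : S2} (h : equatorial p = equatorial q) (hp : 0 ≤ p.1 2)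
    (hq : 0 ≤ q.1 2) : p = q := by
  have h0 : p.1 0 = q.1 0 := congrArg Complex.re h
  have h1 : p.1 1 = q.1 1 := congrArg Complex.im h
  have e1 := sq_add_sq_add_sq p
  have e2 := sq_add_sq_add_sq q
  have h2 : p.1 2 = q.1 2 := by
    rw [← sq_eq_sq₀ hp hq]
    rw [h0, h1] at e1
    linarith
  apply Subtype.ext
  ext i
  fin_cases i
  · exact h0
  · exact h1
  · exact h2

theorem exists_equatorial_eq {z : ℂ} (hz : ‖z‖ ≤ 1) : ∃ p : S2, 0 ≤ p.1 2 ∧ equatorial p = z := by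
  have h := norm_le_one_iff.1 hz
  refine ⟨⟨!₂[z.re, z.im, √(1 - z.re ^ 2 - z.im ^ 2)], ?_⟩, ?_, ?_⟩
  · rw [mem_S2_iff]
    simp only [Matrix.cons_val]
    rw [Real.sq_sqrt (by linarith)]
    ring
  · simp
  · simp [equatorial]

theorem equatorial_neg (p : S2) : equatorial (-p) = -equatorial p := by
  apply Complex.ext <;> simp [equatorial]

/-- A disc with antipodal boundary identifications gives an injection of the projective plane. -/
theorem exists_projectivePlane_map {π : ℂ → X} {S : Set X}
    (hc : ContinuousOn π (Metric.closedBall 0 1)) (hi : InjOn π (Metric.ball 0 1))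
    (himage : π '' Metric.ball 0 1 = S) (hdisj : ∀ z : ℂ, ‖z‖ = 1 → π z ∉ S)
    (hneg : ∀ z : ℂ, ‖z‖ = 1 → π (-z) = π z)
    (hbd : ∀ z z' : ℂ, ‖z‖ = 1 → ‖z'‖ = 1 → π z = π z' → z = z' ∨ z = -z') :
    ∃ f : P2 → X, Continuous f ∧ Function.Injective f ∧ f '' P1 = π '' Metric.sphere 0 1 ∧
      f '' P1ᶜ = S := by
  -- The upper hemisphere is projected to the disc, and a point of the lower one is first replaced
  -- by its antipode. The two rules agree on the equator by `hneg`.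
  set g : S2 → X := fun p => if 0 ≤ p.1 2 then π (equatorial p) else π (-equatorial p) with hg
  have hgc : Continuous g := by
    refine Continuous.if_le ?_ ?_ continuous_const (by fun_prop) ?_
    · exact hc.comp_continuous continuous_equatorial fun p => by simpa using norm_equatorial_le p
    · exact hc.comp_continuous continuous_equatorial.neg fun p => by
        simpa using norm_equatorial_le p
    · intro p hp
      exact (hneg _ (norm_equatorial_eq_one_iff.2 hp.symm)).symm
  have hpos : ∀ p : S2, 0 ≤ p.1 2 → g p = π (equatorial p) := fun p hp => if_pos hp
  have hgneg : ∀ p : S2, g (-p) = g p := by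
    intro p
    have e : (-p).1 2 = -p.1 2 := rfl
    rcases lt_trichotomy (p.1 2) 0 with h | h | h
    · rw [hpos (-p) (by rw [e]; linarith), equatorial_neg]
      exact (if_neg (not_le.2 h)).symm
    · rw [hpos (-p) (by rw [e]; linarith), hpos p h.ge, equatorial_neg]
      exact hneg _ (norm_equatorial_eq_one_iff.2 h)
    · rw [hpos p h.le]
      have : g (-p) = π (-equatorial (-p)) := if_neg (not_le.2 (by rw [e]; linarith))
      rw [this, equatorial_neg, neg_neg]
  have hup : ∀ l : P2, ∃ p : S2, 0 ≤ p.1 2 ∧ Quot.mk _ p = l := by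
    rintro ⟨p⟩
    rcases le_total 0 (p.1 2) with h | h
    · exact ⟨p, h, rfl⟩
    · exact ⟨-p, by change 0 ≤ -p.1 2; linarith,
        (Quot.sound (r := fun x y : S2 => y = -x) rfl).symm⟩
  have hP1 : ∀ p : S2, (Quot.mk _ p : P2) ∈ P1 ↔ p.1 2 = 0 := by
    intro p
    constructor
    · rintro ⟨q, hq, e⟩
      have hr : ∀ a b : S2, b = -a → (a.1 2 = 0) = (b.1 2 = 0) := by
        rintro a b rfl
        change _ = (-a.1 2 = 0)
        rw [neg_eq_zero]
      have := congrArg (Quot.lift (fun x : S2 => x.1 2 = 0) hr) e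
      exact this.mpr hq
    · intro h
      exact ⟨p, h, rfl⟩
  have hin : ∀ p : S2, 0 ≤ p.1 2 → p.1 2 ≠ 0 → equatorial p ∈ Metric.ball (0 : ℂ) 1 := by
    intro p _ hp
    rw [mem_ball_zero_iff]
    exact lt_of_le_of_ne (norm_equatorial_le p) fun h => hp (norm_equatorial_eq_one_iff.1 h)
  refine ⟨Quot.lift g (by rintro a b rfl; exact (hgneg a).symm), continuous_quot_lift _ hgc,
    ?_, ?_, ?_⟩
  · intro l l' e
    obtain ⟨p, hp, rfl⟩ := hup l
    obtain ⟨q, hq, rfl⟩ := hup l'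
    simp only [hpos p hp, hpos q hq] at e
    by_cases h1 : p.1 2 = 0 <;> by_cases h2 : q.1 2 = 0
    · rcases hbd _ _ (norm_equatorial_eq_one_iff.2 h1) (norm_equatorial_eq_one_iff.2 h2) e
        with e' | e'
      · rw [eq_of_equatorial_eq e' hp hq]
      · rw [← equatorial_neg] at e'
        have := eq_of_equatorial_eq e' hp (by change 0 ≤ -q.1 2; rw [h2, neg_zero])
        exact (Quot.sound (r := fun x y : S2 => y = -x) this).symm
    · refine absurd ?_ (hdisj _ (norm_equatorial_eq_one_iff.2 h1))
      rw [e, ← himage]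
      exact ⟨_, hin q hq h2, rfl⟩
    · refine absurd ?_ (hdisj _ (norm_equatorial_eq_one_iff.2 h2))
      rw [← e, ← himage]
      exact ⟨_, hin p hp h1, rfl⟩
    · rw [eq_of_equatorial_eq (hi (hin p hp h1) (hin q hq h2) e) hp hq]
  · ext x
    constructor
    · rintro ⟨_, ⟨p, hp, rfl⟩, rfl⟩
      exact ⟨equatorial p, by simpa using norm_equatorial_eq_one_iff.2 hp, (hpos p hp.ge).symm⟩
    · rintro ⟨z, hz, rfl⟩
      have hz' : ‖z‖ = 1 := by simpa using hz
      obtain ⟨p, hp, rfl⟩ := exists_equatorial_eq hz'.le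
      exact ⟨Quot.mk _ p, (hP1 p).2 (norm_equatorial_eq_one_iff.1 hz'), hpos p hp⟩
  · rw [← himage]
    ext x
    constructor
    · rintro ⟨l, hl, rfl⟩
      obtain ⟨p, hp, rfl⟩ := hup l
      exact ⟨equatorial p, hin p hp fun h => hl ((hP1 p).2 h), (hpos p hp).symm⟩
    · rintro ⟨z, hz, rfl⟩
      have hz' : ‖z‖ < 1 := by simpa using hz
      obtain ⟨p, hp, rfl⟩ := exists_equatorial_eq hz'.le
      refine ⟨Quot.mk _ p, fun h => ?_, hpos p hp⟩
      exact hz'.ne (norm_equatorial_eq_one_iff.2 ((hP1 p).1 h))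

/-- Compactness turns the continuous bijection from `P1` to its image in a Hausdorff space into a
homeomorphism, which supplies the gluing map. -/
instance compactSpace_P1 : CompactSpace P1 := by
  have e : P1 = (fun x : S2 => (Quot.mk _ x : P2)) '' {x : S2 | x.1 2 = 0} := by
    ext l
    constructor
    · rintro ⟨x, hx, rfl⟩
      exact ⟨x, hx, rfl⟩
    · rintro ⟨x, hx, rfl⟩
      exact ⟨x, hx, rfl⟩
  rw [← isCompact_iff_compactSpace, e]
  refine IsCompact.image ?_ continuous_quot_mk
  exact (isClosed_eq (by fun_prop) continuous_const).isCompact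

/-- A projective plane and a disc in a Hausdorff space that meet exactly in the projective line and
in the boundary circle. -/
theorem exists_homeomorph_projectivePlaneWithDisc_of_maps [T2Space X] {f : P2 → X} {g : Disc → X}
    (hf : Continuous f) (hfi : Function.Injective f) (hg : Continuous g)
    (hgi : Function.Injective g)
    (hT : f '' P1 = range fun z : S1 => g ⟨z.1, Metric.sphere_subset_closedBall z.2⟩)
    (hmeet : ∀ l z, f l = g z → l ∈ P1) :
    ∃ φ : S1 ≃ₜ P1, Nonempty (↥(range f ∪ range g) ≃ₜ ProjectivePlaneWithDisc φ) := by
  set ι : S1 → Disc := fun z => ⟨z.1, Metric.sphere_subset_closedBall z.2⟩ with hι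
  have hιc : Continuous ι := by fun_prop
  have hιi : Function.Injective ι := fun a b e => Subtype.ext (congrArg (fun x : Disc => x.1) e)
  have b1 : Function.Bijective (rangeFactorization fun z : S1 => g (ι z)) :=
    ⟨fun a b e => hιi (hgi (congrArg Subtype.val e)), rangeFactorization_surjective⟩
  have c1 : Continuous (Equiv.ofBijective _ b1) := (hg.comp hιc).subtype_mk _
  set k : P1 → range (fun z : S1 => g (ι z)) := fun l => ⟨f l.1, hT ▸ ⟨l.1, l.2, rfl⟩⟩
  have b2 : Function.Bijective k := by
    refine ⟨fun a b e => Subtype.ext (hfi (congrArg Subtype.val e)), ?_⟩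
    rintro ⟨x, hx⟩
    have hx' := hx
    rw [← hT] at hx'
    obtain ⟨l, hl, rfl⟩ := hx'
    exact ⟨⟨l, hl⟩, rfl⟩
  have c2 : Continuous (Equiv.ofBijective _ b2) := (hf.comp continuous_subtype_val).subtype_mk _
  -- Both circles are compact and map bijectively onto the same subset of X; the gluing map is one
  -- bijection followed by the inverse of the other.
  set φ : S1 ≃ₜ P1 := c1.homeoOfEquivCompactToT2.trans c2.homeoOfEquivCompactToT2.symm with hφ
  have key : ∀ z, f (φ z).1 = g (ι z) := by
    intro z
    have : k (φ z) = ⟨g (ι z), z, rfl⟩ :=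
      (Equiv.ofBijective _ b2).apply_symm_apply ((Equiv.ofBijective _ b1) z)
    exact congrArg Subtype.val this
  refine ⟨φ, ?_⟩
  rw [← Set.Sum.elim_range]
  refine nonempty_homeomorph_quot (f := rangeFactorization (Sum.elim f g))
    ((hf.sumElim hg).subtype_mk _) rangeFactorization_surjective _ ?_ ?_
  · rintro a b ⟨z, rfl, rfl⟩
    exact Subtype.ext (key z)
  · have mixed : ∀ l z, f l = g z → (Quot.mk _ (Sum.inl l) : ProjectivePlaneWithDisc φ) =
        Quot.mk _ (Sum.inr z) := by
      intro l z e
      have hx : f l ∈ f '' P1 := ⟨l, hmeet l z e, rfl⟩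
      rw [hT] at hx
      obtain ⟨y, hy⟩ := hx
      refine Quot.sound ⟨y, ?_, ?_⟩
      · rw [hfi (hy.symm.trans (key y).symm)]
      · rw [hgi (e.symm.trans hy.symm)]
    intro a b e
    replace e := congrArg Subtype.val e
    simp only [rangeFactorization_coe] at e
    rcases a with a | a <;> rcases b with b | b
    · rw [hfi e]
    · exact mixed a b e
    · exact (mixed b a e.symm).symm
    · rw [hgi e]

/-- In the word u u the semicircles are read in the same direction, so antipodal boundary points of
that cell coincide. Since `u` is simple nothing else does: the closure of `T` is a projective plane
with the trail of `u` as projective line. The simple word `w` makes the closure of `S` an embedded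
disc on the same curve. -/
theorem exists_homeomorph_projectivePlaneWithDisc [T2Space X] {P : δ → ℝ → X} {w u : List δ}
    {S T : Set X} (hS : BoundsCell P w S) (hT : BoundsCell P (u ++ u) T) (hu : u ≠ [])
    (hw : IsSimpleLoop P w) (hus : IsSimpleLoop P u) (htrail : trail P w = trail P u)
    (hST : Disjoint S T) :
    ∃ φ : S1 ≃ₜ P1, Nonempty (↥(S ∪ T ∪ trail P u) ≃ₜ ProjectivePlaneWithDisc φ) := by
  obtain ⟨π, hπ⟩ := hT.exists_isBigon hu hu
  obtain ⟨b, ρ, hb, hρ⟩ := hS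
  have hloup : ∀ x ∈ Icc (-1 : ℝ) 1, π (lo (-x)) = π (up x) := by
    intro x hx
    obtain ⟨k, hk, t, ht, rfl⟩ := exists_eq_one_sub (List.length_pos_iff.2 hu) hx
    rw [hπ.upper k hk t ht, ← hπ.lower k hk t ht]
    congr 2; ring
  have hneg : ∀ z : ℂ, ‖z‖ = 1 → π (-z) = π z := by
    intro z hz
    have hre := re_mem_Icc hz.le
    rcases le_total 0 z.im with h | h
    · rw [eq_up_re hz h, neg_up, hloup _ hre]
    · rw [eq_lo_re hz h, neg_lo, ← hloup _ ⟨by linarith [hre.2], by linarith [hre.1]⟩, neg_neg]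
  have hend : π (up (-1)) = π (up 1) := by
    have := hneg 1 (by simp)
    rwa [up_one, up_neg_one]
  have hupi := hπ.up_injOn hu hus
  have hupi' : ∀ x ∈ Icc (-1 : ℝ) 1, ∀ y ∈ Icc (-1 : ℝ) 1, π (up x) = π (up y) →
      up x = up y ∨ up x = -up y := by
    intro x hx y hy e
    rcases eq_or_lt_of_le hx.1 with h1 | h1 <;> rcases eq_or_lt_of_le hy.1 with h2 | h2
    · left; rw [← h1, ← h2]
    · rw [← h1, hend] at e
      have := hupi ⟨by norm_num, le_rfl⟩ ⟨h2, hy.2⟩ e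
      right; rw [← h1, ← this, up_one, up_neg_one]
    · rw [← h2, hend] at e
      have := hupi ⟨h1, hx.2⟩ ⟨by norm_num, le_rfl⟩ e
      right; rw [← h2, this, up_one, up_neg_one, neg_neg]
    · left; rw [hupi ⟨h1, hx.2⟩ ⟨h2, hy.2⟩ e]
  have hrep : ∀ z : ℂ, ‖z‖ = 1 → ∃ x ∈ Icc (-1 : ℝ) 1, (z = up x ∨ z = -up x) ∧
      π z = π (up x) := by
    intro z hz
    have hre := re_mem_Icc hz.le
    rcases le_total 0 z.im with h | h
    · exact ⟨z.re, hre, Or.inl (eq_up_re hz h), by rw [← eq_up_re hz h]⟩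
    · have e : -z = up (-z).re := eq_up_re (by simpa using hz) (by simpa using h)
      refine ⟨(-z).re, re_mem_Icc (by simpa using hz.le), Or.inr (by rw [← e, neg_neg]), ?_⟩
      rw [← e, hneg z hz]
  have hbd : ∀ z z' : ℂ, ‖z‖ = 1 → ‖z'‖ = 1 → π z = π z' → z = z' ∨ z = -z' := by
    intro z z' hz hz' e
    obtain ⟨x, hx, h1, e1⟩ := hrep z hz
    obtain ⟨y, hy, h2, e2⟩ := hrep z' hz'
    rw [e1, e2] at e
    rcases hupi' x hx y hy e with h3 | h3 <;> rcases h1 with h1 | h1 <;> rcases h2 with h2 | h2 <;>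
      simp [h1, h2, h3]
  obtain ⟨f, hf, hfi, hf1, hf2⟩ := exists_projectivePlane_map hπ.cont hπ.inj hπ.image hπ.disj
    hneg hbd
  have hπs : π '' Metric.sphere 0 1 = trail P u := by
    rw [← hπ.image_up hu]
    ext y
    constructor
    · rintro ⟨z, hz, rfl⟩
      obtain ⟨x, hx, -, e⟩ := hrep z (by simpa using hz)
      exact ⟨x, hx, e.symm⟩
    · rintro ⟨x, hx, rfl⟩
      exact ⟨up x, by simpa using norm_up hx, rfl⟩
  have hfloor : ∀ s ∈ Ico (0 : ℝ) w.length, ∃ k, ∃ hk : k < w.length, ∃ t ∈ Ico (0 : ℝ) 1,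
      s = k + t ∧ ρ (b s) = P w[k] t := by
    intro s hs
    have ht : s - ⌊s⌋₊ ∈ Ico (0 : ℝ) 1 :=
      ⟨sub_nonneg.2 (Nat.floor_le hs.1), by linarith [Nat.lt_floor_add_one s]⟩
    have hk : ⌊s⌋₊ < w.length := (Nat.floor_lt hs.1).2 hs.2
    refine ⟨⌊s⌋₊, hk, s - ⌊s⌋₊, ht, by ring, ?_⟩
    rw [← hρ.trace _ hk _ (Ico_subset_Icc_self ht), add_sub_cancel]
  have hρs : ρ '' Metric.sphere 0 1 = trail P w := by
    ext y
    constructor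
    · rintro ⟨z, hz, rfl⟩
      obtain ⟨s, hs, rfl⟩ := hb.surj z (by simpa using hz)
      obtain ⟨k, hk, t, ht, -, e⟩ := hfloor s hs
      exact ⟨_, List.getElem_mem hk, t, Ico_subset_Icc_self ht, e.symm⟩
    · rintro ⟨e, he, t, ht, rfl⟩
      obtain ⟨k, hk, rfl⟩ := List.getElem_of_mem he
      exact ⟨b (k + t), by simpa using hb.norm _ (mem_Icc_length hk ht), hρ.trace k hk t ht⟩
  have hρi : InjOn ρ (Metric.sphere 0 1) := by
    intro z hz z' hz' e
    obtain ⟨s, hs, rfl⟩ := hb.surj z (by simpa using hz)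
    obtain ⟨s', hs', rfl⟩ := hb.surj z' (by simpa using hz')
    obtain ⟨k, hk, t, ht, rfl, e1⟩ := hfloor s hs
    obtain ⟨k', hk', t', ht', rfl, e2⟩ := hfloor s' hs'
    rw [e1, e2] at e
    obtain ⟨rfl, rfl⟩ := hw k k' hk hk' t ht t' ht' e
    rfl
  set g : Disc → X := fun z => ρ (planeToComplex z.1) with hg
  have hnorm : ∀ z : Disc, ‖planeToComplex z.1‖ ≤ 1 := fun z => by
    rw [norm_planeToComplex]; exact mem_closedBall_zero_iff.1 z.2
  have hgc : Continuous g := hρ.cont.comp_continuous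
    (continuous_planeToComplex.comp continuous_subtype_val) fun z => by simpa using hnorm z
  have hgi : Function.Injective g := by
    intro z z' e
    apply Subtype.ext
    apply planeToComplex_injective
    rcases eq_or_lt_of_le (hnorm z) with h1 | h1 <;> rcases eq_or_lt_of_le (hnorm z') with h2 | h2
    · exact hρi (by simpa using h1) (by simpa using h2) e
    · refine absurd ?_ (hρ.disj _ h1)
      simp only [hg] at e
      rw [e, ← hρ.image]; exact ⟨_, by simpa using h2, rfl⟩
    · refine absurd ?_ (hρ.disj _ h2)
      simp only [hg] at e
      rw [← e, ← hρ.image]; exact ⟨_, by simpa using h1, rfl⟩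
    · exact hρ.inj (by simpa using h1) (by simpa using h2) e
  have hgS1 : (range fun z : S1 => g ⟨z.1, Metric.sphere_subset_closedBall z.2⟩) = trail P w := by
    rw [← hρs]
    ext y
    constructor
    · rintro ⟨z, rfl⟩
      exact ⟨planeToComplex z.1, by simp [norm_planeToComplex], rfl⟩
    · rintro ⟨z, hz, rfl⟩
      obtain ⟨p, rfl⟩ := exists_planeToComplex_eq z
      exact ⟨⟨p, by simpa [norm_planeToComplex] using hz⟩, rfl⟩
  have hgr : range g = S ∪ trail P w := by
    rw [← hρs, ← hρ.image, ← image_union, Metric.ball_union_sphere]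
    ext y
    constructor
    · rintro ⟨z, rfl⟩
      exact ⟨planeToComplex z.1, by simpa using hnorm z, rfl⟩
    · rintro ⟨z, hz, rfl⟩
      obtain ⟨p, rfl⟩ := exists_planeToComplex_eq z
      exact ⟨⟨p, by simpa [norm_planeToComplex] using hz⟩, rfl⟩
  have hfr : range f = trail P u ∪ T := by
    rw [← hf2, ← hπs, ← hf1, ← image_union, union_compl_self, image_univ]
  have hTu : Disjoint T (trail P u) := by
    rw [disjoint_left, ← hπs]
    rintro x hx ⟨z, hz, rfl⟩
    exact hπ.disj z (by simpa using hz) hx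
  obtain ⟨φ, ⟨e⟩⟩ := exists_homeomorph_projectivePlaneWithDisc_of_maps hf hfi hgc hgi
    (by rw [hf1, hgS1, hπs, htrail]) (by
      intro l z e
      by_contra hl
      have h1 : f l ∈ T := hf2 ▸ ⟨l, hl, rfl⟩
      have h2 : g z ∈ S ∪ trail P w := hgr ▸ ⟨z, rfl⟩
      rw [← e, htrail] at h2
      rcases h2 with h2 | h2
      · exact hST.notMem_of_mem_left h2 h1
      · exact hTu.notMem_of_mem_left h1 h2)
  refine ⟨φ, ⟨(Homeomorph.setCongr ?_).trans e⟩⟩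
  rw [hfr, hgr, htrail]
  ext x
  simp only [mem_union]
  tauto

end Models

/-! ### The fundamental cycle of a minimal cycle -/

section FundamentalCycle

set_option linter.unusedSectionVars false

variable {V : Type*} [Fintype V] [DecidableEq V]

/-- An alternating function of three vertices, as the coefficients of a 2-chain. -/
structure IsAlternating (c : V → V → V → ℚ) : Prop where
  swap : ∀ x y z, c y x z = -c x y z
  rot : ∀ x y z, c y z x = c x y z

/-- The coefficients of the boundary of a 2-chain. -/
def bdry (c : V → V → V → ℚ) (x y : V) : ℚ := ∑ w, c w x y

/-- The part of a 2-chain on a set of triangles. -/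
def restrict (R : Finset (Finset V)) (c : V → V → V → ℚ) (x y z : V) : ℚ :=
  if {x, y, z} ∈ R then c x y z else 0

/-- The triangle `t` contains the edge `e`. -/
abbrev Incident (e : Sym2 V) (t : Finset V) : Prop := ∀ v ∈ e, v ∈ t

/-- The number of triangles in `F` that contain the edge `e`. -/
def edgeDeg (F : Finset (Finset V)) (e : Sym2 V) : ℕ := (F.filter (Incident e)).card

/-- The edges of the triangles in `F`. -/
def edges (F : Finset (Finset V)) : Finset (Sym2 V) :=
  Finset.univ.filter fun e => ¬ e.IsDiag ∧ ∃ t ∈ F, Incident e t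

/-- The vertices of the triangles in `F`. -/
def verts (F : Finset (Finset V)) : Finset V := F.biUnion id

/-- `c` is a rational 2-cycle supported on exactly the triangles of `F`, and no nonzero 2-cycle is
supported on a proper subset of `F`. -/
structure IsFundamentalCycle (F : Finset (Finset V)) (c : V → V → V → ℚ) : Prop where
  card : ∀ t ∈ F, t.card = 3
  nonempty : F.Nonempty
  alt : IsAlternating c
  supp : ∀ x y z, c x y z ≠ 0 ↔ ({x, y, z} : Finset V) ∈ F
  cycle : ∀ x y, bdry c x y = 0
  minimal : ∀ R ⊂ F, ∀ c' : V → V → V → ℚ, IsAlternating c' → (∀ x y, bdry c' x y = 0) →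
    (∀ x y z, c' x y z ≠ 0 → ({x, y, z} : Finset V) ∈ R) → c' = 0

theorem mem_verts {F : Finset (Finset V)} {v : V} : v ∈ verts F ↔ ∃ t ∈ F, v ∈ t := by
  simp [verts]

theorem mem_edges {F : Finset (Finset V)} {x y : V} :
    s(x, y) ∈ edges F ↔ x ≠ y ∧ ∃ t ∈ F, x ∈ t ∧ y ∈ t := by
  simp [edges, Incident]

theorem IsAlternating.restrict {c : V → V → V → ℚ} (h : IsAlternating c)
    (R : Finset (Finset V)) : IsAlternating (restrict R c) := by
  refine ⟨fun x y z => ?_, fun x y z => ?_⟩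
  · unfold MinimalCycles.restrict
    rw [show ({y, x, z} : Finset V) = {x, y, z} by ext; simp; tauto, h.swap]
    split_ifs <;> simp
  · unfold MinimalCycles.restrict
    rw [show ({y, z, x} : Finset V) = {x, y, z} by ext; simp; tauto, h.rot]

theorem IsAlternating.bdry_swap {c : V → V → V → ℚ} (h : IsAlternating c) (x y : V) :
    bdry c y x = -bdry c x y := by
  unfold bdry
  rw [← Finset.sum_neg_distrib]
  refine Finset.sum_congr rfl fun w _ => ?_
  rw [← h.rot, h.swap, h.rot]

/-- The boundary of a boundary vanishes. -/
theorem IsAlternating.sum_bdry {c : V → V → V → ℚ} (h : IsAlternating c) (x : V) :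
    ∑ y, bdry c x y = 0 := by
  have h1 : ∑ y, bdry c x y = -∑ y, bdry c x y := by
    unfold bdry
    conv_lhs => rw [Finset.sum_comm]
    rw [← Finset.sum_neg_distrib]
    refine Finset.sum_congr rfl fun w _ => ?_
    rw [← Finset.sum_neg_distrib]
    refine Finset.sum_congr rfl fun y _ => ?_
    rw [← h.rot, h.swap, ← h.rot]
  linarith

theorem card_insert_eq_three {x y z : V} (h : ({x, y, z} : Finset V).card = 3) :
    x ≠ y ∧ x ≠ z ∧ y ≠ z := by
  refine ⟨?_, ?_, ?_⟩ <;> rintro rfl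
  · have := Finset.card_le_two (a := x) (b := z); simp at h; omega
  · have := Finset.card_le_two (a := y) (b := x); simp at h; omega
  · have := Finset.card_le_two (a := x) (b := y); simp at h; omega

/-- The coefficients of the orderings of one triangle differ only by sign, so one zero makes all of
them zero. -/
theorem IsAlternating.eq_zero_of_eq {c : V → V → V → ℚ} (hc : IsAlternating c) {x y z x' y' z' : V}
    (e : ({x', y', z'} : Finset V) = {x, y, z}) (hcard : ({x', y', z'} : Finset V).card = 3)
    (h0 : c x y z = 0) : c x' y' z' = 0 := by
  obtain ⟨d1, d2, d3⟩ := card_insert_eq_three (e ▸ hcard)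
  have e1 : x ∈ ({x', y', z'} : Finset V) := by rw [e]; simp
  have e2 : y ∈ ({x', y', z'} : Finset V) := by rw [e]; simp
  have e3 : z ∈ ({x', y', z'} : Finset V) := by rw [e]; simp
  simp only [Finset.mem_insert, Finset.mem_singleton] at e1 e2 e3
  have a1 := hc.swap x' y' z'
  have a2 := hc.rot x' y' z'
  have a3 := hc.rot y' z' x'
  have a4 := hc.swap y' z' x'
  have a5 := hc.swap z' x' y'
  clear e hcard
  rcases e1 with rfl | rfl | rfl <;> rcases e2 with rfl | rfl | rfl <;>
    rcases e3 with rfl | rfl | rfl <;>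
    first
    | exact absurd rfl d1
    | exact absurd rfl d2
    | exact absurd rfl d3
    | linarith

theorem restrict_eq_zero_of_notMem {c : V → V → V → ℚ} {R : Finset (Finset V)} {x y z : V}
    (h : ({x, y, z} : Finset V) ∉ R) : restrict R c x y z = 0 := if_neg h

namespace IsFundamentalCycle

variable {F R : Finset (Finset V)} {c : V → V → V → ℚ}

/-- If `R` takes all triangles at an edge, the restricted chain has there the boundary coefficient
of `c`, which is zero; if it takes none, nothing contributes. -/
theorem bdry_restrict_eq_zero (h : IsFundamentalCycle F c) (x y : V)
    (hR : (∀ t ∈ F, x ∈ t → y ∈ t → t ∈ R) ∨ (∀ t ∈ F, x ∈ t → y ∈ t → t ∉ R)) :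
    bdry (restrict R c) x y = 0 := by
  rcases hR with hR | hR
  · rw [← h.cycle x y]
    refine Finset.sum_congr rfl fun w _ => ?_
    unfold restrict
    split_ifs with h0
    · rfl
    · by_contra h1
      exact h0 (hR _ ((h.supp w x y).1 (Ne.symm h1)) (by simp) (by simp))
  · refine Finset.sum_eq_zero fun w _ => ?_
    unfold restrict
    split_ifs with h0
    · by_contra h1
      exact hR _ ((h.supp w x y).1 h1) (by simp) (by simp) h0
    · rfl

theorem exists_triple (h : IsFundamentalCycle F c) {t : Finset V} (ht : t ∈ F) :
    ∃ x y z, x ≠ y ∧ x ≠ z ∧ y ≠ z ∧ t = {x, y, z} := Finset.card_eq_three.1 (h.card t ht)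

/-- A nonempty set of triangles that carries a cycle is everything. -/
theorem eq_of_bdry_restrict (h : IsFundamentalCycle F c) (hR : R ⊆ F) (hne : R.Nonempty)
    (h0 : ∀ x y, bdry (restrict R c) x y = 0) : R = F := by
  by_contra hn
  have h1 := h.minimal R (hR.ssubset_of_ne hn) _ (h.alt.restrict R) h0 fun x y z hx => by
    by_contra h2
    exact hx (restrict_eq_zero_of_notMem h2)
  obtain ⟨t, ht⟩ := hne
  obtain ⟨x, y, z, -, -, -, rfl⟩ := h.exists_triple (hR ht)
  have h2 := congrFun (congrFun (congrFun h1 x) y) z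
  rw [restrict, if_pos ht] at h2
  exact (h.supp x y z).2 (hR ht) h2

end IsFundamentalCycle

/-! ### Homology of the complex in terms of alternating functions. -/

theorem chains_eq_zero_of_not_injective {K : PreAbstractSimplicialComplex V} {n : ℕ}
    {c : (Fin (n + 1) → V) → ℚ} (hc : c ∈ chains K n) {x : Fin (n + 1) → V}
    (hx : ¬ Function.Injective x) : c x = 0 := by
  simp only [Function.Injective, not_forall] at hx
  obtain ⟨i, j, hij, hne⟩ := hx
  have h := hc.1 (Equiv.swap i j) x
  have e : x ∘ Equiv.swap i j = x := by
    funext k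
    rcases eq_or_ne k i with rfl | h1
    · simp [hij]
    · rcases eq_or_ne k j with rfl | h2
      · simp [hij]
      · simp [Equiv.swap_apply_of_ne_of_ne h1 h2]
  rw [e, Equiv.Perm.sign_swap hne] at h
  simp at h
  linarith

theorem chains_three_eq_bot {K : PreAbstractSimplicialComplex V} (hK : IsTwoComplex K) :
    chains K 3 = ⊥ := by
  rw [eq_bot_iff]
  intro c hc
  rw [Submodule.mem_bot]
  funext x
  by_cases hx : Function.Injective x
  · refine hc.2 x ?_
    rintro ⟨s, hs, e⟩
    have h1 := hK s hs
    have h2 : s = Finset.univ.image x := by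
      rw [← Finset.coe_inj, e]; simp
    rw [h2, Finset.card_image_of_injective _ hx] at h1
    simp at h1
  · exact chains_eq_zero_of_not_injective hc hx

/-- Without 3-simplices there are no 2-boundaries, so the second homology is the space of 2-cycles.
-/
theorem betti₂_eq_finrank_cycles {K : PreAbstractSimplicialComplex V} (hK : IsTwoComplex K) :
    betti₂ K = Module.finrank ℚ (cycles K 1) := by
  unfold betti₂
  refine LinearEquiv.finrank_eq (Submodule.quotEquivOfEqBot _ ?_)
  rw [boundaries, chains_three_eq_bot hK, Submodule.map_bot, Submodule.submoduleOf,
    Submodule.comap_bot, Submodule.ker_subtype]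

theorem uncurry_mem_chains {K : PreAbstractSimplicialComplex V} {c : V → V → V → ℚ}
    (hc : IsAlternating c) (h : ∀ x y z, c x y z ≠ 0 → ({x, y, z} : Finset V) ∈ K.faces) :
    (fun x : Fin 3 → V => c (x 0) (x 1) (x 2)) ∈ chains K 2 := by
  refine ⟨fun σ => ?_, fun x hx => ?_⟩
  · induction σ using Equiv.Perm.swap_induction_on with
    | one => intro x; simp
    | swap_mul f i j hij ih =>
      intro x
      have h1 := ih (x ∘ Equiv.swap i j)
      have h2 : c ((x ∘ Equiv.swap i j) 0) ((x ∘ Equiv.swap i j) 1) ((x ∘ Equiv.swap i j) 2) =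
          -c (x 0) (x 1) (x 2) := by
        have a1 := hc.swap (x 0) (x 1) (x 2)
        have a2 : c (x 0) (x 2) (x 1) = -c (x 0) (x 1) (x 2) := by
          rw [← hc.rot (x 0) (x 2) (x 1), hc.swap, hc.rot]
        have a3 : c (x 2) (x 1) (x 0) = -c (x 0) (x 1) (x 2) := by
          rw [hc.swap, hc.rot]
        fin_cases i <;> fin_cases j <;> simp [Equiv.swap_apply_def] at hij ⊢ <;> assumption
      rw [Function.comp_assoc, ← Equiv.Perm.coe_mul] at h1
      simp only at h1 ⊢
      rw [h1, h2, Equiv.Perm.sign_mul, Equiv.Perm.sign_swap hij]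
      push_cast
      ring
  · by_contra h0
    refine hx ⟨_, h _ _ _ h0, ?_⟩
    ext v
    simp only [Finset.coe_insert, Finset.coe_singleton, mem_insert_iff, mem_singleton_iff, mem_range]
    constructor
    · rintro (rfl | rfl | rfl) <;> exact ⟨_, rfl⟩
    · rintro ⟨i, rfl⟩
      fin_cases i <;> simp

theorem uncurry_mem_cycles {K : PreAbstractSimplicialComplex V} {c : V → V → V → ℚ}
    (hc : IsAlternating c) (h : ∀ x y z, c x y z ≠ 0 → ({x, y, z} : Finset V) ∈ K.faces)
    (h0 : ∀ x y, bdry c x y = 0) :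
    (fun x : Fin 3 → V => c (x 0) (x 1) (x 2)) ∈ cycles K 1 := by
  refine ⟨uncurry_mem_chains hc h, ?_⟩
  change _ = _
  funext x
  exact h0 (x 0) (x 1)

theorem isAlternating_curry {K : PreAbstractSimplicialComplex V} {c : (Fin 3 → V) → ℚ}
    (hc : c ∈ chains K 2) : IsAlternating fun x y z => c ![x, y, z] := by
  refine ⟨fun x y z => ?_, fun x y z => ?_⟩
  · have h := hc.1 (Equiv.swap 0 1) ![x, y, z]
    rw [Equiv.Perm.sign_swap (by decide)] at h
    have e : ![x, y, z] ∘ Equiv.swap (0 : Fin 3) 1 = ![y, x, z] := by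
      funext i; fin_cases i <;> simp [Equiv.swap_apply_def]
    rw [e] at h
    simpa using h
  · have h := hc.1 (finRotate 3) ![x, y, z]
    have e : ![x, y, z] ∘ finRotate 3 = ![y, z, x] := by
      funext i; fin_cases i <;> simp
    rw [e, sign_finRotate] at h
    simpa using h

theorem curry_eta (x : Fin 3 → V) : ![x 0, x 1, x 2] = x := by
  funext i; fin_cases i <;> rfl

/-- The complex of the nonempty subsets of the members of `R`. -/
def closureComplex (R : Finset (Finset V)) : PreAbstractSimplicialComplex V where
  faces := {s | s.Nonempty ∧ ∃ t ∈ R, s ⊆ t}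
  isRelLowerSet_faces := by
    rintro s ⟨hs, t, ht, hst⟩
    exact ⟨hs, fun u hu hun => ⟨hun, t, ht, hu.trans hst⟩⟩

/-- The triangles of a complex. -/
noncomputable def triangles (K : PreAbstractSimplicialComplex V) : Finset (Finset V) :=
  open Classical in Finset.univ.filter fun t => t ∈ K.faces ∧ t.card = 3

theorem mem_triangles {K : PreAbstractSimplicialComplex V} {t : Finset V} :
    t ∈ triangles K ↔ t ∈ K.faces ∧ t.card = 3 := by simp [triangles]

theorem mem_faces_of_subset {K : PreAbstractSimplicialComplex V} {s t : Finset V}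
    (ht : t ∈ K.faces) (hs : s.Nonempty) (hst : s ⊆ t) : s ∈ K.faces :=
  (K.isRelLowerSet_faces ht).2 hst hs

/-- A nonzero cycle exists since b₂ = 1. A cycle on a proper set of triangles lives on the
subcomplex generated by that set, where b₂ = 0. In particular no triangle can have coefficient zero
in the chosen cycle. -/
theorem IsMinimalCycle.exists_isFundamentalCycle {K : PreAbstractSimplicialComplex V}
    (h : IsMinimalCycle K) : ∃ c, IsFundamentalCycle (triangles K) c := by
  have hmin : ∀ R ⊂ triangles K, ∀ c' : V → V → V → ℚ, IsAlternating c' →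
      (∀ x y, bdry c' x y = 0) →
      (∀ x y z, c' x y z ≠ 0 → ({x, y, z} : Finset V) ∈ R) → c' = 0 := by
    intro R hR c' hc' hb hs
    -- A triangle outside `R` is no face of a triangle in `R`, so the generated subcomplex is
    -- proper.
    have hlt : closureComplex R < K := by
      refine lt_of_le_of_ne ?_ ?_
      · rintro s ⟨hs, t, ht, hst⟩
        exact mem_faces_of_subset (mem_triangles.1 (hR.1 ht)).1 hs hst
      · rintro rfl
        refine hR.2 fun t ht => ?_
        obtain ⟨⟨-, t', ht', htt'⟩, hcard⟩ := mem_triangles.1 ht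
        have := (mem_triangles.1 (hR.1 ht')).2
        rwa [Finset.eq_of_subset_of_card_le htt' (by omega)]
    have h0 := h.betti₂_eq_zero_of_lt _ hlt
    have h2 : IsTwoComplex (closureComplex R) := by
      rintro s ⟨-, t, ht, hst⟩
      exact (Finset.card_le_card hst).trans (mem_triangles.1 (hR.1 ht)).2.le
    rw [betti₂_eq_finrank_cycles h2, Submodule.finrank_eq_zero] at h0
    have h3 := uncurry_mem_cycles (K := closureComplex R) hc'
      (fun x y z hx => ⟨by simp, _, hs x y z hx, subset_rfl⟩) hb
    rw [h0, Submodule.mem_bot] at h3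
    funext x y z
    exact congrFun h3 ![x, y, z]
  have h1 := h.betti₂_eq_one
  rw [betti₂_eq_finrank_cycles h.isTwoComplex] at h1
  obtain ⟨⟨c, hc⟩, hne⟩ := Module.finrank_pos_iff_exists_ne_zero.1 (by rw [h1]; norm_num :
    0 < Module.finrank ℚ (cycles K 1))
  have hcne : c ≠ 0 := fun h => hne (Subtype.ext h)
  have halt := isAlternating_curry hc.1
  have hb : ∀ x y, bdry (fun x y z => c ![x, y, z]) x y = 0 := by
    intro x y
    have := congrFun (hc.2 : boundary V 1 c = 0) ![x, y]
    exact this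
  have hsub : ∀ x y z, c ![x, y, z] ≠ 0 → ({x, y, z} : Finset V) ∈ triangles K := by
    intro x y z hx
    rw [mem_triangles]
    have hinj : Function.Injective ![x, y, z] := by
      by_contra hi
      exact hx (chains_eq_zero_of_not_injective hc.1 hi)
    have himage : ({x, y, z} : Finset V) = Finset.univ.image ![x, y, z] := by
      ext v; simp [Fin.exists_fin_succ, eq_comm]
    constructor
    · by_contra hn
      refine hx (hc.1.2 _ ?_)
      rintro ⟨s, hs, e⟩
      refine hn ?_
      have : s = {x, y, z} := by
        rw [himage, ← Finset.coe_inj, e]; simp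
      rwa [← this]
    · rw [himage, Finset.card_image_of_injective _ hinj]; simp
  have hcn' : (fun x y z => c ![x, y, z]) ≠ 0 := by
    intro h0
    refine hcne (funext fun x => ?_)
    rw [← curry_eta x]
    exact congrFun (congrFun (congrFun h0 (x 0)) (x 1)) (x 2)
  refine ⟨fun x y z => c ![x, y, z], fun t ht => (mem_triangles.1 ht).2, ?_, halt, ?_, hb, hmin⟩
  · by_contra hn
    rw [Finset.not_nonempty_iff_eq_empty] at hn
    refine hcn' (funext fun x => funext fun y => funext fun z => ?_)
    by_contra h0
    have := hsub x y z h0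
    rw [hn] at this
    simp at this
  · intro x y z
    refine ⟨hsub x y z, fun ht h0 => hcn' ?_⟩
    -- A triangle with coefficient zero can be removed from the support; the cycle then vanishes by
    -- the minimality shown first.
    refine hmin ((triangles K).erase {x, y, z}) (Finset.erase_ssubset ht) _ halt hb ?_
    intro x' y' z' h'
    refine Finset.mem_erase.2 ⟨?_, hsub _ _ _ h'⟩
    intro e
    exact h' (halt.eq_zero_of_eq e (mem_triangles.1 (hsub _ _ _ h')).2 h0)

/-! ### Ranks of the chain groups and the Euler characteristic. -/

theorem finrank_eq_finrank_map_add {M N : Type*} [AddCommGroup M] [Module ℚ M] [AddCommGroup N]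
    [Module ℚ N] [FiniteDimensional ℚ M] (p : Submodule ℚ M) (f : M →ₗ[ℚ] N) :
    Module.finrank ℚ p =
      Module.finrank ℚ (p.map f) + Module.finrank ℚ ↥(p ⊓ LinearMap.ker f) := by
  rw [← LinearMap.finrank_range_add_finrank_ker (f.domRestrict p), LinearMap.range_domRestrict,
    LinearMap.ker_domRestrict]
  congr 1
  rw [← Submodule.map_comap_subtype]
  exact (Submodule.equivMapOfInjective _ p.injective_subtype _).finrank_eq

/-- This antisymmetrized indicator function is the oriented simplex `x`, viewed as a chain. -/
theorem sum_sign_mem_chains {K : PreAbstractSimplicialComplex V} {n : ℕ} {x : Fin (n + 1) → V}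
    (hx : ∃ s ∈ K.faces, (s : Set V) = Set.range x) :
    (fun y => ∑ σ : Equiv.Perm (Fin (n + 1)),
      ((Equiv.Perm.sign σ : ℤ) : ℚ) * if y = x ∘ σ then 1 else 0) ∈ chains K n := by
  refine ⟨fun τ y => ?_, fun y hy => ?_⟩
  · rw [Finset.mul_sum]
    refine Fintype.sum_equiv (Equiv.mulRight τ⁻¹) _ _ fun σ => ?_
    have h1 : y ∘ τ = x ∘ σ ↔ y = x ∘ Equiv.mulRight τ⁻¹ σ := by
      refine ⟨fun h => ?_, fun h => ?_⟩
      · funext i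
        have := congrFun h (τ⁻¹ i)
        simpa using this
      · funext i
        have := congrFun h (τ i)
        simpa using this
    have h2 : ((Equiv.Perm.sign σ : ℤ) : ℚ) = ((Equiv.Perm.sign τ : ℤ) : ℚ) *
        ((Equiv.Perm.sign (Equiv.mulRight τ⁻¹ σ) : ℤ) : ℚ) := by
      rcases Int.units_eq_one_or (Equiv.Perm.sign τ) with h | h <;> simp [h]
    rw [if_congr h1 rfl rfl, h2, mul_assoc]
  · refine Finset.sum_eq_zero fun σ _ => ?_
    rw [if_neg, mul_zero]
    rintro rfl
    refine hy ?_
    obtain ⟨s, hs, e⟩ := hx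
    exact ⟨s, hs, by rw [e, Set.range_comp, Equiv.range_eq_univ, Set.image_univ]⟩

/-- The oriented triangles are linearly independent, as evaluation at one chosen ordering of each
triangle shows. Only this inequality enters the Euler characteristic bound. -/
theorem card_triangles_le_finrank (K : PreAbstractSimplicialComplex V) :
    (triangles K).card ≤ Module.finrank ℚ (chains K 2) := by
  have hex : ∀ t : triangles K, ∃ x : Fin 3 → V, Function.Injective x ∧ Set.range x = t.1 := by
    rintro ⟨t, ht⟩
    obtain ⟨x, y, z, h1, h2, h3, rfl⟩ := Finset.card_eq_three.1 (mem_triangles.1 ht).2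
    refine ⟨![x, y, z], ?_, ?_⟩
    · intro i j
      fin_cases i <;> fin_cases j <;> simp [h1, h2, h3, h1.symm, h2.symm, h3.symm]
    · ext v; simp [eq_comm]; tauto
  choose x hinj hrange using hex
  set b : triangles K → chains K 2 := fun t => ⟨_, sum_sign_mem_chains (x := x t)
    ⟨t.1, (mem_triangles.1 t.2).1, (hrange t).symm⟩⟩ with hb
  have hval : ∀ s t, (b s).1 (x t) = if s = t then 1 else 0 := by
    intro s t
    simp only [hb]
    by_cases hst : s = t
    · subst hst
      rw [if_pos rfl, Finset.sum_eq_single 1]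
      · simp
      · intro σ _ hσ
        rw [if_neg, mul_zero]
        intro e
        refine hσ (Equiv.ext fun i => hinj s ?_)
        exact (congrFun e i).symm
      · simp
    · rw [if_neg hst]
      refine Finset.sum_eq_zero fun σ _ => ?_
      rw [if_neg, mul_zero]
      intro e
      refine hst (Subtype.ext (Finset.coe_injective ?_))
      rw [← hrange, ← hrange, e, Set.range_comp, Equiv.range_eq_univ, Set.image_univ]
  have hli : LinearIndependent ℚ b := by
    rw [Fintype.linearIndependent_iff]
    intro g hg t
    have h1 := congrArg (fun c : chains K 2 => c.1 (x t)) hg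
    simpa [hval] using h1
  simpa using hli.fintype_card_le_finrank

/-- A 1-chain is determined by its coefficient at one orientation of each edge, and by purity each
edge lies in a triangle. -/
theorem finrank_chains_one_le {K : PreAbstractSimplicialComplex V} (hK : IsPure K) :
    Module.finrank ℚ (chains K 1) ≤ (edges (triangles K)).card := by
  set f : chains K 1 →ₗ[ℚ] (edges (triangles K) → ℚ) :=
    { toFun := fun c e => c.1 ![e.1.out.1, e.1.out.2]
      map_add' := fun a b => rfl
      map_smul' := fun r a => rfl } with hf
  have hinj : Function.Injective f := by
    rw [← LinearMap.ker_eq_bot, LinearMap.ker_eq_bot']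
    rintro ⟨c, hc⟩ h0
    refine Subtype.ext (funext fun x => ?_)
    by_contra hx
    have hx' : c x ≠ 0 := hx
    have hinj : Function.Injective x := by
      by_contra hi
      exact hx' (chains_eq_zero_of_not_injective hc hi)
    have hs : ∃ s ∈ K.faces, (s : Set V) = Set.range x := by
      by_contra hn
      exact hx' (hc.2 x hn)
    obtain ⟨s, hs, e⟩ := hs
    obtain ⟨t, ht, hst, hcard⟩ := hK s hs
    have hmem : ∀ i, x i ∈ t := fun i => hst (by
      have : x i ∈ (s : Set V) := e ▸ ⟨i, rfl⟩
      exact this)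
    have he : s(x 0, x 1) ∈ edges (triangles K) := mem_edges.2
      ⟨fun h => by simpa using hinj h, t, mem_triangles.2 ⟨ht, hcard⟩, hmem 0, hmem 1⟩
    have h1 := congrFun h0 ⟨_, he⟩
    simp only [hf, LinearMap.coe_mk, AddHom.coe_mk, Pi.zero_apply] at h1
    have h2 : s((s(x 0, x 1)).out.1, (s(x 0, x 1)).out.2) = s(x 0, x 1) := Quot.out_eq _
    have hx2 : ![x 0, x 1] = x := by funext i; fin_cases i <;> rfl
    rcases Sym2.eq_iff.1 h2 with ⟨a1, a2⟩ | ⟨a1, a2⟩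
    · rw [a1, a2, hx2] at h1
      exact hx' h1
    · have h3 := hc.1 (Equiv.swap 0 1) x
      have e3 : x ∘ Equiv.swap (0 : Fin 2) 1 = ![x 1, x 0] := by
        funext i; fin_cases i <;> simp
      rw [a1, a2] at h1
      rw [e3, h1, Equiv.Perm.sign_swap (by decide)] at h3
      simp at h3
      exact hx' h3
  simpa using LinearMap.finrank_le_finrank_of_injective hinj

/-- The Euler characteristic of a minimal cycle is at most two. -/
theorem IsMinimalCycle.card_verts_add_le {K : PreAbstractSimplicialComplex V}
    (h : IsMinimalCycle K) : (verts (triangles K)).card + (triangles K).card ≤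
      (edges (triangles K)).card + 2 := by
  obtain ⟨c, hc⟩ := h.exists_isFundamentalCycle
  set F := triangles K with hF
  have h1 := h.betti₂_eq_one
  rw [betti₂_eq_finrank_cycles h.isTwoComplex] at h1
  have r2 := finrank_eq_finrank_map_add (chains K 2) (boundary V 1)
  have r1 := finrank_eq_finrank_map_add (chains K 1) (boundary V 0)
  have hle : Module.finrank ℚ (boundaries K 1) ≤ Module.finrank ℚ (cycles K 0) :=
    Submodule.finrank_mono (boundaries_le_cycles K 0)
  have hf := card_triangles_le_finrank K
  have he := finrank_chains_one_le h.isPure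
  set M := (chains K 1).map (boundary V 0) with hM
  set δ : V → (Fin 1 → V) → ℚ := fun u x => if x 0 = u then 1 else 0 with hδ
  have hedge : ∀ u v, ∀ t ∈ F, u ∈ t → v ∈ t → δ u - δ v ∈ M := by
    intro u v t ht hu hv
    by_cases huv : u = v
    · subst huv; simp
    have hx : ∃ s ∈ K.faces, (s : Set V) = Set.range ![v, u] := by
      refine ⟨{v, u}, mem_faces_of_subset (mem_triangles.1 ht).1 (by simp) ?_, ?_⟩
      · intro w hw
        simp only [Finset.mem_insert, Finset.mem_singleton] at hw
        rcases hw with rfl | rfl <;> assumption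
      · ext w; simp [eq_comm]; tauto
    refine ⟨_, sum_sign_mem_chains hx, ?_⟩
    funext y
    change ∑ w, ∑ σ : Equiv.Perm (Fin 2), _ = _
    have hs : (Finset.univ : Finset (Equiv.Perm (Fin 2))) = {1, Equiv.swap 0 1} := by decide
    have e1 : ![v, u] ∘ Equiv.swap (0 : Fin 2) 1 = ![u, v] := by
      funext i; fin_cases i <;> simp
    have hcons : ∀ w a b, (Fin.cons w y : Fin 2 → V) = ![a, b] ↔ w = a ∧ y 0 = b := by
      intro w a b
      constructor
      · intro h
        exact ⟨congrFun h 0, congrFun h 1⟩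
      · rintro ⟨rfl, rfl⟩
        funext i; fin_cases i <;> rfl
    rw [hs]
    simp only [Finset.sum_pair (show (1 : Equiv.Perm (Fin 2)) ≠ Equiv.swap 0 1 by decide),
      Equiv.Perm.coe_one, Function.comp_id, e1, hcons, Equiv.Perm.sign_one,
      Equiv.Perm.sign_swap (show (0 : Fin 2) ≠ 1 by decide)]
    rw [Finset.sum_add_distrib, ← Finset.mul_sum, ← Finset.mul_sum]
    simp only [ite_and, Finset.sum_ite_eq', Finset.mem_univ, if_true]
    simp only [hδ, Pi.sub_apply, Fin.isValue]
    push_cast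
    ring
  obtain ⟨t₀, ht₀⟩ := hc.nonempty
  obtain ⟨p, hp⟩ : t₀.Nonempty := Finset.card_pos.1 (by rw [hc.card t₀ ht₀]; norm_num)
  classical
  have hstep : ∀ t ∈ F, ∀ u ∈ t, δ u - δ p ∈ M → ∀ v ∈ t, δ v - δ p ∈ M := by
    intro t ht u hu h v hv
    have := M.add_mem (hedge v u t ht hv hu) h
    simpa using this
  -- Connectedness: the triangles whose vertices are all homologous to `p` include every triangle
  -- that meets one of them. So the restriction of `c` to them is a cycle, and by minimality they
  -- are all of `F`.
  have hall : F.filter (fun t => ∀ v ∈ t, δ v - δ p ∈ M) = F := by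
    refine hc.eq_of_bdry_restrict (Finset.filter_subset _ _) ⟨t₀, ?_⟩ fun x y => ?_
    · exact Finset.mem_filter.2 ⟨ht₀, hstep t₀ ht₀ p hp (by simp)⟩
    · refine hc.bdry_restrict_eq_zero x y ?_
      by_cases hx : δ x - δ p ∈ M
      · left
        intro t ht hxt _
        exact Finset.mem_filter.2 ⟨ht, hstep t ht x hxt hx⟩
      · right
        intro t ht hxt _ h
        exact hx ((Finset.mem_filter.1 h).2 x hxt)
  have hMv : ∀ v ∈ verts F, δ v - δ p ∈ M := by
    intro v hv
    obtain ⟨t, ht, hvt⟩ := mem_verts.1 hv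
    rw [← hall] at ht
    exact (Finset.mem_filter.1 ht).2 v hvt
  -- All vertex chains lie in the span of the 1-boundary image `M` and the single vector `δ p`.
  have hrank : (verts F).card ≤ Module.finrank ℚ M + 1 := by
    set N := M ⊔ Submodule.span ℚ {δ p} with hN
    set b : verts F → N := fun v => ⟨δ v.1, by
      have h2 := N.add_mem (Submodule.mem_sup_left (hMv v.1 v.2))
        (Submodule.mem_sup_right (Submodule.mem_span_singleton_self (δ p)))
      simpa using h2⟩ with hb
    have hli : LinearIndependent ℚ b := by
      rw [Fintype.linearIndependent_iff]
      intro g hg v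
      have h1 := congrArg (fun c : N => c.1 (fun _ => v.1)) hg
      simp only [hb, hδ, AddSubmonoidClass.coe_finsetSum, SetLike.val_smul, Finset.sum_apply,
        Pi.smul_apply, smul_eq_mul, mul_ite, mul_one, mul_zero, ZeroMemClass.coe_zero,
        Pi.zero_apply, ← Subtype.ext_iff, Finset.sum_ite_eq, Finset.mem_univ, if_true] at h1
      exact h1
    have h2 := hli.fintype_card_le_finrank
    have h3 := Submodule.finrank_add_le_finrank_add_finrank M (Submodule.span ℚ {δ p})
    have h4 : Module.finrank ℚ (Submodule.span ℚ {δ p}) ≤ 1 :=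
      (finrank_span_le_card (R := ℚ) {δ p}).trans_eq (by simp)
    rw [Fintype.card_coe] at h2
    exact h2.trans (h3.trans (Nat.add_le_add_left h4 _))
  -- Now f ≤ dim C₂ = rank ∂₂ + 1, rank ∂₂ ≤ dim ker ∂₁, v ≤ rank ∂₁ + 1 and rank ∂₁ + dim ker ∂₁ =
  -- dim C₁ ≤ e add up to the claim.
  have hc1 : Module.finrank ℚ ↥(chains K 2 ⊓ LinearMap.ker (boundary V 1)) = 1 := h1
  have hc2 : Module.finrank ℚ ↥((chains K 2).map (boundary V 1)) ≤
    Module.finrank ℚ ↥(chains K 1 ⊓ LinearMap.ker (boundary V 0)) := hle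
  rw [← hF] at hf he
  omega

theorem IsPure.mem_faces_iff {K : PreAbstractSimplicialComplex V} (hK : IsPure K) {s : Finset V} :
    s ∈ K.faces ↔ s.Nonempty ∧ ∃ t ∈ triangles K, s ⊆ t := by
  constructor
  · intro hs
    obtain ⟨t, ht, hst, hcard⟩ := hK s hs
    exact ⟨(K.isRelLowerSet_faces hs).1, t, mem_triangles.2 ⟨ht, hcard⟩, hst⟩
  · rintro ⟨hs, t, ht, hst⟩
    exact mem_faces_of_subset (mem_triangles.1 ht).1 hs hst

theorem IsMinimalCycle.card_triangles_lt {K : PreAbstractSimplicialComplex V}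
    (h : IsMinimalCycle K) (hμ : 1 / 2 < mu K) :
    (triangles K).card < 2 * (verts (triangles K)).card := by
  have h2 : simplexCount K 2 = (triangles K).card := by
    rw [simplexCount, ← Set.ncard_coe_finset]
    congr 1
    ext t
    simp [mem_triangles]
  have h0 : simplexCount K 0 = (verts (triangles K)).card := by
    rw [simplexCount, ← Finset.card_map (⟨fun v => {v}, Finset.singleton_injective⟩ :
      V ↪ Finset V), ← Set.ncard_coe_finset]
    congr 1
    ext s
    simp only [zero_add, mem_ofPred_eq, Finset.coe_map, Function.Embedding.coeFn_mk, mem_image,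
      Finset.mem_coe, mem_verts, Finset.card_eq_one, h.isPure.mem_faces_iff]
    constructor
    · rintro ⟨⟨-, t, ht, hst⟩, v, rfl⟩
      exact ⟨v, ⟨t, ht, by simpa using hst⟩, rfl⟩
    · rintro ⟨v, ⟨t, ht, hvt⟩, rfl⟩
      exact ⟨⟨by simp, t, ht, by simpa using hvt⟩, v, rfl⟩
  obtain ⟨c, hc⟩ := h.exists_isFundamentalCycle
  have hpos : (0 : ℝ) < (triangles K).card := by exact_mod_cast Finset.card_pos.2 hc.nonempty
  rw [mu, h0, h2, lt_div_iff₀ hpos] at hμ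
  have : ((triangles K).card : ℝ) < 2 * (verts (triangles K)).card := by linarith
  exact_mod_cast this

end FundamentalCycle

/-! ### Open simplices -/

section OpenSimplices

set_option linter.unusedSectionVars false

variable {V : Type*} [Fintype V] [DecidableEq V]

/-- The union of the open simplices in `A`. -/
def openSimplices (A : Set (Finset V)) : Set (V → ℝ) :=
  {x | (∀ v, 0 ≤ x v) ∧ ∑ v, x v = 1 ∧ Finset.univ.filter (fun v => x v ≠ 0) ∈ A}

/-- The segment from the vertex `d.1` to the vertex `d.2`. -/
def seg (d : V × V) (t : ℝ) : V → ℝ := fun v =>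
  (if v = d.1 then 1 - t else 0) + if v = d.2 then t else 0

theorem openSimplices_union (A B : Set (Finset V)) :
    openSimplices (A ∪ B) = openSimplices A ∪ openSimplices B := by
  ext x
  simp only [openSimplices, mem_ofPred_eq, mem_union]
  tauto

/-- A point lies in exactly one open simplex, the one spanned by its support. So disjointness of
cells becomes a statement about finite sets of faces. -/
theorem disjoint_openSimplices {A B : Set (Finset V)} (h : Disjoint A B) :
    Disjoint (openSimplices A) (openSimplices B) := by
  rw [disjoint_left]
  rintro x ⟨-, -, hA⟩ ⟨-, -, hB⟩
  exact disjoint_left.1 h hA hB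

theorem seg_nonneg (d : V × V) {t : ℝ} (ht : t ∈ Icc (0 : ℝ) 1) (v : V) : 0 ≤ seg d t v := by
  unfold seg
  have h1 := ht.1
  have h2 := ht.2
  split_ifs <;> linarith

theorem sum_seg (d : V × V) (t : ℝ) : ∑ v, seg d t v = 1 := by
  simp [seg, Finset.sum_add_distrib]

theorem seg_swap (x y : V) (t : ℝ) : seg (y, x) t = seg (x, y) (1 - t) := by
  funext v
  simp only [seg]
  split_ifs <;> ring

theorem seg_injective {d : V × V} (hd : d.1 ≠ d.2) : Function.Injective (seg d) := by
  intro s t h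
  have := congrFun h d.2
  simpa [seg, hd.symm] using this

/-- The simplex whose interior contains `seg d t`. -/
noncomputable def segFace (d : V × V) (t : ℝ) : Finset V :=
  if t = 0 then {d.1} else if t = 1 then {d.2} else {d.1, d.2}

theorem filter_seg {d : V × V} (hd : d.1 ≠ d.2) (t : ℝ) :
    Finset.univ.filter (fun v => seg d t v ≠ 0) = segFace d t := by
  ext v
  rw [Finset.mem_filter, and_iff_right (Finset.mem_univ v)]
  simp only [seg, segFace]
  have h1 : 1 - t = 0 ↔ t = 1 := by constructor <;> intro h <;> linarith
  by_cases h0 : t = 0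
  · subst h0
    by_cases hv : v = d.1 <;> simp [hv]
  · by_cases h2 : t = 1
    · subst h2
      by_cases hv : v = d.2 <;> simp [hv]
    · rw [if_neg h0, if_neg h2]
      by_cases hv : v = d.1
      · subst hv; simp [hd, h1, h2]
      · by_cases hv' : v = d.2
        · subst hv'; simp [hd.symm, h0]
        · simp [hv, hv']

theorem seg_mem_openSimplices {d : V × V} (hd : d.1 ≠ d.2) {t : ℝ} (ht : t ∈ Icc (0 : ℝ) 1)
    {A : Set (Finset V)} : seg d t ∈ openSimplices A ↔ segFace d t ∈ A := by
  rw [openSimplices, mem_ofPred_eq, filter_seg hd]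
  exact ⟨fun h => h.2.2, fun h => ⟨seg_nonneg d ht, sum_seg d t, h⟩⟩

theorem segFace_of_mem_Ioo {d : V × V} {t : ℝ} (ht : t ∈ Ioo (0 : ℝ) 1) :
    segFace d t = {d.1, d.2} := by
  rw [segFace, if_neg ht.1.ne', if_neg ht.2.ne]

theorem segFace_cases (d : V × V) (t : ℝ) :
    segFace d t = {d.1} ∨ segFace d t = {d.2} ∨ segFace d t = {d.1, d.2} := by
  unfold segFace
  split_ifs <;> simp

theorem eq_seg_of_filter_eq {d : V × V} (hd : d.1 ≠ d.2) {x : V → ℝ} (h0 : ∀ v, 0 ≤ x v)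
    (h1 : ∑ v, x v = 1) (hx : ∀ v, v ≠ d.1 → v ≠ d.2 → x v = 0) :
    x d.2 ∈ Icc (0 : ℝ) 1 ∧ seg d (x d.2) = x := by
  have hs : x d.1 + x d.2 = 1 := by
    rw [← h1, ← Finset.sum_pair hd]
    refine Finset.sum_subset (Finset.subset_univ _) fun v _ hv => ?_
    simp only [Finset.mem_insert, Finset.mem_singleton, not_or] at hv
    exact hx v hv.1 hv.2
  refine ⟨⟨h0 _, by linarith [h0 d.1]⟩, ?_⟩
  funext v
  simp only [seg]
  by_cases hv : v = d.1
  · subst hv; simp [hd]; linarith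
  · by_cases hv' : v = d.2
    · subst hv'; simp [hd.symm]
    · simp [hv, hv', hx v hv hv']

theorem mem_openSimplices_edge {d : V × V} (hd : d.1 ≠ d.2) {A : Set (Finset V)}
    {x : V → ℝ} (hx : x ∈ openSimplices A) (hA : ∀ s ∈ A, s ⊆ {d.1, d.2}) :
    ∃ t ∈ Icc (0 : ℝ) 1, seg d t = x := by
  obtain ⟨h0, h1, h2⟩ := hx
  have h3 := hA _ h2
  obtain ⟨h4, h5⟩ := eq_seg_of_filter_eq hd h0 h1 fun v hv hv' => by
    by_contra h
    have := h3 (Finset.mem_filter.2 ⟨Finset.mem_univ v, h⟩)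
    simp [hv, hv'] at this
  exact ⟨_, h4, h5⟩

theorem segFace_eq_pair_iff {d : V × V} (hd : d.1 ≠ d.2) {t : ℝ} (ht : t ∈ Icc (0 : ℝ) 1) :
    segFace d t = {d.1, d.2} ↔ t ∈ Ioo (0 : ℝ) 1 := by
  constructor
  · intro h
    refine ⟨lt_of_le_of_ne ht.1 ?_, lt_of_le_of_ne ht.2 ?_⟩
    · rintro rfl
      have := congrArg Finset.card h
      simp [segFace, Finset.card_pair hd] at this
    · rintro rfl
      have := congrArg Finset.card h
      simp [segFace, Finset.card_pair hd] at this
  · exact segFace_of_mem_Ioo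

theorem seg_image_Ioo {d : V × V} (hd : d.1 ≠ d.2) :
    seg d '' Ioo 0 1 = openSimplices {{d.1, d.2}} := by
  ext x
  constructor
  · rintro ⟨t, ht, rfl⟩
    rw [seg_mem_openSimplices hd (Ioo_subset_Icc_self ht), segFace_of_mem_Ioo ht]
    rfl
  · intro hx
    obtain ⟨t, ht, rfl⟩ := mem_openSimplices_edge hd hx (by rintro s rfl; exact subset_rfl)
    rw [seg_mem_openSimplices hd ht, mem_singleton_iff, segFace_eq_pair_iff hd ht] at hx
    exact ⟨t, hx, rfl⟩

theorem seg_image_Ioc {d : V × V} (hd : d.1 ≠ d.2) :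
    seg d '' Ioc 0 1 = openSimplices {{d.1, d.2}, {d.2}} := by
  ext x
  constructor
  · rintro ⟨t, ht, rfl⟩
    rw [seg_mem_openSimplices hd (Ioc_subset_Icc_self ht)]
    rcases eq_or_lt_of_le ht.2 with rfl | h
    · simp [segFace]
    · rw [segFace_of_mem_Ioo ⟨ht.1, h⟩]; simp
  · intro hx
    obtain ⟨t, ht, rfl⟩ := mem_openSimplices_edge hd hx (by rintro s (rfl | rfl) <;> simp)
    rw [seg_mem_openSimplices hd ht] at hx
    refine ⟨t, ⟨lt_of_le_of_ne ht.1 ?_, ht.2⟩, rfl⟩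
    rintro rfl
    rcases hx with hx | hx
    · rw [segFace_eq_pair_iff hd ht] at hx
      exact lt_irrefl _ hx.1
    · simp [segFace, hd] at hx

theorem trail_seg {w : List (V × V)} (hw : ∀ d ∈ w, d.1 ≠ d.2) :
    trail seg w = openSimplices
      {s | ∃ d ∈ w, s = {d.1} ∨ s = {d.2} ∨ s = {d.1, d.2}} := by
  ext x
  constructor
  · rintro ⟨d, hd, t, ht, rfl⟩
    rw [seg_mem_openSimplices (hw d hd) ht]
    exact ⟨d, hd, segFace_cases d t⟩
  · rintro ⟨h0, h1, d, hd, hs⟩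
    obtain ⟨t, ht, e⟩ := mem_openSimplices_edge (hw d hd) (x := x)
      (A := {Finset.univ.filter (fun v => x v ≠ 0)}) ⟨h0, h1, rfl⟩ (by
        rintro s rfl
        rcases hs with hs | hs | hs <;> rw [hs] <;> simp)
    exact ⟨d, hd, t, ht, e⟩

/-- The three barycentric coordinates of a point moving around the boundary of a triangle. -/
noncomputable def tour (s : ℝ) : ℝ × ℝ × ℝ :=
  (max 0 (1 - s) + max 0 (s - 2), max 0 (1 - |s - 1|), max 0 (1 - |s - 2|))

theorem continuous_tour : Continuous tour := by unfold tour; fun_prop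

theorem tour_zero {t : ℝ} (ht : t ∈ Icc (0 : ℝ) 1) : tour t = (1 - t, t, 0) := by
  obtain ⟨h0, h1⟩ := ht
  unfold tour
  rw [max_eq_right (by linarith : 0 ≤ 1 - t), max_eq_left (by linarith : t - 2 ≤ 0),
    abs_of_nonpos (by linarith : t - 1 ≤ 0), abs_of_nonpos (by linarith : t - 2 ≤ 0),
    max_eq_right (by linarith), max_eq_left (by linarith)]
  ext <;> simp

theorem tour_one {t : ℝ} (ht : t ∈ Icc (0 : ℝ) 1) : tour (1 + t) = (0, 1 - t, t) := by
  obtain ⟨h0, h1⟩ := ht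
  unfold tour
  rw [max_eq_left (by linarith : 1 - (1 + t) ≤ 0), max_eq_left (by linarith : 1 + t - 2 ≤ 0),
    abs_of_nonneg (by linarith : 0 ≤ 1 + t - 1), abs_of_nonpos (by linarith : 1 + t - 2 ≤ 0),
    max_eq_right (by linarith), max_eq_right (by linarith)]
  ext <;> simp; ring

theorem tour_two {t : ℝ} (ht : t ∈ Icc (0 : ℝ) 1) : tour (2 + t) = (t, 0, 1 - t) := by
  obtain ⟨h0, h1⟩ := ht
  unfold tour
  rw [max_eq_left (by linarith : 1 - (2 + t) ≤ 0), max_eq_right (by linarith : 0 ≤ 2 + t - 2),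
    abs_of_nonneg (by linarith : 0 ≤ 2 + t - 1), abs_of_nonneg (by linarith : 0 ≤ 2 + t - 2),
    max_eq_left (by linarith), max_eq_right (by linarith)]
  ext <;> simp

theorem tour_cases {s : ℝ} (hs : s ∈ Icc (0 : ℝ) 3) : ∃ t ∈ Icc (0 : ℝ) 1,
    s = t ∨ s = 1 + t ∨ s = 2 + t := by
  obtain ⟨h0, h3⟩ := hs
  rcases le_total s 1 with h | h
  · exact ⟨s, ⟨h0, h⟩, Or.inl rfl⟩
  · rcases le_total s 2 with h' | h'
    · exact ⟨s - 1, ⟨by linarith, by linarith⟩, Or.inr (Or.inl (by ring))⟩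
    · exact ⟨s - 2, ⟨by linarith, by linarith⟩, Or.inr (Or.inr (by ring))⟩

theorem tour_spec {s : ℝ} (hs : s ∈ Icc (0 : ℝ) 3) : 0 ≤ (tour s).1 ∧ 0 ≤ (tour s).2.1 ∧
    0 ≤ (tour s).2.2 ∧ (tour s).1 + (tour s).2.1 + (tour s).2.2 = 1 ∧
    ((tour s).1 = 0 ∨ (tour s).2.1 = 0 ∨ (tour s).2.2 = 0) := by
  obtain ⟨t, ht, rfl | rfl | rfl⟩ := tour_cases hs
  · rw [tour_zero ht]; simp [ht.1, ht.2]
  · rw [tour_one ht]; simp [ht.1, ht.2]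
  · rw [tour_two ht]; simp [ht.1, ht.2]

theorem tour_injOn : InjOn tour (Ico 0 3) := by
  intro s hs s' hs' e
  obtain ⟨t, ht, h⟩ := tour_cases (Ico_subset_Icc_self hs)
  obtain ⟨t', ht', h'⟩ := tour_cases (Ico_subset_Icc_self hs')
  have a1 := ht.1
  have a2 := ht.2
  have a3 := ht'.1
  have a4 := ht'.2
  have a5 := hs.2
  have a6 := hs'.2
  rcases h with rfl | rfl | rfl <;> rcases h' with rfl | rfl | rfl <;>
    simp only [tour_zero ht, tour_zero ht', tour_one ht, tour_one ht', tour_two ht, tour_two ht',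
      Prod.mk.injEq] at e <;> obtain ⟨e1, e2, e3⟩ := e <;> linarith

theorem exists_tour_eq {a b c : ℝ} (ha : 0 ≤ a) (hb : 0 ≤ b) (hc : 0 ≤ c) (h : a + b + c = 1)
    (h0 : a = 0 ∨ b = 0 ∨ c = 0) : ∃ s ∈ Icc (0 : ℝ) 3, tour s = (a, b, c) := by
  rcases h0 with rfl | rfl | rfl
  · refine ⟨1 + c, ⟨by linarith, by linarith⟩, ?_⟩
    rw [tour_one ⟨hc, by linarith⟩]
    ext <;> simp; linarith
  · refine ⟨2 + a, ⟨by linarith, by linarith⟩, ?_⟩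
    rw [tour_two ⟨ha, by linarith⟩]
    ext <;> simp; linarith
  · refine ⟨b, ⟨by linarith, by linarith⟩, ?_⟩
    rw [tour_zero ⟨hb, by linarith⟩]
    ext <;> simp; linarith

/-- The boundary word of a triangle bounds its interior. -/
theorem boundsCell_triangle {x y z : V} (hxy : x ≠ y) (hxz : x ≠ z) (hyz : y ≠ z) :
    BoundsCell seg [(x, y), (y, z), (z, x)] (openSimplices {({x, y, z} : Finset V)}) := by
  set pt : ℝ × ℝ × ℝ → V → ℝ := fun q v =>
    (if v = x then q.1 else 0) + (if v = y then q.2.1 else 0) + if v = z then q.2.2 else 0 with hpt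
  have hptc : Continuous pt := by
    refine continuous_pi fun v => ?_
    simp only [hpt]
    split_ifs <;> fun_prop
  have p1 : ∀ q, pt q x = q.1 := fun q => by simp [hpt, hxy, hxz]
  have p2 : ∀ q, pt q y = q.2.1 := fun q => by simp [hpt, hxy.symm, hyz]
  have p3 : ∀ q, pt q z = q.2.2 := fun q => by simp [hpt, hxz.symm, hyz.symm]
  have p4 : ∀ q v, v ≠ x → v ≠ y → v ≠ z → pt q v = 0 := fun q v h1 h2 h3 => by
    simp [hpt, h1, h2, h3]
  have hpti : Function.Injective pt := fun q q' e => by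
    have e1 := congrFun e x
    have e2 := congrFun e y
    have e3 := congrFun e z
    rw [p1, p1] at e1
    rw [p2, p2] at e2
    rw [p3, p3] at e3
    exact Prod.ext e1 (Prod.ext e2 e3)
  -- Cone from the barycentre: radius 0 is the barycentre and radius 1 the boundary tour, in
  -- barycentric coordinates.
  set m : ℝ × ℝ → ℝ × ℝ × ℝ := fun y =>
    ((1 - y.1) / 3 + y.1 * (tour y.2).1, (1 - y.1) / 3 + y.1 * (tour y.2).2.1,
      (1 - y.1) / 3 + y.1 * (tour y.2).2.2) with hm
  have hmc : Continuous m := by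
    have := continuous_tour
    fun_prop
  have hb : IsBoundaryParam (arcs 1 2) 3 := isBoundaryParam_arcs (by norm_num) (by norm_num)
  have hmi : ∀ r s r' s', 0 ≤ r → 0 ≤ r' → s ∈ Ico (0 : ℝ) 3 → s' ∈ Ico (0 : ℝ) 3 →
      m (r, s) = m (r', s') → r = r' ∧ (r = 0 ∨ s = s') := by
    intro r s r' s' hr hr' hs hs' e
    simp only [hm, Prod.mk.injEq] at e
    obtain ⟨e1, e2, e3⟩ := e
    obtain ⟨a1, a2, a3, a4, a5⟩ := tour_spec (Ico_subset_Icc_self hs)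
    obtain ⟨b1, b2, b3, b4, b5⟩ := tour_spec (Ico_subset_Icc_self hs')
    have q1 := mul_nonneg hr a1
    have q2 := mul_nonneg hr a2
    have q3 := mul_nonneg hr a3
    have q1' := mul_nonneg hr' b1
    have q2' := mul_nonneg hr' b2
    have q3' := mul_nonneg hr' b3
    -- Some coordinate of the tour is zero, so the smallest coordinate of the cone point is (1 −
    -- r)/3. This recovers the radius.
    have h1 : r ≤ r' := by
      rcases a5 with h | h | h
      · rw [h] at e1; linarith
      · rw [h] at e2; linarith
      · rw [h] at e3; linarith
    have h2 : r' ≤ r := by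
      rcases b5 with h | h | h
      · rw [h] at e1; linarith
      · rw [h] at e2; linarith
      · rw [h] at e3; linarith
    have h3 : r = r' := le_antisymm h1 h2
    subst h3
    refine ⟨rfl, ?_⟩
    by_cases h0 : r = 0
    · exact Or.inl h0
    · refine Or.inr (tour_injOn hs hs' ?_)
      refine Prod.ext ?_ (Prod.ext ?_ ?_) <;> refine mul_left_cancel₀ h0 ?_ <;> linarith
  have htour3 : tour 0 = tour 3 := by
    have h1 := tour_zero (t := 0) (by simp)
    have h2 := tour_two (t := 1) (by simp)
    rw [h1, show (3 : ℝ) = 2 + 1 by norm_num, h2]; norm_num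
  obtain ⟨φ, hφ, hφ'⟩ := exists_continuousOn_descend (K := Icc (0 : ℝ) 1 ×ˢ Icc (0 : ℝ) 3)
    (f := fun y : ℝ × ℝ => (y.1 : ℂ) * arcs 1 2 y.2) (g := fun y => pt (m y))
    (isCompact_Icc.prod isCompact_Icc)
    (ContinuousOn.mul (by fun_prop) (hb.cont.comp continuousOn_snd fun y hy => by
      simpa using hy.2))
    (hptc.comp hmc).continuousOn (by
      rintro ⟨r, s⟩ ⟨hr, hs⟩ ⟨r', s'⟩ ⟨hr', hs'⟩ h
      have hs2 : s ∈ Icc (0 : ℝ) (3 : ℕ) := by simpa using hs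
      have hs2' : s' ∈ Icc (0 : ℝ) (3 : ℕ) := by simpa using hs'
      obtain ⟨h1, h2⟩ := hb.mul_eq_mul hr.1 hr'.1 hs2 hs2' h
      simp only at h1 h2 ⊢
      subst h1
      rcases h2 with rfl | h2
      · simp [hm]
      · rcases hb.eq_or hs2 hs2' h2 with rfl | ⟨rfl, rfl⟩ | ⟨rfl, rfl⟩
        · rfl
        · simp only [hm, htour3, Nat.cast_ofNat]
        · simp only [hm, htour3, Nat.cast_ofNat])
  have hval : ∀ r ∈ Icc (0 : ℝ) 1, ∀ s ∈ Icc (0 : ℝ) 3, φ (r * arcs 1 2 s) = pt (m (r, s)) :=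
    fun r hr s hs => hφ' (r, s) ⟨hr, hs⟩
  have hm1 : ∀ s, m (1, s) = tour s := fun s => by simp [hm]
  have hval1 : ∀ s ∈ Icc (0 : ℝ) 3, φ (arcs 1 2 s) = pt (tour s) := fun s hs => by
    rw [← hm1, ← hval 1 (by simp) s hs]; simp
  have hpol : ∀ z : ℂ, ∃ s ∈ Ico (0 : ℝ) 3, z = ‖z‖ * arcs 1 2 s := fun z => by
    obtain ⟨s, hs, e⟩ := hb.polar z
    exact ⟨s, by simpa using hs, e⟩
  have hnorm : ∀ s ∈ Icc (0 : ℝ) 3, ‖arcs 1 2 s‖ = 1 := fun s hs => hb.norm s (by simpa using hs)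
  have hsum : ∀ q : ℝ × ℝ × ℝ, ∑ v, pt q v = q.1 + q.2.1 + q.2.2 := fun q => by
    simp [hpt, Finset.sum_add_distrib]
  have himage : φ '' Metric.ball 0 1 = openSimplices {({x, y, z} : Finset V)} := by
    ext q
    constructor
    · rintro ⟨ζ, hζ, rfl⟩
      have n1 : ‖ζ‖ < 1 := by simpa using hζ
      obtain ⟨s, hs, e⟩ := hpol ζ
      have is := Ico_subset_Icc_self hs
      rw [e, hval _ ⟨norm_nonneg _, n1.le⟩ s is]
      obtain ⟨a1, a2, a3, a4, a5⟩ := tour_spec is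
      have hr := norm_nonneg ζ
      have q1 : 0 < (m (‖ζ‖, s)).1 := by
        simp only [hm]; have := mul_nonneg hr a1; linarith
      have q2 : 0 < (m (‖ζ‖, s)).2.1 := by
        simp only [hm]; have := mul_nonneg hr a2; linarith
      have q3 : 0 < (m (‖ζ‖, s)).2.2 := by
        simp only [hm]; have := mul_nonneg hr a3; linarith
      refine ⟨fun v => ?_, ?_, ?_⟩
      · simp only [hpt]; split_ifs <;> linarith
      · rw [hsum]; simp only [hm]; linear_combination ‖ζ‖ * a4
      · rw [mem_singleton_iff]
        ext v
        simp only [Finset.mem_filter, Finset.mem_univ, true_and, Finset.mem_insert,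
          Finset.mem_singleton]
        constructor
        · intro h
          by_contra hn
          simp only [not_or] at hn
          exact h (p4 _ v hn.1 hn.2.1 hn.2.2)
        · rintro (rfl | rfl | rfl)
          · rw [p1]; exact q1.ne'
          · rw [p2]; exact q2.ne'
          · rw [p3]; exact q3.ne'
    · rintro ⟨h0, h1, h2⟩
      rw [mem_singleton_iff] at h2
      have hne : ∀ v, q v ≠ 0 ↔ v = x ∨ v = y ∨ v = z := fun v => by
        have : v ∈ Finset.univ.filter (fun v => q v ≠ 0) ↔ v ∈ ({x, y, z} : Finset V) := by
          rw [h2]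
        simpa using this
      have c1 : 0 < q x := lt_of_le_of_ne (h0 x) (Ne.symm ((hne x).2 (by simp)))
      have c2 : 0 < q y := lt_of_le_of_ne (h0 y) (Ne.symm ((hne y).2 (by simp)))
      have c3 : 0 < q z := lt_of_le_of_ne (h0 z) (Ne.symm ((hne z).2 (by simp)))
      have hq : pt (q x, q y, q z) = q := by
        funext v
        by_cases hv : v = x ∨ v = y ∨ v = z
        · rcases hv with rfl | rfl | rfl
          · rw [p1]
          · rw [p2]
          · rw [p3]
        · have h5 : q v = 0 := by by_contra h; exact hv ((hne v).1 h)
          simp only [not_or] at hv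
          rw [p4 _ v hv.1 hv.2.1 hv.2.2, h5]
      have hs1 : q x + q y + q z = 1 := by
        rw [← h1, ← hq, hsum, hq]
      -- `μ` is the smallest barycentric coordinate, which has to equal (1 − r)/3; this dictates r =
      -- 1 − 3μ.
      obtain ⟨μ, hμ, hμx, hμy, hμz, hμe⟩ : ∃ μ : ℝ, 0 < μ ∧ μ ≤ q x ∧ μ ≤ q y ∧ μ ≤ q z ∧
          (μ = q x ∨ μ = q y ∨ μ = q z) := by
        rcases le_total (q x) (q y) with h | h <;> rcases le_total (q x) (q z) with h' | h' <;>
          rcases le_total (q y) (q z) with h'' | h''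
        all_goals first
          | exact ⟨q x, c1, le_rfl, by linarith, by linarith, by simp⟩
          | exact ⟨q y, c2, by linarith, le_rfl, by linarith, by simp⟩
          | exact ⟨q z, c3, by linarith, by linarith, le_rfl, by simp⟩
      obtain ⟨r, hr⟩ : ∃ r : ℝ, r = 1 - 3 * μ := ⟨_, rfl⟩
      have hr0 : 0 ≤ r := by linarith
      have hr1 : r < 1 := by linarith
      obtain ⟨s, hs, hms⟩ : ∃ s ∈ Icc (0 : ℝ) 3, m (r, s) = (q x, q y, q z) := by
        rcases eq_or_lt_of_le hr0 with h | h
        · refine ⟨0, by simp, ?_⟩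
          simp only [hm, ← h]
          refine Prod.ext ?_ (Prod.ext ?_ ?_) <;> simp <;> linarith
        · obtain ⟨s, hs, e⟩ := exists_tour_eq (a := (q x - μ) / r) (b := (q y - μ) / r)
            (c := (q z - μ) / r) (div_nonneg (by linarith) hr0) (div_nonneg (by linarith) hr0)
            (div_nonneg (by linarith) hr0) (by field_simp; linarith) (by
              rcases hμe with e | e | e <;> simp [e])
          refine ⟨s, hs, ?_⟩
          simp only [hm, e]
          refine Prod.ext ?_ (Prod.ext ?_ ?_) <;> simp only <;> rw [mul_div_cancel₀ _ h.ne', hr] <;>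
            ring
      refine ⟨r * arcs 1 2 s, ?_, ?_⟩
      · simpa [hnorm s hs, abs_of_nonneg hr0] using hr1
      · rw [hval r ⟨hr0, hr1.le⟩ s hs, hms, hq]
  refine ⟨arcs 1 2, φ, hb, ?_, ?_, himage, ?_, ?_⟩
  · refine hφ.mono fun ζ hζ => ?_
    obtain ⟨s, hs, e⟩ := hpol ζ
    exact ⟨(‖ζ‖, s), ⟨⟨norm_nonneg _, by simpa using hζ⟩, Ico_subset_Icc_self hs⟩, e.symm⟩
  · intro ζ hζ ζ' hζ' e
    obtain ⟨s, hs, e1⟩ := hpol ζ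
    obtain ⟨s', hs', e2⟩ := hpol ζ'
    have n1 : ‖ζ‖ < 1 := by simpa using hζ
    have n2 : ‖ζ'‖ < 1 := by simpa using hζ'
    rw [e1, e2, hval _ ⟨norm_nonneg _, n1.le⟩ s (Ico_subset_Icc_self hs),
      hval _ ⟨norm_nonneg _, n2.le⟩ s' (Ico_subset_Icc_self hs')] at e
    obtain ⟨h1, h2⟩ := hmi _ _ _ _ (norm_nonneg _) (norm_nonneg _) hs hs' (hpti e)
    rcases h2 with h2 | h2
    · rw [e1, e2, ← h1, h2]; simp
    · rw [e1, e2, ← h1, h2]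
  · intro k hk t ht
    have hk3 : k < 3 := by simpa using hk
    have := mem_Icc_length hk ht
    rw [hval1 _ (by simpa using this)]
    interval_cases k
    · rw [Nat.cast_zero, zero_add, tour_zero ht]
      funext v
      simp [hpt, seg]
    · rw [Nat.cast_one, tour_one ht]
      funext v
      simp [hpt, seg]
    · rw [Nat.cast_ofNat, tour_two ht]
      funext v
      simp [hpt, seg, add_comm]
  · intro ζ hζ
    obtain ⟨s, hs, e⟩ := hpol ζ
    have is := Ico_subset_Icc_self hs
    rw [hζ] at e
    simp only [Complex.ofReal_one, one_mul] at e
    rw [e, hval1 s is]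
    rintro ⟨-, -, h2⟩
    rw [mem_singleton_iff] at h2
    have hne : ∀ v, (v = x ∨ v = y ∨ v = z) → pt (tour s) v ≠ 0 := fun v hv => by
      have : v ∈ Finset.univ.filter (fun v => pt (tour s) v ≠ 0) := by rw [h2]; simpa using hv
      simpa using this
    obtain ⟨-, -, -, -, h5⟩ := tour_spec is
    rcases h5 with h5 | h5 | h5
    · exact hne x (by simp) (by rw [p1, h5])
    · exact hne y (by simp) (by rw [p2, h5])
    · exact hne z (by simp) (by rw [p3, h5])

end OpenSimplices

/-! ### Closed walks and regions -/

section Regions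

set_option linter.unusedSectionVars false

variable {V : Type*} [Fintype V] [DecidableEq V]

/-- The unoriented edge of a dart. -/
def dartEdge (d : V × V) : Sym2 V := s(d.1, d.2)

/-- `w` is a walk from `p` to `q`, given by its darts. -/
def IsWalk : V → List (V × V) → V → Prop
  | p, [], q => p = q
  | p, d :: w, q => d.1 = p ∧ IsWalk d.2 w q

/-- `w` is a closed walk. -/
def IsClosedWalk (w : List (V × V)) : Prop := ∃ p, IsWalk p w p

/-- The vertices of a closed walk. -/
def wordVerts (w : List (V × V)) : Finset V := (w.map Prod.fst).toFinset

/-- The edges of a walk. -/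
def wordEdges (w : List (V × V)) : Finset (Sym2 V) := (w.map dartEdge).toFinset

/-- The number of passages of a walk through an edge. -/
def edgeCount (w : List (V × V)) (e : Sym2 V) : ℕ := (w.map dartEdge).count e

/-- The coefficients of the 1-chain of a walk. -/
def net (w : List (V × V)) (x y : V) : ℚ := (w.count (x, y) : ℚ) - w.count (y, x)

theorem isWalk_append {p q : V} {u v : List (V × V)} :
    IsWalk p (u ++ v) q ↔ ∃ r, IsWalk p u r ∧ IsWalk r v q := by
  induction u generalizing p with
  | nil => simp [IsWalk]
  | cons d u ih => simp [IsWalk, ih, and_assoc]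

theorem IsClosedWalk.rotate {u v : List (V × V)} (h : IsClosedWalk (u ++ v)) :
    IsClosedWalk (v ++ u) := by
  obtain ⟨p, hp⟩ := h
  obtain ⟨r, h1, h2⟩ := isWalk_append.1 hp
  exact ⟨r, isWalk_append.2 ⟨p, h2, h1⟩⟩

theorem mem_wordVerts {w : List (V × V)} {v : V} : v ∈ wordVerts w ↔ ∃ d ∈ w, d.1 = v := by
  simp [wordVerts]

theorem mem_wordEdges {w : List (V × V)} {e : Sym2 V} :
    e ∈ wordEdges w ↔ ∃ d ∈ w, dartEdge d = e := by simp [wordEdges]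

theorem edgeCount_pos {w : List (V × V)} {e : Sym2 V} : 0 < edgeCount w e ↔ e ∈ wordEdges w := by
  rw [edgeCount, List.count_pos_iff, wordEdges, List.mem_toFinset]

theorem IsWalk.snd_mem {p q : V} {w : List (V × V)} (h : IsWalk p w q) {d : V × V} (hd : d ∈ w) :
    d.2 ∈ wordVerts w ∨ d.2 = q := by
  induction w generalizing p with
  | nil => simp at hd
  | cons a w ih =>
    obtain ⟨-, h2⟩ := h
    rcases List.mem_cons.1 hd with rfl | hd
    · cases w with
      | nil => exact Or.inr h2
      | cons b w => exact Or.inl (mem_wordVerts.2 ⟨b, by simp, h2.1⟩)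
    · rcases ih h2 hd with h3 | h3
      · obtain ⟨b, hb, e⟩ := mem_wordVerts.1 h3
        exact Or.inl (mem_wordVerts.2 ⟨b, List.mem_cons_of_mem _ hb, e⟩)
      · exact Or.inr h3

theorem IsClosedWalk.snd_mem {w : List (V × V)} (h : IsClosedWalk w) {d : V × V} (hd : d ∈ w) :
    d.2 ∈ wordVerts w := by
  obtain ⟨p, hp⟩ := h
  rcases hp.snd_mem hd with h1 | h1
  · exact h1
  · cases w with
    | nil => simp at hd
    | cons a w => exact mem_wordVerts.2 ⟨a, by simp, by rw [h1]; exact hp.1⟩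

theorem edgeCount_append (u v : List (V × V)) (e : Sym2 V) :
    edgeCount (u ++ v) e = edgeCount u e + edgeCount v e := by
  simp [edgeCount, List.count_append]

theorem net_append (u v : List (V × V)) (x y : V) :
    net (u ++ v) x y = net u x y + net v x y := by
  simp only [net, List.count_append]; push_cast; ring

theorem edgeCount_eq {w : List (V × V)} {x y : V} (h : x ≠ y) :
    edgeCount w s(x, y) = w.count (x, y) + w.count (y, x) := by
  induction w with
  | nil => simp [edgeCount]
  | cons d w ih =>
    unfold edgeCount at ih ⊢
    rw [List.map_cons, List.count_cons, List.count_cons, List.count_cons, ih]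
    obtain ⟨a, b⟩ := d
    simp only [dartEdge, beq_iff_eq, Sym2.eq_iff, Prod.mk.injEq]
    by_cases h1 : a = x ∧ b = y
    · obtain ⟨rfl, rfl⟩ := h1
      simp only [h, h.symm, and_self, true_or, if_true, if_false]
      omega
    · by_cases h2 : a = y ∧ b = x
      · obtain ⟨rfl, rfl⟩ := h2
        simp only [h, h.symm, and_self, or_true, if_true, if_false]
        omega
      · simp only [h1, h2, or_self, if_false]
        omega

/-- The simplices that make up a region: its triangles `R`, inner edges `I` and inner
vertices `J`. -/
def cellFaces (R : Finset (Finset V)) (I : Finset (Sym2 V)) (J : Finset V) : Set (Finset V) :=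
  {s | s ∈ R ∨ (∃ e ∈ I, s = e.toFinset) ∨ ∃ v ∈ J, s = {v}}

/-- A set `R` of triangles, merged along the inner edges `I` and the inner vertices `J` to an open
2-cell that is bounded by the closed walk `w`. -/
structure IsRegion (F : Finset (Finset V)) (c : V → V → V → ℚ) (R : Finset (Finset V))
    (w : List (V × V)) (I : Finset (Sym2 V)) (J : Finset V) : Prop where
  subset : R ⊆ F
  ne_nil : w ≠ []
  walk : IsClosedWalk w
  nondiag : ∀ d ∈ w, d.1 ≠ d.2
  cell : BoundsCell seg w (openSimplices (cellFaces R I J))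
  count : ∀ e : Sym2 V, ¬ e.IsDiag → edgeCount w e = if e ∈ I then 0 else edgeDeg R e
  inner : ∀ e ∈ I, ¬ e.IsDiag ∧ edgeDeg F e = 2 ∧ edgeDeg R e = 2
  disj : ∀ v ∈ J, v ∉ wordVerts w
  verts : wordVerts w ∪ J = verts R
  -- The open cell has triangles − inner edges + inner vertices = 1.
  euler : I.card + 1 = R.card + J.card
  -- `a` is the common coefficient of `c` on the triangles of the region, oriented along the cell.
  bdry : ∃ a : ℚ, a ≠ 0 ∧ ∀ x y, bdry (restrict R c) x y = a * net w x y

variable {F R : Finset (Finset V)} {c : V → V → V → ℚ} {I : Finset (Sym2 V)} {J : Finset V}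

theorem IsRegion.rotate {u v : List (V × V)} (h : IsRegion F c R (u ++ v) I J) :
    IsRegion F c R (v ++ u) I J := by
  have hp : (v ++ u).Perm (u ++ v) := List.perm_append_comm
  have hv : wordVerts (v ++ u) = wordVerts (u ++ v) := by
    ext a; simp only [mem_wordVerts, hp.mem_iff]
  refine ⟨h.subset, ?_, h.walk.rotate, fun d hd => h.nondiag d (hp.mem_iff.1 hd), h.cell.rotate,
    fun e he => ?_, h.inner, by rw [hv]; exact h.disj, by rw [hv]; exact h.verts, h.euler, ?_⟩
  · have := h.ne_nil
    simp only [ne_eq, List.append_eq_nil_iff] at this ⊢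
    tauto
  · rw [← h.count e he, edgeCount_append, edgeCount_append, add_comm]
  · obtain ⟨a, ha, hb⟩ := h.bdry
    refine ⟨a, ha, fun x y => ?_⟩
    rw [hb, net_append, net_append, add_comm]

theorem incident_mk {x y : V} {t : Finset V} : Incident s(x, y) t ↔ x ∈ t ∧ y ∈ t := Sym2.ball

theorem incident_triple {x y z : V} {e : Sym2 V} (he : ¬ e.IsDiag) :
    Incident e {x, y, z} → e = s(x, y) ∨ e = s(y, z) ∨ e = s(z, x) := by
  induction e with
  | h p q =>
    rw [incident_mk]
    simp only [Sym2.mk_isDiag_iff] at he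
    simp only [Finset.mem_insert, Finset.mem_singleton, Sym2.eq_iff]
    rintro ⟨rfl | rfl | rfl, rfl | rfl | rfl⟩ <;> simp_all

theorem edgeDeg_insert {t : Finset V} (ht : t ∉ R) (e : Sym2 V) :
    edgeDeg (insert t R) e = edgeDeg R e + if Incident e t then 1 else 0 := by
  unfold edgeDeg
  rw [Finset.filter_insert]
  split_ifs with h
  · rw [Finset.card_insert_of_notMem (by simp [ht])]
  · rfl

theorem edgeDeg_mono {R F : Finset (Finset V)} (h : R ⊆ F) (e : Sym2 V) :
    edgeDeg R e ≤ edgeDeg F e := Finset.card_le_card (Finset.filter_subset_filter _ h)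

theorem edgeDeg_pos {R : Finset (Finset V)} {e : Sym2 V} :
    0 < edgeDeg R e ↔ ∃ t ∈ R, Incident e t := by
  rw [edgeDeg, Finset.card_pos]
  simp [Finset.Nonempty]

/-- If all triangles of `F` at `e` are counted in `R`, they belong to `R`. -/
theorem mem_of_edgeDeg_eq {R F : Finset (Finset V)} (h : R ⊆ F) {e : Sym2 V}
    (he : edgeDeg F e ≤ edgeDeg R e) {t : Finset V} (ht : t ∈ F) (hi : Incident e t) : t ∈ R := by
  have := Finset.eq_of_subset_of_card_le (Finset.filter_subset_filter (Incident e) h) he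
  have h2 : t ∈ F.filter (Incident e) := Finset.mem_filter.2 ⟨ht, hi⟩
  rw [← this] at h2
  exact (Finset.mem_filter.1 h2).1

theorem bdry_restrict_insert {t : Finset V} (ht : t ∉ R) (x y : V) :
    bdry (restrict (insert t R) c) x y =
      bdry (restrict R c) x y + bdry (restrict {t} c) x y := by
  unfold bdry
  rw [← Finset.sum_add_distrib]
  refine Finset.sum_congr rfl fun w _ => ?_
  unfold restrict
  by_cases h1 : ({w, x, y} : Finset V) = t
  · subst h1; simp [ht]
  · simp [h1]

theorem bdry_restrict_singleton (hc : IsAlternating c) {x y z : V} (hxy : x ≠ y)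
    (hxz : x ≠ z) (hyz : y ≠ z) (p q : V) :
    bdry (restrict {({x, y, z} : Finset V)} c) p q =
      c x y z * net [(x, y), (y, z), (z, x)] p q := by
  have key : ∀ p q r : V, p ≠ q → p ≠ r → q ≠ r → ({r, p, q} : Finset V) = {x, y, z} →
      bdry (restrict {({x, y, z} : Finset V)} c) p q = c r p q := by
    intro p q r hpq hpr hqr e
    unfold bdry
    rw [Finset.sum_eq_single r]
    · simp [restrict, e]
    · intro w _ hw
      refine restrict_eq_zero_of_notMem ?_
      rw [Finset.mem_singleton, ← e]
      intro h
      have : r ∈ ({w, p, q} : Finset V) := by rw [h]; simp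
      simp [hw.symm, hpr.symm, hqr.symm] at this
    · simp
  have zero : (p ∉ ({x, y, z} : Finset V) ∨ q ∉ ({x, y, z} : Finset V) ∨ p = q) →
      bdry (restrict {({x, y, z} : Finset V)} c) p q = 0 := by
    intro h
    refine Finset.sum_eq_zero fun w _ => restrict_eq_zero_of_notMem ?_
    rw [Finset.mem_singleton]
    intro e
    rcases h with h | h | h
    · exact h (e ▸ by simp)
    · exact h (e ▸ by simp)
    · subst h
      have h3 : ({x, y, z} : Finset V).card = 3 := Finset.card_eq_three.2 ⟨x, y, z, hxy, hxz, hyz, rfl⟩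
      rw [← e] at h3
      exact (card_insert_eq_three h3).2.2 rfl
  by_cases hp : p ∈ ({x, y, z} : Finset V)
  swap
  · rw [zero (Or.inl hp)]
    simp only [Finset.mem_insert, Finset.mem_singleton, not_or] at hp
    obtain ⟨h1, h2, h3⟩ := hp
    simp [net, Ne.symm h1, Ne.symm h2, Ne.symm h3]
  by_cases hq : q ∈ ({x, y, z} : Finset V)
  swap
  · rw [zero (Or.inr (Or.inl hq))]
    simp only [Finset.mem_insert, Finset.mem_singleton, not_or] at hq
    obtain ⟨h1, h2, h3⟩ := hq
    simp [net, Ne.symm h1, Ne.symm h2, Ne.symm h3]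
  simp only [Finset.mem_insert, Finset.mem_singleton] at hp hq
  have s1 := hc.swap x y z
  have s2 := hc.rot x y z
  have s3 := hc.rot y z x
  have s4 := hc.swap y z x
  have s5 := hc.swap z x y
  rcases hp with rfl | rfl | rfl <;> rcases hq with rfl | rfl | rfl
  · rw [zero (by simp)]; simp [net]
  · rw [key p q z hxy hxz hyz (by ext; simp; tauto)]
    simp [net, hxy, hxz, hyz, hxy.symm, hxz.symm, hyz.symm]
    linarith
  · rw [key p q y hxz hxy hyz.symm (by ext; simp; tauto)]
    simp [net, hxy, hxz, hyz, hxy.symm, hxz.symm, hyz.symm]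
    linarith
  · rw [key p q z hxy.symm hyz hxz (by ext; simp; tauto)]
    simp [net, hxy, hxz, hyz, hxy.symm, hxz.symm, hyz.symm]
    linarith
  · rw [zero (by simp)]; simp [net]
  · rw [key p q x hyz hxy.symm hxz.symm (by ext; simp)]
    simp [net, hxy, hxz, hyz, hxy.symm, hxz.symm, hyz.symm]
  · rw [key p q y hxz.symm hyz.symm hxy (by ext; simp; tauto)]
    simp [net, hxy, hxz, hyz, hxy.symm, hxz.symm, hyz.symm]
    linarith
  · rw [key p q x hyz.symm hxz.symm hxy.symm (by ext; simp; tauto)]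
    simp [net, hxy, hxz, hyz, hxy.symm, hxz.symm, hyz.symm]
    linarith
  · rw [zero (by simp)]; simp [net]

theorem cellFaces_singleton (t : Finset V) : cellFaces {t} ∅ ∅ = {t} := by
  ext s; simp [cellFaces]

theorem edgeCount_triangle {x y z : V} (hxy : x ≠ y) (hxz : x ≠ z) (hyz : y ≠ z) {e : Sym2 V}
    (he : ¬ e.IsDiag) : edgeCount [(x, y), (y, z), (z, x)] e =
      if Incident e ({x, y, z} : Finset V) then 1 else 0 := by
  by_cases hi : Incident e ({x, y, z} : Finset V)
  · rw [if_pos hi]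
    rcases incident_triple he hi with rfl | rfl | rfl <;>
      simp [edgeCount, dartEdge, hxy, hxz, hyz, hxy.symm, hxz.symm, hyz.symm]
  · rw [if_neg hi, edgeCount, List.count_eq_zero]
    simp only [List.map_cons, List.map_nil, dartEdge, List.mem_cons, List.not_mem_nil, or_false]
    rintro (rfl | rfl | rfl) <;> exact hi (by rw [incident_mk]; simp)

/-- The growth of regions starts here; the factor `a` is the coefficient of the triangle, nonzero as
the triangle lies in `F`. -/
theorem IsFundamentalCycle.isRegion_triangle (hF : IsFundamentalCycle F c) {x y z : V}
    (ht : ({x, y, z} : Finset V) ∈ F) :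
    IsRegion F c {{x, y, z}} [(x, y), (y, z), (z, x)] ∅ ∅ := by
  obtain ⟨hxy, hxz, hyz⟩ := card_insert_eq_three (hF.card _ ht)
  refine ⟨by simpa using ht, by simp, ⟨x, by simp [IsWalk]⟩, ?_, ?_, ?_, by simp, by simp, ?_,
    by simp, ⟨c x y z, (hF.supp x y z).2 ht, bdry_restrict_singleton hF.alt hxy hxz hyz⟩⟩
  · simp [hxy, hyz, hxz.symm]
  · rw [cellFaces_singleton]
    exact boundsCell_triangle hxy hxz hyz
  · intro e he
    rw [edgeCount_triangle hxy hxz hyz he, edgeDeg, Finset.filter_singleton]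
    split_ifs <;> simp_all
  · ext v
    simp [mem_wordVerts, mem_verts, eq_comm]

theorem exists_third {t : Finset V} (ht : t.card = 3) {x y : V} (hx : x ∈ t) (hy : y ∈ t)
    (hxy : x ≠ y) : ∃ z, x ≠ z ∧ y ≠ z ∧ t = {x, y, z} := by
  obtain ⟨a, b, d, h1, h2, h3, rfl⟩ := Finset.card_eq_three.1 ht
  simp only [Finset.mem_insert, Finset.mem_singleton] at hx hy
  rcases hx with rfl | rfl | rfl <;> rcases hy with rfl | rfl | rfl
  · exact absurd rfl hxy
  · exact ⟨d, h2, h3, rfl⟩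
  · exact ⟨b, h1, h3.symm, by ext; simp; tauto⟩
  · exact ⟨d, h3, h2, by ext; simp; tauto⟩
  · exact absurd rfl hxy
  · exact ⟨a, h1.symm, h2.symm, by ext; simp; tauto⟩
  · exact ⟨b, h3.symm, h1, by ext; simp; tauto⟩
  · exact ⟨a, h2.symm, h1.symm, by ext; simp; tauto⟩
  · exact absurd rfl hxy

theorem card_toFinset_edge {e : Sym2 V} (he : ¬ e.IsDiag) : e.toFinset.card = 2 :=
  Sym2.card_toFinset_of_not_isDiag e he

theorem toFinset_mk (x y : V) : (s(x, y)).toFinset = {x, y} := Sym2.toFinset_mk_eq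

theorem toFinset_injective : Function.Injective (Sym2.toFinset : Sym2 V → Finset V) := by
  intro e e' h
  refine Sym2.ext fun v => ?_
  rw [← Sym2.mem_toFinset, h, Sym2.mem_toFinset]

end Regions

/-! ### Attaching a triangle to a region, and folding an edge -/

section Moves

set_option linter.unusedSectionVars false

variable {V : Type*} [Fintype V] [DecidableEq V]
variable {F R : Finset (Finset V)} {c : V → V → V → ℚ} {I : Finset (Sym2 V)} {J : Finset V}

theorem wordVerts_append (u v : List (V × V)) : wordVerts (u ++ v) = wordVerts u ∪ wordVerts v := by
  simp [wordVerts]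

theorem wordVerts_cons (d : V × V) (u : List (V × V)) :
    wordVerts (d :: u) = insert d.1 (wordVerts u) := by
  simp [wordVerts]

theorem wordVerts_nil : wordVerts ([] : List (V × V)) = ∅ := rfl

theorem segFace_eq_of_seg_eq {d d' : V × V} (hd : d.1 ≠ d.2) (hd' : d'.1 ≠ d'.2) {t t' : ℝ}
    (h : seg d t = seg d' t') : segFace d t = segFace d' t' := by
  rw [← filter_seg hd, ← filter_seg hd', h]

theorem card_segFace_le (d : V × V) (t : ℝ) : (segFace d t).card ≤ 2 := by
  rcases segFace_cases d t with h | h | h <;> rw [h]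
  · simp
  · simp
  · exact Finset.card_le_two

theorem segFace_eq_pair {d : V × V} {t : ℝ} (h : (segFace d t).card = 2) :
    segFace d t = {d.1, d.2} := by
  rcases segFace_cases d t with h' | h' | h'
  · rw [h'] at h; simp at h
  · rw [h'] at h; simp at h
  · exact h'

theorem toFinset_dartEdge (d : V × V) : (dartEdge d).toFinset = {d.1, d.2} := toFinset_mk _ _

theorem edgeCount_singleton (d : V × V) (e : Sym2 V) :
    edgeCount [d] e = if dartEdge d = e then 1 else 0 := by
  simp [edgeCount, List.count_singleton]

theorem edgeCount_eq_zero {w : List (V × V)} {e : Sym2 V} :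
    edgeCount w e = 0 ↔ ∀ d ∈ w, dartEdge d ≠ e := by
  simp [edgeCount, List.count_eq_zero]

theorem net_singleton_swap (x y p q : V) : net [(y, x)] p q = -net [(x, y)] p q := by
  simp only [net, List.count_singleton, beq_iff_eq, Prod.mk.injEq, and_comm (a := y = p),
    and_comm (a := y = q), neg_sub]

theorem exists_mem_of_edgeDeg_lt {e : Sym2 V} (h : edgeDeg R e < edgeDeg F e) :
    ∃ t ∈ F, t ∉ R ∧ Incident e t := by
  by_contra! hn
  refine absurd (Finset.card_le_card ?_) (not_le.2 h)
  intro t ht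
  obtain ⟨h1, h2⟩ := Finset.mem_filter.1 ht
  refine Finset.mem_filter.2 ⟨?_, h2⟩
  by_contra h3
  exact hn t h1 h3 h2

theorem not_isClosedWalk_singleton {d : V × V} (hd : d.1 ≠ d.2) : ¬ IsClosedWalk [d] := by
  rintro ⟨p, h1, h2⟩
  exact hd (h1.trans h2.symm)

/-- The edge xy has one triangle in `R` and one outside. The outer triangle, with third vertex z, is
merged along xy: the letter xy is replaced by xz, zy, and xy becomes an inner edge. The vertex z may
already lie on the boundary of the cell, since only the open cell is embedded; hence no inner
vertices arise. -/
theorem IsRegion.attach (hF : IsFundamentalCycle F c) {u : List (V × V)} {x y : V}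
    (h : IsRegion F c R (u ++ [(x, y)]) I ∅) (h2 : edgeDeg F s(x, y) = 2)
    (h1 : edgeDeg R s(x, y) = 1) :
    ∃ t ∈ F, t ∉ R ∧ Incident s(x, y) t ∧ ∃ w' I', IsRegion F c (insert t R) w' I' ∅ := by
  obtain ⟨t, htF, htR, hti⟩ := exists_mem_of_edgeDeg_lt (by omega : edgeDeg R s(x, y) < edgeDeg F s(x, y))
  refine ⟨t, htF, htR, hti, ?_⟩
  have hxy : x ≠ y := h.nondiag (x, y) (by simp)
  have hdi : ¬ (s(x, y)).IsDiag := by simpa using hxy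
  rw [incident_mk] at hti
  obtain ⟨z, hxz, hyz, rfl⟩ := exists_third (hF.card t htF) hti.1 hti.2 hxy
  have ht' : ({x, y, z} : Finset V) = {x, z, y} := by ext; simp; tauto
  have heI : s(x, y) ∉ I := fun hI => by have := (h.inner _ hI).2.2; omega
  have hcu : edgeCount u s(x, y) = 0 := by
    have := h.count _ hdi
    rw [if_neg heI, h1, edgeCount_append, edgeCount_singleton,
      if_pos (by rfl)] at this
    omega
  have hu : u ≠ [] := by
    rintro rfl
    exact not_isClosedWalk_singleton hxy h.walk
  have hud : ∀ d ∈ u, d.1 ≠ d.2 := fun d hd => h.nondiag d (by simp [hd])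
  have hins : R ⊆ insert {x, y, z} R := Finset.subset_insert _ _
  have hsub : insert {x, y, z} R ⊆ F := Finset.insert_subset htF h.subset
  have hinI : ∀ e ∈ I, ¬ Incident e ({x, y, z} : Finset V) := fun e he hi =>
    htR (mem_of_edgeDeg_eq h.subset (by have := h.inner e he; omega) htF hi)
  have hcard := hF.card _ htF
  have htop : edgeDeg (insert {x, y, z} R) s(x, y) = 2 := by
    rw [edgeDeg_insert htR, if_pos (incident_mk.2 hti), h1]
  refine ⟨u ++ [(x, z), (z, y)], insert s(x, y) I, hsub, by simp, ?_, ?_, ?_, ?_, ?_, by simp, ?_,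
    ?_, ?_⟩
  · obtain ⟨p, hp⟩ := h.walk
    obtain ⟨r, h3, h4, h5⟩ := isWalk_append.1 hp
    exact ⟨p, isWalk_append.2 ⟨r, h3, h4, rfl, h5⟩⟩
  · intro d hd
    rcases List.mem_append.1 hd with hd | hd
    · exact hud d hd
    · simp only [List.mem_cons, List.not_mem_nil, or_false] at hd
      rcases hd with rfl | rfl
      · exact hxz
      · exact hyz.symm
  · have hT := boundsCell_triangle hxz hxy hyz.symm
    have hm := BoundsCell.merge (v := [(x, z), (z, y)]) h.cell hT hu (by simp)
      (fun t _ => seg_swap x y t) (seg_injective hxy).injOn ?_ ?_ ?_ ?_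
    · rw [seg_image_Ioo hxy, ← openSimplices_union, ← openSimplices_union] at hm
      convert hm using 2
      ext s
      simp only [cellFaces, mem_union, mem_ofPred_eq, Finset.mem_insert, mem_singleton_iff, ← ht',
        Finset.notMem_empty, false_and, exists_false, or_false]
      constructor
      · rintro ((rfl | h) | ⟨e, rfl | he, rfl⟩)
        · simp
        · simp [h]
        · right; exact toFinset_mk _ _
        · exact Or.inl (Or.inl (Or.inr ⟨e, he, rfl⟩))
      · rintro (((h | ⟨e, he, rfl⟩) | rfl) | rfl)
        · exact Or.inl (Or.inr h)
        · exact Or.inr ⟨e, Or.inr he, rfl⟩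
        · simp
        · exact Or.inr ⟨_, Or.inl rfl, (toFinset_mk _ _).symm⟩
    · refine disjoint_openSimplices (disjoint_right.2 ?_)
      rintro s rfl
      rw [← ht']
      rintro (h3 | ⟨e, he, h3⟩ | ⟨v, hv, -⟩)
      · exact htR h3
      · have := card_toFinset_edge (h.inner e he).1
        rw [← h3] at this
        omega
      · simp at hv
    · intro d hd t ht
      rw [seg_mem_openSimplices (hud d hd) ht, mem_singleton_iff, ← ht']
      intro h3
      have := card_segFace_le d t
      rw [h3] at this
      omega
    · intro d hd t ht
      have hd' : d.1 ≠ d.2 ∧ Incident (dartEdge d) ({x, y, z} : Finset V) := by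
        simp only [List.mem_cons, List.not_mem_nil, or_false] at hd
        rcases hd with rfl | rfl
        · exact ⟨hxz, incident_mk.2 (by simp)⟩
        · exact ⟨hyz.symm, incident_mk.2 (by simp)⟩
      rw [seg_mem_openSimplices hd'.1 ht]
      rintro (h3 | ⟨e, he, h3⟩ | ⟨v, hv, -⟩)
      · have := hF.card _ (h.subset h3)
        have := card_segFace_le d t
        omega
      · have h4 := segFace_eq_pair (by rw [h3]; exact card_toFinset_edge (h.inner e he).1)
        rw [h4, ← toFinset_dartEdge] at h3
        exact hinI e he (toFinset_injective h3 ▸ hd'.2)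
      · simp at hv
    · intro t ht d hd t' ht' e
      have hd' : d.1 ≠ d.2 ∧ dartEdge d ≠ s(x, y) := by
        rcases List.mem_append.1 hd with hd | hd
        · exact ⟨hud d hd, edgeCount_eq_zero.1 hcu d hd⟩
        · simp only [List.mem_cons, List.not_mem_nil, or_false] at hd
          rcases hd with rfl | rfl
          · exact ⟨hxz, by simp [dartEdge, hyz.symm, hxy]⟩
          · exact ⟨hyz.symm, by simp [dartEdge, hxz.symm, hyz.symm]⟩
      have h3 := segFace_eq_of_seg_eq hd'.1 hxy e
      rw [segFace_of_mem_Ioo ht] at h3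
      have h4 := segFace_eq_pair (by rw [h3]; exact Finset.card_pair hxy)
      rw [h4, ← toFinset_dartEdge, ← toFinset_mk] at h3
      exact hd'.2 (toFinset_injective h3)
  · intro e he
    have e1 := h.count e he
    have e2 := edgeCount_triangle hxz hxy hyz.symm he
    rw [← ht', show [(x, z), (z, y), (y, x)] = [(x, z), (z, y)] ++ [(y, x)] from rfl, edgeCount_append,
      edgeCount_singleton] at e2
    rw [edgeCount_append, edgeCount_singleton] at e1
    rw [edgeCount_append, edgeDeg_insert htR]
    by_cases he0 : e = s(x, y)
    · subst he0
      simp only [dartEdge, incident_mk, hti, Sym2.eq_swap (a := y), heI, h1, and_self, if_true,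
        if_false, Finset.mem_insert, true_or] at e1 e2 ⊢
      omega
    · rw [if_neg (by simpa [dartEdge, Sym2.eq_swap] using Ne.symm he0)] at e2
      rw [if_neg (by simpa [dartEdge] using Ne.symm he0)] at e1
      simp only [Finset.mem_insert, he0, false_or]
      by_cases heI' : e ∈ I
      · rw [if_pos heI'] at e1 ⊢
        rw [if_neg (hinI e heI')] at e2
        omega
      · rw [if_neg heI'] at e1 ⊢
        omega
  · intro e he
    rcases Finset.mem_insert.1 he with rfl | he
    · exact ⟨hdi, h2, htop⟩
    · obtain ⟨a1, a2, a3⟩ := h.inner e he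
      refine ⟨a1, a2, le_antisymm ?_ ?_⟩
      · rw [← a2]; exact edgeDeg_mono hsub e
      · rw [← a3]; exact edgeDeg_mono hins e
  · have hv := h.verts
    have hy := h.walk.snd_mem (d := (x, y)) (by simp)
    simp only [wordVerts_append, wordVerts_cons, wordVerts_nil, Finset.union_empty] at hv hy ⊢
    have : MinimalCycles.verts (insert {x, y, z} R) = {x, y, z} ∪ MinimalCycles.verts R := by
      simp [MinimalCycles.verts]
    rw [this, ← hv]
    ext v
    simp only [Finset.mem_union, Finset.mem_insert, Finset.notMem_empty, or_false,
      Finset.mem_singleton] at hy ⊢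
    constructor
    · tauto
    · rintro ((rfl | rfl | rfl) | h | rfl) <;> tauto
  · rw [Finset.card_insert_of_notMem heI, Finset.card_insert_of_notMem htR]
    have := h.euler
    simp only [Finset.card_empty] at this ⊢
    omega
  · obtain ⟨a, ha, hb⟩ := h.bdry
    have key : ∀ p q, MinimalCycles.bdry (restrict (insert {x, y, z} R) c) p q =
        a * (net u p q + net [(x, y)] p q) +
          c x z y * (net [(x, z), (z, y)] p q - net [(x, y)] p q) := by
      intro p q
      rw [bdry_restrict_insert htR, hb, ht', bdry_restrict_singleton hF.alt hxz hxy hyz.symm,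
        net_append, show [(x, z), (z, y), (y, x)] = [(x, z), (z, y)] ++ [(y, x)] from rfl, net_append,
        net_singleton_swap]
      ring
    -- Both triangles at xy now belong to the region, so the boundary vanishes there. This forces
    -- the coefficient of the new triangle to equal `a`.
    have hz : MinimalCycles.bdry (restrict (insert {x, y, z} R) c) x y = 0 := by
      refine hF.bdry_restrict_eq_zero x y (Or.inl fun t ht hx hy => ?_)
      exact mem_of_edgeDeg_eq hsub (by rw [htop, h2]) ht (incident_mk.2 ⟨hx, hy⟩)
    have hnu : net u x y = 0 := by
      have := edgeCount_eq (w := u) hxy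
      rw [hcu] at this
      simp only [net]
      rw [show u.count (x, y) = 0 by omega, show u.count (y, x) = 0 by omega]
      simp
    rw [key, hnu] at hz
    have n1 : net [(x, y)] x y = 1 := by simp [net, hxy]
    have n2 : net [(x, z), (z, y)] x y = 0 := by simp [net, hxy, hxz, hxz.symm, hyz.symm]
    rw [n1, n2] at hz
    have hac : c x z y = a := by linarith
    refine ⟨a, ha, fun p q => ?_⟩
    rw [key, hac, net_append]
    ring

/-- The boundary enters q along pq and returns at once, and q does not occur elsewhere. Folding
makes the edge and the vertex q inner, one of each, so the Euler count persists; the two letters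
cancel in the 1-chain of the word. -/
theorem IsRegion.fold {w : List (V × V)} {p q : V}
    (h : IsRegion F c R (w ++ [(p, q), (q, p)]) I J) (hw : w ≠ []) (hq : q ∉ wordVerts w)
    (h2 : edgeDeg F s(p, q) = 2) : IsRegion F c R w (insert s(p, q) I) (insert q J) := by
  have hpq : p ≠ q := h.nondiag (p, q) (by simp)
  have hdi : ¬ (s(p, q)).IsDiag := by simpa using hpq
  have hwd : ∀ d ∈ w, d.1 ≠ d.2 := fun d hd => h.nondiag d (by simp [hd])
  have hwalk : IsWalk p w p := by
    obtain ⟨r, hr⟩ := h.walk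
    obtain ⟨r', h3, h4, h5, h6⟩ := isWalk_append.1 hr
    change p = r at h6
    change p = r' at h4
    rw [← h6, ← h4] at h3
    exact h3
  have hclosed : IsClosedWalk w := ⟨p, hwalk⟩
  have hq1 : ∀ d ∈ w, d.1 ≠ q := fun d hd e => hq (mem_wordVerts.2 ⟨d, hd, e⟩)
  have hq2 : ∀ d ∈ w, d.2 ≠ q := fun d hd e => hq (e ▸ hclosed.snd_mem hd)
  have hc0 : edgeCount w s(p, q) = 0 := by
    refine edgeCount_eq_zero.2 fun d hd e => ?_
    have : q ∈ dartEdge d := by rw [e]; simp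
    rcases Sym2.mem_iff.1 this with e | e
    · exact hq1 d hd e.symm
    · exact hq2 d hd e.symm
  have hcp : ∀ e, edgeCount [(p, q), (q, p)] e = if s(p, q) = e then 2 else 0 := by
    intro e
    rw [show [(p, q), (q, p)] = [(p, q)] ++ [(q, p)] from rfl, edgeCount_append, edgeCount_singleton,
      edgeCount_singleton]
    rw [show dartEdge (q, p) = s(p, q) from Sym2.eq_swap, show dartEdge (p, q) = s(p, q) from rfl]
    split_ifs <;> rfl
  have hce := h.count _ hdi
  rw [edgeCount_append, hc0, hcp, if_pos rfl] at hce
  have heI : s(p, q) ∉ I := fun hI => by rw [if_pos hI] at hce; omega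
  rw [if_neg heI] at hce
  have hqJ : q ∉ J := fun hJ => h.disj q hJ (mem_wordVerts.2 ⟨(q, p), by simp, rfl⟩)
  refine ⟨h.subset, hw, hclosed, hwd, ?_, ?_, ?_, ?_, ?_, ?_, ?_⟩
  · have hm := BoundsCell.fold h.cell hw (fun t _ => seg_swap p q t) (seg_injective hpq).injOn ?_
    · rw [seg_image_Ioc hpq, ← openSimplices_union] at hm
      convert hm using 2
      ext s
      simp only [cellFaces, mem_union, mem_ofPred_eq, Finset.mem_insert, mem_singleton_iff,
        mem_insert_iff, or_and_right, exists_or, exists_eq_left, toFinset_mk]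
      generalize (∃ x ∈ I, s = x.toFinset) = A
      generalize (∃ x ∈ J, s = {x}) = B
      tauto
    · intro t ht d hd t' ht' e
      -- The barycentric coordinate of q is t > 0 on the folded segment and zero on every letter of
      -- `w`.
      have := congrFun e q
      simp [seg, (hq1 d hd).symm, (hq2 d hd).symm, hpq.symm] at this
      exact ht.1.ne this
  · intro e he
    have := h.count e he
    rw [edgeCount_append, hcp] at this
    by_cases h3 : e = s(p, q)
    · subst h3; simp [hc0]
    · rw [if_neg (Ne.symm h3)] at this
      simp only [Finset.mem_insert, h3, false_or]
      exact this
  · intro e he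
    rcases Finset.mem_insert.1 he with rfl | he
    · exact ⟨hdi, h2, by omega⟩
    · exact h.inner e he
  · intro v hv
    rcases Finset.mem_insert.1 hv with rfl | hv
    · exact hq
    · have := h.disj v hv
      rw [wordVerts_append] at this
      exact fun h3 => this (Finset.mem_union_left _ h3)
  · rw [← h.verts]
    have hp : p ∈ wordVerts w := by
      cases w with
      | nil => exact absurd rfl hw
      | cons d w => exact mem_wordVerts.2 ⟨d, by simp, hwalk.1⟩
    ext v
    simp only [wordVerts_append, wordVerts_cons, wordVerts_nil, Finset.mem_union, Finset.mem_insert,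
      Finset.notMem_empty, or_false]
    constructor
    · tauto
    · rintro ((h | rfl | rfl) | h) <;> tauto
  · rw [Finset.card_insert_of_notMem heI, Finset.card_insert_of_notMem hqJ]
    have := h.euler
    omega
  · obtain ⟨a, ha, hb⟩ := h.bdry
    refine ⟨a, ha, fun x y => ?_⟩
    rw [hb, net_append, show [(p, q), (q, p)] = [(p, q)] ++ [(q, p)] from rfl, net_append,
      net_singleton_swap]
    ring

end Moves

/-! ### Maximal regions and reduced boundary words -/

section Growth

set_option linter.unusedSectionVars false

variable {V : Type*} [Fintype V] [DecidableEq V]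
variable {F R : Finset (Finset V)} {c : V → V → V → ℚ} {I : Finset (Sym2 V)} {J : Finset V}

theorem IsRegion.of_isRotated {w w' : List (V × V)} (h : IsRegion F c R w I J) (hr : w ~r w') :
    IsRegion F c R w' I J := by
  obtain ⟨n, hn, rfl⟩ := List.isRotated_iff_mod.1 hr
  rw [List.rotate_eq_drop_append_take hn]
  refine IsRegion.rotate ?_
  rwa [List.take_append_drop]

theorem IsClosedWalk.of_isRotated {w w' : List (V × V)} (h : IsClosedWalk w) (hr : w ~r w') :
    IsClosedWalk w' := by
  obtain ⟨n, hn, rfl⟩ := List.isRotated_iff_mod.1 hr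
  rw [List.rotate_eq_drop_append_take hn]
  refine IsClosedWalk.rotate ?_
  rwa [List.take_append_drop]

theorem isRotated_append_comm (u v : List (V × V)) : (u ++ v) ~r (v ++ u) :=
  ⟨u.length, List.rotate_append_length_eq u v⟩

theorem isRotated_of_mem {w : List (V × V)} {d : V × V} (hd : d ∈ w) :
    ∃ u, w ~r (u ++ [d]) := by
  obtain ⟨a, b, rfl⟩ := List.append_of_mem hd
  refine ⟨b ++ a, ?_⟩
  have := isRotated_append_comm (a ++ [d]) b
  simpa using this

theorem IsRegion.mem_inner_or_mem_wordEdges {w : List (V × V)} (h : IsRegion F c R w I J)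
    {e : Sym2 V} (he : ¬ e.IsDiag) (hR : 0 < edgeDeg R e) : e ∈ I ∨ e ∈ wordEdges w := by
  by_cases hI : e ∈ I
  · exact Or.inl hI
  · have := h.count e he
    rw [if_neg hI] at this
    exact Or.inr (edgeCount_pos.1 (by omega))

theorem IsRegion.not_isDiag {w : List (V × V)} (h : IsRegion F c R w I J) {e : Sym2 V}
    (he : e ∈ wordEdges w) : ¬ e.IsDiag := by
  obtain ⟨d, hd, rfl⟩ := mem_wordEdges.1 he
  simpa [dartEdge] using h.nondiag d hd

theorem IsRegion.notMem_inner {w : List (V × V)} (h : IsRegion F c R w I J) {e : Sym2 V}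
    (he : e ∈ wordEdges w) : e ∉ I := by
  intro hI
  have := h.count e (h.not_isDiag he)
  rw [if_pos hI] at this
  have := edgeCount_pos.2 he
  omega

theorem IsRegion.edgeCount_eq_edgeDeg {w : List (V × V)} (h : IsRegion F c R w I J) {e : Sym2 V}
    (he : e ∈ wordEdges w) : edgeCount w e = edgeDeg R e := by
  rw [h.count e (h.not_isDiag he), if_neg (h.notMem_inner he)]

/-- `R` contains both or none of the triangles at an edge of degree two. -/
def IsSaturated (F R : Finset (Finset V)) : Prop :=
  ∀ e : Sym2 V, ¬ e.IsDiag → edgeDeg F e = 2 → 0 < edgeDeg R e → edgeDeg R e = 2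

/-- A saturated set of triangles contains a saturated region. -/
theorem IsFundamentalCycle.exists_isRegion (hF : IsFundamentalCycle F c) {F' : Finset (Finset V)}
    (hF' : F' ⊆ F) (hne : F'.Nonempty) (hsat : IsSaturated F F') :
    ∃ R ⊆ F', R.Nonempty ∧ IsSaturated F R ∧ ∃ w I, IsRegion F c R w I ∅ := by
  classical
  set 𝒜 := F'.powerset.filter fun R => R.Nonempty ∧ ∃ w I, IsRegion F c R w I ∅ with h𝒜
  have hA : 𝒜.Nonempty := by
    obtain ⟨t, ht⟩ := hne
    obtain ⟨x, y, z, -, -, -, rfl⟩ := hF.exists_triple (hF' ht)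
    refine ⟨{{x, y, z}}, ?_⟩
    simp only [h𝒜, Finset.mem_filter, Finset.mem_powerset, Finset.singleton_subset_iff]
    exact ⟨ht, Finset.singleton_nonempty _, _, _, hF.isRegion_triangle (hF' ht)⟩
  -- A region inside `F'` with the largest number of triangles is saturated: otherwise a triangle
  -- could be attached.
  obtain ⟨R, hR, hmax⟩ := Finset.exists_max_image 𝒜 Finset.card hA
  simp only [h𝒜, Finset.mem_filter, Finset.mem_powerset] at hR
  obtain ⟨hRF, hRne, w, I, hreg⟩ := hR
  refine ⟨R, hRF, hRne, ?_, w, I, hreg⟩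
  intro e he h2 hpos
  have hle := edgeDeg_mono hreg.subset e
  by_contra hn
  have h1 : edgeDeg R e = 1 := by omega
  have hI : e ∉ I := fun hI => hn (hreg.inner e hI).2.2
  obtain ⟨⟨x, y⟩, hd, rfl⟩ := mem_wordEdges.1
    ((hreg.mem_inner_or_mem_wordEdges he hpos).resolve_left hI)
  obtain ⟨u, hu⟩ := isRotated_of_mem hd
  obtain ⟨t, htF, htR, hti, w', I', hreg'⟩ := (hreg.of_isRotated hu).attach hF h2 h1
  have h2' : edgeDeg F' (dartEdge (x, y)) = 2 :=
    hsat _ he h2 (hpos.trans_le (edgeDeg_mono hRF _))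
  -- Saturation of `F'` keeps the attached triangle inside `F'`, against maximality.
  have htF' : t ∈ F' := mem_of_edgeDeg_eq hF' (h2.trans h2'.symm).le htF hti
  have := hmax (insert t R) (by
    simp only [h𝒜, Finset.mem_filter, Finset.mem_powerset]
    exact ⟨Finset.insert_subset htF' hRF, Finset.insert_nonempty _ _, w', I', hreg'⟩)
  rw [Finset.card_insert_of_notMem htR] at this
  omega

/-- At a leaf q of the walked graph the walk must leave by the edge on which it came. That already
makes two passages, so q is visited only once. -/
theorem IsClosedWalk.exists_isRotated_of_leaf {w : List (V × V)} (hw : IsClosedWalk w)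
    (hd : ∀ d ∈ w, d.1 ≠ d.2) {q : V} (hq : q ∈ wordVerts w) {e : Sym2 V}
    (he : ∀ d ∈ w, q ∈ dartEdge d → dartEdge d = e) (h2 : edgeCount w e = 2) :
    ∃ w' p, w ~r (w' ++ [(p, q), (q, p)]) ∧ e = s(p, q) ∧ q ∉ wordVerts w' := by
  obtain ⟨⟨q', p⟩, hdw, rfl⟩ := mem_wordVerts.1 hq
  obtain ⟨u, hu⟩ := isRotated_of_mem hdw
  have hwu := hw.of_isRotated hu
  have hmem : ∀ d, d ∈ u ++ [(q', p)] ↔ d ∈ w := fun d => hu.mem_iff.symm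
  rcases List.eq_nil_or_concat u with rfl | ⟨w', ⟨a, b⟩, rfl⟩
  · exact absurd hwu (not_isClosedWalk_singleton (hd _ hdw))
  rw [List.concat_eq_append, List.append_assoc] at hu hwu hmem
  have hb : b = q' := by
    obtain ⟨r, hr⟩ := hwu
    obtain ⟨s, -, -, h4, -⟩ := isWalk_append.1 hr
    exact h4.symm
  subst hb
  have hep : e = s(p, b) := by
    rw [← he _ hdw (by simp [dartEdge])]
    exact Sym2.eq_swap
  have hea : dartEdge (a, b) = e := he _ ((hmem _).1 (by simp)) (by simp [dartEdge])
  rw [hep] at hea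
  have hab : a ≠ b := hd _ ((hmem (a, b)).1 (by simp))
  have hap : a = p := by simpa [dartEdge, hab] using hea
  subst hap
  refine ⟨w', a, hu, hep, ?_⟩
  intro hq'
  obtain ⟨d, hdw', hdq⟩ := mem_wordVerts.1 hq'
  have h0 : dartEdge d = e := he d ((hmem d).1 (by simp [hdw'])) (by
    rw [← hdq]; simp [dartEdge])
  have h3 : edgeCount (w' ++ [(a, b), (b, a)]) e = 2 := by
    rw [← h2, edgeCount, edgeCount]
    exact ((hu.perm.map dartEdge).count_eq e).symm
  have h4 : 0 < edgeCount w' e := edgeCount_pos.2 (mem_wordEdges.2 ⟨d, hdw', h0⟩)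
  rw [edgeCount_append, show [(a, b), (b, a)] = [(a, b)] ++ [(b, a)] from rfl, edgeCount_append,
    edgeCount_singleton, edgeCount_singleton, if_pos (by rw [hep]; rfl),
    if_pos (by rw [hep]; exact Sym2.eq_swap)] at h3
  omega

/-- No edge of the word can be folded, unless it is the whole word. -/
def IsReduced (F : Finset (Finset V)) (w : List (V × V)) : Prop :=
  (∃ p q, w = [(p, q), (q, p)] ∧ edgeDeg F s(p, q) = 2) ∨
    ∀ q ∈ wordVerts w, 2 ≤ ((wordEdges w).filter (q ∈ ·)).card ∨
      ∃ e ∈ wordEdges w, q ∈ e ∧ edgeDeg F e ≠ 2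

/-- A word that is not reduced has a leaf whose edge has degree two in `F`. By saturation that edge
occurs exactly twice in the word, so it can be folded, which shortens the word. Only a word
consisting of these two letters is left unfolded. -/
theorem IsRegion.exists_isReduced (hsat : IsSaturated F R) {w : List (V × V)}
    (h : IsRegion F c R w I J) : ∃ w' I' J', IsRegion F c R w' I' J' ∧ IsReduced F w' := by
  induction hn : w.length using Nat.strong_induction_on generalizing w I J with
  | _ n ih =>
    by_cases hr : IsReduced F w
    · exact ⟨w, I, J, h, hr⟩
    unfold IsReduced at hr
    push Not at hr
    obtain ⟨-, q, hq, h1, h2⟩ := hr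
    obtain ⟨d, hd, rfl⟩ := mem_wordVerts.1 hq
    have hde : dartEdge d ∈ wordEdges w := mem_wordEdges.2 ⟨d, hd, rfl⟩
    have hdF := h2 _ hde (by simp [dartEdge])
    have hc := h.edgeCount_eq_edgeDeg hde
    rw [hsat _ (h.not_isDiag hde) hdF (by rw [← hc]; exact edgeCount_pos.2 hde)] at hc
    obtain ⟨w', p, hrot, hep, hq'⟩ := h.walk.exists_isRotated_of_leaf h.nondiag hq
      (e := dartEdge d) (fun d' hd' hdd' => by
        have := Finset.card_le_one.1 (Nat.lt_succ_iff.1 h1)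
        exact this _ (Finset.mem_filter.2 ⟨mem_wordEdges.2 ⟨d', hd', rfl⟩, hdd'⟩) _
          (Finset.mem_filter.2 ⟨hde, by simp [dartEdge]⟩)) hc
    rw [hep] at hdF
    have h' := h.of_isRotated hrot
    by_cases hw' : w' = []
    · subst hw'
      exact ⟨_, I, J, h', Or.inl ⟨p, d.1, rfl, hdF⟩⟩
    · refine ih w'.length ?_ (h'.fold hw' hq' hdF) rfl
      have := hrot.perm.length_eq
      simp at this
      omega

theorem mem_edges_iff {e : Sym2 V} : e ∈ edges R ↔ ¬ e.IsDiag ∧ 0 < edgeDeg R e := by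
  rw [edgeDeg_pos]; simp [edges]

/-- The vertices and edges of `R` split into those of the word and the inner ones. So the Euler
count of the open cell says that χ of the closed region is χ of the boundary graph plus one. -/
theorem IsRegion.card_wordVerts {w : List (V × V)} (h : IsRegion F c R w I J) :
    (wordVerts w).card + (edges R).card + 1 =
      (MinimalCycles.verts R).card + (wordEdges w).card + R.card := by
  have h1 : (wordVerts w).card + J.card = (MinimalCycles.verts R).card := by
    rw [← h.verts, Finset.card_union_of_disjoint]
    exact Finset.disjoint_right.2 h.disj
  have h2 : (wordEdges w).card + I.card = (edges R).card := by
    rw [← Finset.card_union_of_disjoint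
      (Finset.disjoint_left.2 fun e he => h.notMem_inner he)]
    congr 1
    ext e
    rw [Finset.mem_union, mem_edges_iff]
    constructor
    · rintro (he | he)
      · refine ⟨h.not_isDiag he, ?_⟩
        rw [← h.edgeCount_eq_edgeDeg he]
        exact edgeCount_pos.2 he
      · have := h.inner e he
        exact ⟨this.1, by omega⟩
    · rintro ⟨h3, h4⟩
      exact (h.mem_inner_or_mem_wordEdges h3 h4).symm
  have := h.euler
  omega

theorem IsRegion.sum_card_filter {w : List (V × V)} (h : IsRegion F c R w I J) :
    ∑ v ∈ wordVerts w, ((wordEdges w).filter (v ∈ ·)).card = 2 * (wordEdges w).card := by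
  have := Finset.sum_card_bipartiteAbove_eq_sum_card_bipartiteBelow (s := wordVerts w)
    (t := wordEdges w) (fun v e => v ∈ e)
  unfold Finset.bipartiteAbove Finset.bipartiteBelow at this
  rw [this, Finset.sum_const_nat (m := 2), mul_comm]
  intro e he
  obtain ⟨d, hd, rfl⟩ := mem_wordEdges.1 he
  have : (wordVerts w).filter (· ∈ dartEdge d) = {d.1, d.2} := by
    ext v
    simp only [Finset.mem_filter, dartEdge, Sym2.mem_iff, Finset.mem_insert, Finset.mem_singleton]
    refine ⟨fun h => h.2, ?_⟩
    rintro (rfl | rfl)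
    · exact ⟨mem_wordVerts.2 ⟨d, hd, rfl⟩, Or.inl rfl⟩
    · exact ⟨h.walk.snd_mem hd, Or.inr rfl⟩
  rw [this, Finset.card_pair (h.nondiag d hd)]

/-- The closure of a region. -/
theorem IsRegion.union_trail (hF : IsFundamentalCycle F c) {w : List (V × V)}
    (h : IsRegion F c R w I J) : openSimplices (cellFaces R I J) ∪ trail seg w =
      openSimplices {s | s.Nonempty ∧ ∃ t ∈ R, s ⊆ t} := by
  rw [trail_seg h.nondiag, ← openSimplices_union]
  congr 1
  have hedge : ∀ x y, x ≠ y → 0 < edgeDeg R s(x, y) → ∃ t ∈ R, ({x, y} : Finset V) ⊆ t := by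
    intro x y hxy he
    obtain ⟨t, ht, hi⟩ := edgeDeg_pos.1 he
    rw [incident_mk] at hi
    exact ⟨t, ht, by simp [Finset.insert_subset_iff, hi.1, hi.2]⟩
  have hvert : ∀ v, (v ∈ wordVerts w ∨ v ∈ J) ↔ ∃ t ∈ R, v ∈ t := by
    intro v
    rw [← mem_verts, ← h.verts, Finset.mem_union]
  ext s
  simp only [mem_union, mem_ofPred_eq]
  constructor
  · rintro ((ht | ⟨e, he, rfl⟩ | ⟨v, hv, rfl⟩) | ⟨d, hd, rfl | rfl | rfl⟩)
    · exact ⟨Finset.card_pos.1 (by rw [hF.card s (h.subset ht)]; omega), s, ht, subset_rfl⟩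
    · obtain ⟨h1, -, h3⟩ := h.inner e he
      induction e with
      | h x y =>
        rw [toFinset_mk]
        exact ⟨by simp, hedge x y (by simpa using h1) (by omega)⟩
    · obtain ⟨t, ht, hvt⟩ := (hvert v).1 (Or.inr hv)
      exact ⟨by simp, t, ht, by simpa using hvt⟩
    · obtain ⟨t, ht, hvt⟩ := (hvert d.1).1 (Or.inl (mem_wordVerts.2 ⟨d, hd, rfl⟩))
      exact ⟨by simp, t, ht, by simpa using hvt⟩
    · obtain ⟨t, ht, hvt⟩ := (hvert d.2).1 (Or.inl (h.walk.snd_mem hd))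
      exact ⟨by simp, t, ht, by simpa using hvt⟩
    · have he : dartEdge d ∈ wordEdges w := mem_wordEdges.2 ⟨d, hd, rfl⟩
      refine ⟨by simp, hedge _ _ (h.nondiag d hd) ?_⟩
      rw [← dartEdge, ← h.edgeCount_eq_edgeDeg he]
      exact edgeCount_pos.2 he
  · rintro ⟨hne, t, ht, hst⟩
    have hcard := hF.card t (h.subset ht)
    have hle := Finset.card_le_card hst
    have hpos := Finset.card_pos.2 hne
    obtain h1 | h2 | h3 : s.card = 1 ∨ s.card = 2 ∨ s.card = 3 := by omega
    · obtain ⟨v, rfl⟩ := Finset.card_eq_one.1 h1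
      rcases (hvert v).2 ⟨t, ht, by simpa using hst⟩ with hv | hv
      · obtain ⟨d, hd, rfl⟩ := mem_wordVerts.1 hv
        exact Or.inr ⟨d, hd, Or.inl rfl⟩
      · exact Or.inl (Or.inr (Or.inr ⟨v, hv, rfl⟩))
    · obtain ⟨x, y, hxy, rfl⟩ := Finset.card_eq_two.1 h2
      rcases h.mem_inner_or_mem_wordEdges (e := s(x, y)) (by simpa using hxy)
        (edgeDeg_pos.2 ⟨t, ht, incident_mk.2 ⟨hst (by simp), hst (by simp)⟩⟩) with he | he
      · exact Or.inl (Or.inr (Or.inl ⟨_, he, (toFinset_mk x y).symm⟩))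
      · obtain ⟨d, hd, e1⟩ := mem_wordEdges.1 he
        refine Or.inr ⟨d, hd, Or.inr (Or.inr ?_)⟩
        rw [← toFinset_dartEdge, e1, toFinset_mk]
    · rw [Finset.eq_of_subset_of_card_le hst (by omega)]
      exact Or.inl (Or.inl ht)

end Growth

/-! ### The degrees of the edges -/

section Degrees

set_option linter.unusedSectionVars false

variable {V : Type*} [Fintype V] [DecidableEq V]
variable {F R : Finset (Finset V)} {c : V → V → V → ℚ}

/-- If only one triangle contained the edge, the boundary of `c` there would be its single nonzero
coefficient. -/
theorem IsFundamentalCycle.two_le_edgeDeg (hF : IsFundamentalCycle F c) {e : Sym2 V}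
    (he : e ∈ edges F) : 2 ≤ edgeDeg F e := by
  induction e with
  | h x y =>
    obtain ⟨hxy, t, ht, hx, hy⟩ := mem_edges.1 he
    obtain ⟨z, hxz, hyz, rfl⟩ := exists_third (hF.card t ht) hx hy hxy
    by_contra! hlt
    have h1 := Finset.card_le_one.1 (Nat.lt_succ_iff.1 hlt)
    have hz : bdry c x y = c z x y := by
      refine Finset.sum_eq_single z (fun w _ hw => ?_) (by simp)
      by_contra h0
      have h2 := h1 _ (Finset.mem_filter.2 ⟨(hF.supp w x y).1 h0, incident_mk.2 (by simp)⟩)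
        _ (Finset.mem_filter.2 ⟨ht, incident_mk.2 (by simp)⟩)
      have h3 : z ∈ ({w, x, y} : Finset V) := by rw [h2]; simp
      simp [hw.symm, hxz.symm, hyz.symm] at h3
    rw [hF.cycle] at hz
    refine (hF.supp z x y).2 ?_ hz.symm
    convert ht using 1
    ext; simp; tauto

theorem IsFundamentalCycle.bdry_restrict_of_isSaturated (hF : IsFundamentalCycle F c) (hR : R ⊆ F)
    (hsat : IsSaturated F R) {x y : V} (hxy : x ≠ y)
    (h : s(x, y) ∈ edges F → edgeDeg F s(x, y) = 2) : bdry (restrict R c) x y = 0 := by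
  have hdi : ¬ (s(x, y)).IsDiag := by simpa using hxy
  refine hF.bdry_restrict_eq_zero x y ?_
  rcases Nat.eq_zero_or_pos (edgeDeg R s(x, y)) with h0 | h0
  · refine Or.inr fun t _ hx hy htR => ?_
    have := edgeDeg_pos.2 ⟨t, htR, incident_mk.2 ⟨hx, hy⟩⟩
    omega
  · have h2 := h (mem_edges_iff.2 ⟨hdi, h0.trans_le (edgeDeg_mono hR _)⟩)
    have h3 := hsat _ hdi h2 h0
    exact Or.inl fun t ht hx hy => mem_of_edgeDeg_eq hR (by omega) ht (incident_mk.2 ⟨hx, hy⟩)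

theorem IsAlternating.bdry_self {c : V → V → V → ℚ} (hc : IsAlternating c) (x : V) :
    bdry c x x = 0 := by
  have := hc.bdry_swap x x
  linarith

theorem sum_edgeDeg (hF : ∀ t ∈ F, t.card = 3) : ∑ e ∈ edges F, edgeDeg F e = 3 * F.card := by
  have := Finset.sum_card_bipartiteAbove_eq_sum_card_bipartiteBelow (s := edges F)
    (t := F) (fun e t => Incident e t)
  unfold Finset.bipartiteAbove Finset.bipartiteBelow at this
  unfold edgeDeg
  rw [this, Finset.sum_const_nat (m := 3), mul_comm]
  intro t ht
  obtain ⟨x, y, z, hxy, hxz, hyz, rfl⟩ := Finset.card_eq_three.1 (hF t ht)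
  have : (edges F).filter (fun e => Incident e {x, y, z}) = {s(x, y), s(y, z), s(z, x)} := by
    ext e
    simp only [Finset.mem_filter, Finset.mem_insert, Finset.mem_singleton]
    refine ⟨fun h => incident_triple (mem_edges_iff.1 h.1).1 h.2, ?_⟩
    rintro (rfl | rfl | rfl)
    · exact ⟨mem_edges.2 ⟨hxy, _, ht, by simp, by simp⟩, incident_mk.2 (by simp)⟩
    · exact ⟨mem_edges.2 ⟨hyz, _, ht, by simp, by simp⟩, incident_mk.2 (by simp)⟩
    · exact ⟨mem_edges.2 ⟨hxz.symm, _, ht, by simp, by simp⟩, incident_mk.2 (by simp)⟩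
  rw [this, Finset.card_eq_three]
  exact ⟨_, _, _, by simp [hxy, hxz], by simp [hyz, hxz], by simp [hyz, hxz.symm, hxy.symm], rfl⟩

/-- Each triangle at `v` has two edges at `v`. This is the handshake lemma in the link of `v`. -/
theorem sum_edgeDeg_filter (hF : ∀ t ∈ F, t.card = 3) (v : V) :
    ∑ e ∈ (edges F).filter (v ∈ ·), edgeDeg F e = 2 * (F.filter (v ∈ ·)).card := by
  have h1 : ∀ e ∈ (edges F).filter (v ∈ ·),
      edgeDeg F e = ((F.filter (v ∈ ·)).filter (Incident e)).card := by
    intro e he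
    unfold edgeDeg
    congr 1
    ext t
    simp only [Finset.mem_filter] at he ⊢
    exact ⟨fun h => ⟨⟨h.1, h.2 v he.2⟩, h.2⟩, fun h => ⟨h.1.1, h.2⟩⟩
  have := Finset.sum_card_bipartiteAbove_eq_sum_card_bipartiteBelow (s := (edges F).filter (v ∈ ·))
    (t := F.filter (v ∈ ·)) (fun e t => Incident e t)
  unfold Finset.bipartiteAbove Finset.bipartiteBelow at this
  rw [Finset.sum_congr rfl h1, this, Finset.sum_const_nat (m := 2), mul_comm]
  intro t ht
  obtain ⟨ht, hv⟩ := Finset.mem_filter.1 ht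
  obtain ⟨y, hyt, hy⟩ := Finset.exists_mem_ne (by rw [hF t ht]; omega) v
  obtain ⟨z, hvz, hyz, rfl⟩ := exists_third (hF t ht) hv hyt hy.symm
  have : ((edges F).filter (v ∈ ·)).filter (fun e => Incident e {v, y, z}) =
      {s(v, y), s(v, z)} := by
    ext e
    simp only [Finset.mem_filter, Finset.mem_insert, Finset.mem_singleton]
    constructor
    · rintro ⟨⟨he, hve⟩, hi⟩
      rcases incident_triple (mem_edges_iff.1 he).1 hi with rfl | rfl | rfl
      · exact Or.inl rfl
      · simp [hy.symm, hvz] at hve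
      · exact Or.inr Sym2.eq_swap
    · rintro (rfl | rfl)
      · exact ⟨⟨mem_edges.2 ⟨hy.symm, _, ht, by simp, by simp⟩, by simp⟩, incident_mk.2 (by simp)⟩
      · exact ⟨⟨mem_edges.2 ⟨hvz, _, ht, by simp, by simp⟩, by simp⟩, incident_mk.2 (by simp)⟩
  rw [this, Finset.card_pair (by simp [hyz, hvz])]

/-- The degrees of the edges at a vertex have an even sum, so an odd edge is never the only one at
its end. -/
theorem exists_odd_edgeDeg (hF : ∀ t ∈ F, t.card = 3) {e : Sym2 V} (he : e ∈ edges F)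
    (ho : Odd (edgeDeg F e)) {v : V} (hv : v ∈ e) :
    ∃ e' ∈ edges F, e' ≠ e ∧ v ∈ e' ∧ Odd (edgeDeg F e') := by
  have h1 : ¬ Odd (∑ e ∈ (edges F).filter (v ∈ ·), edgeDeg F e) := by
    rw [sum_edgeDeg_filter hF, Nat.not_odd_iff_even]
    exact even_two_mul _
  rw [Finset.odd_sum_iff_odd_card_odd, Nat.not_odd_iff_even] at h1
  set S := ((edges F).filter (v ∈ ·)).filter fun e => Odd (edgeDeg F e) with hS
  have heS : e ∈ S := by simp [hS, he, ho, hv]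
  have h2 : 1 < S.card := by
    have := Finset.card_pos.2 ⟨e, heS⟩
    obtain ⟨k, hk⟩ := h1
    omega
  obtain ⟨e', he', hne⟩ := Finset.exists_mem_ne h2 e
  simp only [hS, Finset.mem_filter] at he'
  exact ⟨e', he'.1.1, hne, he'.1.2, he'.2⟩

/-- The total excess over degree two is 3f − 2e, at most three by the hypotheses. An odd edge
continues at both ends to other odd edges, so odd edges need a closed circuit, hence at least three
edges; otherwise all degrees are even and at most one is not two. For total excess x, substituting f
≤ 2v − 1 into 2e = 3f − x gives the lower bound on v − e + f by rounding. -/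
theorem IsFundamentalCycle.edgeDeg_cases (hF : IsFundamentalCycle F c)
    (h1 : (verts F).card + F.card ≤ (edges F).card + 2) (h2 : F.card < 2 * (verts F).card) :
    ((∀ e ∈ edges F, edgeDeg F e = 2) ∧ (edges F).card + 1 ≤ (verts F).card + F.card) ∨
    (∃ e₀ ∈ edges F, edgeDeg F e₀ = 4 ∧ (∀ e ∈ edges F, e ≠ e₀ → edgeDeg F e = 2) ∧
      (edges F).card + 2 ≤ (verts F).card + F.card) ∨
    (∃ p q r, p ≠ q ∧ q ≠ r ∧ r ≠ p ∧ edgeDeg F s(p, q) = 3 ∧ edgeDeg F s(q, r) = 3 ∧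
      edgeDeg F s(r, p) = 3 ∧
      (∀ e ∈ edges F, e ≠ s(p, q) → e ≠ s(q, r) → e ≠ s(r, p) → edgeDeg F e = 2) ∧
      (edges F).card + 2 ≤ (verts F).card + F.card) := by
  set ex : Sym2 V → ℕ := fun e => edgeDeg F e - 2 with hex
  have hdeg : ∀ e ∈ edges F, edgeDeg F e = ex e + 2 := fun e he => by
    have := hF.two_le_edgeDeg he
    simp only [hex]; omega
  have hsum : ∑ e ∈ edges F, ex e + 2 * (edges F).card = 3 * F.card := by
    rw [← sum_edgeDeg hF.card, Finset.sum_congr rfl hdeg, Finset.sum_add_distrib, Finset.sum_const,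
      smul_eq_mul, mul_comm 2]
  have hsub : ∀ S ⊆ edges F, ∑ e ∈ S, ex e ≤ ∑ e ∈ edges F, ex e := fun S hS =>
    Finset.sum_le_sum_of_subset hS
  by_cases hodd : ∃ e ∈ edges F, Odd (edgeDeg F e)
  · right; right
    obtain ⟨e₀, he₀, ho₀⟩ := hodd
    induction e₀ with
    | h p q =>
    obtain ⟨e₁, he₁, hn₁, hp₁, ho₁⟩ := exists_odd_edgeDeg hF.card he₀ ho₀ (v := p) (by simp)
    obtain ⟨r, rfl⟩ := Sym2.mem_iff_exists.1 hp₁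
    obtain ⟨e₂, he₂, hn₂, hq₂, ho₂⟩ := exists_odd_edgeDeg hF.card he₀ ho₀ (v := q) (by simp)
    obtain ⟨s, rfl⟩ := Sym2.mem_iff_exists.1 hq₂
    obtain ⟨e₃, he₃, hn₃, hr₃, ho₃⟩ := exists_odd_edgeDeg hF.card he₁ ho₁ (v := r) (by simp)
    have hpq : p ≠ q := (mem_edges.1 he₀).1
    have hpr : p ≠ r := (mem_edges.1 he₁).1
    have hqs : q ≠ s := (mem_edges.1 he₂).1
    have hrq : r ≠ q := by rintro rfl; exact hn₁ rfl
    have hsp : s ≠ p := by rintro rfl; exact hn₂ Sym2.eq_swap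
    have n12 : s(p, r) ≠ s(q, s) := by simp [hpq, hsp.symm]
    have pos : ∀ e ∈ edges F, Odd (edgeDeg F e) → 1 ≤ ex e := by
      rintro e he ⟨k, hk⟩
      have := hdeg e he
      omega
    have p0 := pos _ he₀ ho₀
    have p1 := pos _ he₁ ho₁
    have p2 := pos _ he₂ ho₂
    -- Three odd edges use up the whole excess.
    have hall : ∀ e ∈ edges F, e ≠ s(p, q) → e ≠ s(p, r) → e ≠ s(q, s) → ex e = 0 := by
      intro e he m0 m1 m2
      have := hsub {e, s(p, q), s(p, r), s(q, s)} (by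
        simp [Finset.insert_subset_iff, he, he₀, he₁, he₂])
      rw [Finset.sum_insert (by simp [m0, m1, m2]), Finset.sum_insert (by
        simp only [Finset.mem_insert, Finset.mem_singleton, not_or]; exact ⟨hn₁.symm, hn₂.symm⟩),
        Finset.sum_pair n12] at this
      omega
    have hthree := hsub {s(p, q), s(p, r), s(q, s)} (by
        simp [Finset.insert_subset_iff, he₀, he₁, he₂])
    rw [Finset.sum_insert (by
        simp only [Finset.mem_insert, Finset.mem_singleton, not_or]; exact ⟨hn₁.symm, hn₂.symm⟩),
        Finset.sum_pair n12] at hthree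
    -- If the path s, q, p, r did not close up, its end r would carry a fourth odd edge.
    have hsr : s = r := by
      by_contra hsr
      have := pos _ he₃ ho₃
      have h0 := hall e₃ he₃ (by rintro rfl; simp [hpr.symm, hrq] at hr₃) hn₃
        (by rintro rfl; simp [hrq, Ne.symm hsr] at hr₃)
      omega
    subst hsr
    have d0 := hdeg _ he₀
    have d1 := hdeg _ he₁
    have d2 := hdeg _ he₂
    refine ⟨p, q, s, hpq, hqs, hpr.symm, by omega, by omega, ?_, ?_, by omega⟩
    · rw [Sym2.eq_swap]; omega
    · intro e he m0 m1 m2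
      have := hall e he m0 (by rw [Sym2.eq_swap]; exact m2) m1
      rw [hdeg e he, this]
  · push Not at hodd
    by_cases hall : ∀ e ∈ edges F, edgeDeg F e = 2
    · left
      refine ⟨hall, ?_⟩
      have : ∑ e ∈ edges F, ex e = 0 := Finset.sum_eq_zero fun e he => by simp [hex, hall e he]
      omega
    · right; left
      push Not at hall
      obtain ⟨e₀, he₀, hn₀⟩ := hall
      -- A singular edge of even degree has excess at least two, and two of them would exceed three.
      have pos : ∀ e ∈ edges F, edgeDeg F e ≠ 2 → 2 ≤ ex e := by
        intro e he hn
        have := hdeg e he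
        have h3 := hodd e he
        obtain ⟨k, hk⟩ := Nat.not_odd_iff_even.1 h3
        omega
      have p0 := pos e₀ he₀ hn₀
      have hall : ∀ e ∈ edges F, e ≠ e₀ → edgeDeg F e = 2 := by
        intro e he hne
        by_contra hn
        have p1 := pos e he hn
        have := hsub {e, e₀} (by simp [Finset.insert_subset_iff, he, he₀])
        rw [Finset.sum_pair hne] at this
        omega
      have hs : ∑ e ∈ edges F, ex e = ex e₀ := by
        refine Finset.sum_eq_single e₀ (fun e he hne => ?_) (fun h => absurd he₀ h)
        simp [hex, hall e he hne]
      have d0 := hdeg _ he₀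
      obtain ⟨k, hk⟩ := Nat.not_odd_iff_even.1 (hodd e₀ he₀)
      exact ⟨e₀, he₀, by omega, hall, by omega⟩

end Degrees

/-! ### Words of doubled cycles -/

section Words

set_option linter.unusedSectionVars false

variable {V : Type*} [Fintype V] [DecidableEq V]

theorem IsWalk.fst_mem {w : List (V × V)} {p q : V} (h : IsWalk p w q) {T : Set V} (hp : p ∈ T)
    (hT : ∀ d ∈ w, d.1 ∈ T → d.2 ∈ T) : ∀ d ∈ w, d.1 ∈ T := by
  induction w generalizing p with
  | nil => simp
  | cons a w ih =>
    obtain ⟨rfl, h2⟩ := h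
    intro d hd
    rcases List.mem_cons.1 hd with rfl | hd
    · exact hp
    · exact ih h2 (hT a (by simp) hp) (fun d hd => hT d (by simp [hd])) d hd

theorem IsClosedWalk.fst_mem {w : List (V × V)} (h : IsClosedWalk w) {T : Set V} {d₀ : V × V}
    (hd₀ : d₀ ∈ w) (h₀ : d₀.2 ∈ T) (hT : ∀ d ∈ w, d.1 ∈ T → d.2 ∈ T) : ∀ d ∈ w, d.1 ∈ T := by
  obtain ⟨u, hu⟩ := isRotated_of_mem hd₀
  obtain ⟨p, hp⟩ := h.of_isRotated hu
  obtain ⟨r, -, -, h2⟩ := isWalk_append.1 hp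
  change d₀.2 = p at h2
  intro d hd
  exact hp.fst_mem (h2 ▸ h₀) (fun d hd => hT d (hu.mem_iff.2 hd)) d (hu.mem_iff.1 hd)

theorem IsWalk.snd_getElem {w : List (V × V)} {p q : V} (h : IsWalk p w q) (i : ℕ)
    (hi : i + 1 < w.length) : (w[i]).2 = (w[i + 1]).1 := by
  induction w generalizing p i with
  | nil => simp at hi
  | cons a w ih =>
    obtain ⟨-, h2⟩ := h
    cases i with
    | zero =>
      cases w with
      | nil => simp at hi
      | cons b w => exact h2.1.symm
    | succ i => exact ih h2 i (by simpa using hi)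

/-- The reversed walk. -/
def rev (w : List (V × V)) : List (V × V) := (w.map Prod.swap).reverse

theorem rev_append (u v : List (V × V)) : rev (u ++ v) = rev v ++ rev u := by simp [rev]

theorem rev_rev (u : List (V × V)) : rev (rev u) = u := by simp [rev]

theorem mem_rev {u : List (V × V)} {d : V × V} : d ∈ rev u ↔ d.swap ∈ u := by
  simp [rev, Prod.swap_eq_iff_eq_swap]

theorem dartEdge_swap (d : V × V) : dartEdge d.swap = dartEdge d := Sym2.eq_swap

theorem dartEdge_eq_iff {d d' : V × V} : dartEdge d = dartEdge d' ↔ d = d' ∨ d = d'.swap := by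
  obtain ⟨a, b⟩ := d
  obtain ⟨a', b'⟩ := d'
  simp [dartEdge]

/-- Between the letters ab and ba the walk is closed at b, and b has only one neighbour x besides a.
So this part leaves to x first and returns from x last; the part between is of the same kind, with
bx in place of ab. -/
theorem exists_eq_append_rev {w : List (V × V)} (hw : IsClosedWalk w) (hd : ∀ d ∈ w, d.1 ≠ d.2)
    (hnd : w.Nodup) (hrev : ∀ x y, (x, y) ∈ w → (y, x) ∈ w)
    (htwo : ∀ b a x y, (b, a) ∈ w → (b, x) ∈ w → (b, y) ∈ w → x ≠ a → y ≠ a → x = y)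
    {w₁ w₂ : List (V × V)} {a b : V} (h : w ~r ((a, b) :: (w₁ ++ (b, a) :: w₂))) :
    ∃ v, w₁ = v ++ rev v := by
  induction hn : w₁.length using Nat.strong_induction_on generalizing w₁ w₂ a b with
  | _ n ih =>
    have hnd' := h.nodup_iff.1 hnd
    have hmem : ∀ d, d ∈ (a, b) :: (w₁ ++ (b, a) :: w₂) → d ∈ w := fun d => h.mem_iff.2
    have hwalk : IsWalk b w₁ b := by
      obtain ⟨p, -, hp⟩ := hw.of_isRotated h
      obtain ⟨r, h1, h2, -⟩ := isWalk_append.1 hp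
      change b = r at h2
      rwa [← h2] at h1
    rcases w₁ with - | ⟨⟨b', x⟩, t⟩
    · exact ⟨[], rfl⟩
    obtain ⟨h1, h2⟩ := hwalk
    change b' = b at h1
    subst h1
    rcases List.eq_nil_or_concat t with rfl | ⟨w', ⟨y, z⟩, rfl⟩
    · exact absurd (Eq.symm h2) (hd (b', x) (hmem _ (by simp)))
    rw [List.concat_eq_append] at *
    obtain ⟨r, -, -, h3⟩ := isWalk_append.1 h2
    change z = b' at h3
    subst h3
    -- Moving to a, or coming from a, would repeat one of the letters ba and ab.
    have hxa : x ≠ a := by rintro rfl; simp at hnd'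
    have hya : y ≠ a := by rintro rfl; simp at hnd'
    have hxy : x = y := htwo z a x y (hmem _ (by simp)) (hmem _ (by simp))
      (hrev _ _ (hmem _ (by simp))) hxa hya
    subst hxy
    obtain ⟨v, rfl⟩ := ih w'.length (by simp at hn; omega) (w₁ := w')
      (w₂ := (z, a) :: w₂ ++ [(a, z)]) (a := z) (b := x) (by
        refine h.trans ?_
        have := isRotated_append_comm [(a, z)]
          (((z, x) :: (w' ++ [(x, z)])) ++ (z, a) :: w₂)
        simpa using this) rfl
    exact ⟨(z, x) :: v, by simp [rev]⟩

/-- The letters ab and ba cut the cyclic word into two pieces of the forms v v⁻¹ and v' v'⁻¹.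
Starting in the middle of the second piece, the word reads u u⁻¹ with u = v'⁻¹ (ab) v. -/
theorem exists_isRotated_append_rev {w : List (V × V)} (hw : IsClosedWalk w) (hne : w ≠ [])
    (hd : ∀ d ∈ w, d.1 ≠ d.2) (hnd : w.Nodup) (hrev : ∀ x y, (x, y) ∈ w → (y, x) ∈ w)
    (htwo : ∀ b a x y, (b, a) ∈ w → (b, x) ∈ w → (b, y) ∈ w → x ≠ a → y ≠ a → x = y) :
    ∃ u, u ≠ [] ∧ w ~r (u ++ rev u) := by
  obtain ⟨⟨a, b⟩, t, rfl⟩ := List.exists_cons_of_ne_nil hne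
  have hba : (b, a) ∈ t := by
    rcases List.mem_cons.1 (hrev a b (by simp)) with h | h
    · exact absurd (Prod.ext_iff.1 h).1.symm (hd (a, b) (by simp))
    · exact h
  obtain ⟨w₁, w₂, rfl⟩ := List.append_of_mem hba
  obtain ⟨v, rfl⟩ := exists_eq_append_rev hw hd hnd hrev htwo (List.IsRotated.refl _)
  obtain ⟨v', rfl⟩ := exists_eq_append_rev hw hd hnd hrev htwo (w₁ := w₂)
    (w₂ := v ++ rev v) (a := b) (b := a) (by
      have := isRotated_append_comm ((a, b) :: (v ++ rev v)) ((b, a) :: w₂)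
      simpa using this)
  refine ⟨rev v' ++ (a, b) :: v, by simp, ?_⟩
  have h1 : rev (rev v' ++ (a, b) :: v) = rev v ++ (b, a) :: v' := by
    rw [rev_append, rev_rev]; simp [rev]
  rw [h1]
  have := isRotated_append_comm ((a, b) :: (v ++ rev v ++ (b, a) :: v')) (rev v')
  simpa using this

theorem isSimpleLoop_seg {u : List (V × V)} (hd : ∀ d ∈ u, d.1 ≠ d.2)
    (h1 : ∀ (j k : ℕ) (hj : j < u.length) (hk : k < u.length), (u[j]).1 = (u[k]).1 → j = k)
    (h2 : ∀ (j k : ℕ) (hj : j < u.length) (hk : k < u.length),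
      dartEdge u[j] = dartEdge u[k] → j = k) : IsSimpleLoop seg u := by
  intro j k hj hk s hs t ht e
  have dj := hd u[j] (List.getElem_mem hj)
  have dk := hd u[k] (List.getElem_mem hk)
  have hface := segFace_eq_of_seg_eq dj dk e
  have hjk : j = k := by
    rcases eq_or_lt_of_le hs.1 with hs0 | hs0 <;> rcases eq_or_lt_of_le ht.1 with ht0 | ht0
    · rw [segFace, segFace, if_pos hs0.symm, if_pos ht0.symm, Finset.singleton_inj] at hface
      exact h1 j k hj hk hface
    · rw [segFace, if_pos hs0.symm, segFace_of_mem_Ioo ⟨ht0, ht.2⟩] at hface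
      have := congrArg Finset.card hface
      rw [Finset.card_pair dk] at this
      simp at this
    · rw [segFace_of_mem_Ioo ⟨hs0, hs.2⟩, segFace, if_pos ht0.symm] at hface
      have := congrArg Finset.card hface
      rw [Finset.card_pair dj] at this
      simp at this
    · rw [segFace_of_mem_Ioo ⟨hs0, hs.2⟩, segFace_of_mem_Ioo ⟨ht0, ht.2⟩, ← toFinset_dartEdge,
        ← toFinset_dartEdge] at hface
      exact h2 j k hj hk (toFinset_injective hface)
  subst hjk
  exact ⟨rfl, seg_injective dj e⟩

/-- A walk that meets every vertex in exactly two of its edges, and passes every edge once, is a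
simple closed walk. -/
theorem IsWalk.isSimpleLoop {u : List (V × V)} {p q : V} (hu : IsWalk p u q) (hne : u ≠ [])
    (hd : ∀ d ∈ u, d.1 ≠ d.2)
    (h2 : ∀ (j k : ℕ) (hj : j < u.length) (hk : k < u.length),
      dartEdge u[j] = dartEdge u[k] → j = k)
    (hdeg : ∀ v ∈ wordVerts u, ((wordEdges u).filter (v ∈ ·)).card = 2) :
    IsSimpleLoop seg u ∧ (u.getLast hne).2 = (u.head hne).1 := by
  have hthree : ∀ (v : V), v ∈ wordVerts u → ∀ (i j k : ℕ) (hi : i < u.length) (hj : j < u.length)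
      (hk : k < u.length), v ∈ dartEdge u[i] → v ∈ dartEdge u[j] → v ∈ dartEdge u[k] →
      i ≠ j → i ≠ k → j ≠ k → False := by
    intro v hv i j k hi hj hk vi vj vk hij hik hjk
    have hmem : ∀ (i : ℕ) (hi : i < u.length), v ∈ dartEdge u[i] →
        dartEdge u[i] ∈ (wordEdges u).filter (v ∈ ·) := fun i hi h =>
      Finset.mem_filter.2 ⟨mem_wordEdges.2 ⟨_, List.getElem_mem hi, rfl⟩, h⟩
    have := Finset.two_lt_card.2 ⟨_, hmem i hi vi, _, hmem j hj vj, _, hmem k hk vk,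
      fun h => hij (h2 _ _ hi hj h), fun h => hik (h2 _ _ hi hk h), fun h => hjk (h2 _ _ hj hk h)⟩
    rw [hdeg v hv] at this
    exact lt_irrefl _ this
  have hlt : ∀ (j k : ℕ) (hj : j < u.length) (hk : k < u.length), j < k →
      (u[j]).1 ≠ (u[k]).1 := by
    intro j k hj hk hjk e
    -- If letters j < k start at the same vertex, then the letters j, k − 1 and k give three
    -- different edges there.
    obtain ⟨i, rfl⟩ : ∃ i, k = i + 1 := ⟨k - 1, by omega⟩
    have hstep := hu.snd_getElem i hk
    have hij : i ≠ j := by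
      rintro rfl
      exact hd _ (List.getElem_mem hj) (e.trans hstep.symm)
    refine hthree (u[j]).1 (mem_wordVerts.2 ⟨_, List.getElem_mem hj, rfl⟩) i j (i + 1) (by omega) hj hk
      ?_ (by simp [dartEdge]) ?_ hij (by omega) hjk.ne
    · rw [e, ← hstep]; simp [dartEdge]
    · rw [e]; simp [dartEdge]
  have h1 : ∀ (j k : ℕ) (hj : j < u.length) (hk : k < u.length), (u[j]).1 = (u[k]).1 → j = k := by
    intro j k hj hk e
    rcases lt_trichotomy j k with h | h | h
    · exact absurd e (hlt j k hj hk h)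
    · exact h
    · exact absurd e.symm (hlt k j hk hj h)
  refine ⟨isSimpleLoop_seg hd h1 h2, ?_⟩
  have hpos := List.length_pos_iff.2 hne
  -- The second edge at the initial vertex cannot start there or precede another letter, as initial
  -- vertices are distinct; so it belongs to the last letter and closes the walk.
  have hv : (u[0]).1 ∈ wordVerts u := mem_wordVerts.2 ⟨_, List.getElem_mem hpos, rfl⟩
  obtain ⟨e, he, hne'⟩ := Finset.exists_mem_ne (by rw [hdeg _ hv]; omega :
    1 < ((wordEdges u).filter ((u[0]).1 ∈ ·)).card) (dartEdge u[0])
  obtain ⟨he, hve⟩ := Finset.mem_filter.1 he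
  obtain ⟨d, hdu, rfl⟩ := mem_wordEdges.1 he
  obtain ⟨j, hj, rfl⟩ := List.getElem_of_mem hdu
  have hj0 : j ≠ 0 := by rintro rfl; exact hne' rfl
  rw [List.getLast_eq_getElem, List.head_eq_getElem]
  rcases Sym2.mem_iff.1 hve with h | h
  · exact absurd (h1 0 j hpos hj h) (Ne.symm hj0)
  · by_cases hl : j + 1 < u.length
    · rw [hu.snd_getElem j hl] at h
      exact absurd (h1 0 (j + 1) hpos hl h) (by omega)
    · have : u.length - 1 = j := by omega
      simp only [this]
      exact h.symm

end Words

/-! ### Complexes with at most one singular edge -/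

section Cases

set_option linter.unusedSectionVars false

variable {V : Type*} [Fintype V] [DecidableEq V]
variable {F R : Finset (Finset V)} {c : V → V → V → ℚ} {I : Finset (Sym2 V)} {J : Finset V}

/-- The nonempty faces of the triangles in `F`. -/
def faceClosure (F : Finset (Finset V)) : Set (Finset V) := {s | s.Nonempty ∧ ∃ t ∈ F, s ⊆ t}

theorem trail_seg_subset {w w' : List (V × V)} (h : wordEdges w ⊆ wordEdges w') :
    trail seg w ⊆ trail seg w' := by
  rintro x ⟨d, hd, t, ht, rfl⟩
  obtain ⟨d', hd', e⟩ := mem_wordEdges.1 (h (mem_wordEdges.2 ⟨d, hd, rfl⟩))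
  rcases dartEdge_eq_iff.1 e with rfl | rfl
  · exact ⟨d', hd', t, ht, rfl⟩
  · refine ⟨d.swap, hd', 1 - t, ⟨by linarith [ht.2], by linarith [ht.1]⟩, ?_⟩
    obtain ⟨a, b⟩ := d
    rw [Prod.swap_prod_mk, seg_swap, sub_sub_cancel]

theorem trail_seg_congr {w w' : List (V × V)} (h : wordEdges w = wordEdges w') :
    trail seg w = trail seg w' :=
  (trail_seg_subset h.subset).antisymm (trail_seg_subset h.symm.subset)

theorem forall_eq_of_sum_le {ι : Type*} {s : Finset ι} {f g : ι → ℕ} (h : ∀ i ∈ s, f i ≤ g i)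
    (hs : ∑ i ∈ s, g i ≤ ∑ i ∈ s, f i) : ∀ i ∈ s, g i = f i := fun i hi =>
  (((Finset.sum_eq_sum_iff_of_le h).1 ((Finset.sum_le_sum h).antisymm hs)) i hi).symm

theorem IsFundamentalCycle.restrict_self (hF : IsFundamentalCycle F c) : restrict F c = c := by
  funext x y z
  unfold restrict
  split_ifs with h
  · rfl
  · by_contra h0
    exact h ((hF.supp x y z).1 (Ne.symm h0))

/-- For a region that is everything, the boundary is that of the cycle `c`. So the word passes each
edge equally often in both directions. -/
theorem IsRegion.net_eq_zero (hF : IsFundamentalCycle F c) {w : List (V × V)}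
    (h : IsRegion F c F w I J) (x y : V) : net w x y = 0 := by
  obtain ⟨a, ha, hb⟩ := h.bdry
  have := hb x y
  rw [hF.restrict_self, hF.cycle] at this
  exact (mul_eq_zero.1 this.symm).resolve_left ha

theorem isSaturated_self (F : Finset (Finset V)) : IsSaturated F F := fun _ _ h _ => h

/-- A maximal region is saturated; if saturated sets carry cycles, it is all of `F` by minimality.
-/
theorem IsFundamentalCycle.exists_isRegion_self (hF : IsFundamentalCycle F c)
    (h : ∀ R ⊆ F, IsSaturated F R → ∀ x y, bdry (restrict R c) x y = 0) :
    ∃ w I J, IsRegion F c F w I J ∧ IsReduced F w := by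
  obtain ⟨R, hR, hne, hsat, w, I, hreg⟩ := hF.exists_isRegion subset_rfl hF.nonempty
    (isSaturated_self F)
  obtain rfl := hF.eq_of_bdry_restrict hR hne (h R hR hsat)
  exact hreg.exists_isReduced hsat

theorem wordEdges_append (u v : List (V × V)) : wordEdges (u ++ v) = wordEdges u ∪ wordEdges v := by
  simp [wordEdges]

theorem wordEdges_rev (u : List (V × V)) : wordEdges (rev u) = wordEdges u := by
  ext e
  simp only [mem_wordEdges, mem_rev]
  constructor
  · rintro ⟨d, hd, rfl⟩
    exact ⟨d.swap, hd, dartEdge_swap d⟩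
  · rintro ⟨d, hd, rfl⟩
    exact ⟨d.swap, by simpa using hd, dartEdge_swap d⟩

theorem wordEdges_of_isRotated {w w' : List (V × V)} (h : w ~r w') : wordEdges w = wordEdges w' := by
  ext e; simp only [mem_wordEdges, h.mem_iff]

theorem seg_one (d : V × V) : seg d 1 = Pi.single d.2 1 := by
  funext v; simp [seg, Pi.single_apply]

theorem seg_zero (d : V × V) : seg d 0 = Pi.single d.1 1 := by
  funext v; simp [seg, Pi.single_apply]

/-- Each edge of the word has degree two and net count zero, so it is passed once in each direction.
As each vertex has two boundary edges, the word is u u⁻¹ with u a simple loop. -/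
theorem IsRegion.exists_homeomorph_pointsIdentified (hF : IsFundamentalCycle F c)
    {w : List (V × V)} (h : IsRegion F c F w I J)
    (h2 : ∀ e ∈ wordEdges w, edgeDeg F e = 2)
    (hdeg : ∀ v ∈ wordVerts w, ((wordEdges w).filter (v ∈ ·)).card = 2) :
    ∃ p q : S2, p ≠ q ∧
      Nonempty (↥(openSimplices (faceClosure F)) ≃ₜ SphereWithPointsIdentified p q) := by
  have hcount : ∀ x y, (x, y) ∈ w → w.count (x, y) = 1 ∧ w.count (y, x) = 1 := by
    intro x y hd
    have he : s(x, y) ∈ wordEdges w := mem_wordEdges.2 ⟨_, hd, rfl⟩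
    have h3 := h.edgeCount_eq_edgeDeg he
    rw [h2 _ he, edgeCount_eq (x := x) (y := y) (h.nondiag _ hd)] at h3
    have h4 := h.net_eq_zero hF x y
    unfold net at h4
    have h5 : w.count (x, y) = w.count (y, x) := by
      have := sub_eq_zero.1 h4
      exact_mod_cast this
    omega
  have hnd : w.Nodup := by
    refine List.nodup_iff_count_le_one.2 fun d => ?_
    by_cases hd : d ∈ w
    · exact (hcount d.1 d.2 hd).1.le
    · rw [List.count_eq_zero.2 hd]; omega
  have hrev : ∀ x y, (x, y) ∈ w → (y, x) ∈ w := fun x y hd =>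
    List.count_pos_iff.1 (by rw [(hcount x y hd).2]; omega)
  have htwo : ∀ b a x y, (b, a) ∈ w → (b, x) ∈ w → (b, y) ∈ w → x ≠ a → y ≠ a → x = y := by
    intro b a x y ha hx hy hxa hya
    by_contra hxy
    have hmem : ∀ z, (b, z) ∈ w → s(b, z) ∈ (wordEdges w).filter (b ∈ ·) := fun z hz =>
      Finset.mem_filter.2 ⟨mem_wordEdges.2 ⟨_, hz, rfl⟩, by simp⟩
    have := Finset.two_lt_card.2 ⟨_, hmem a ha, _, hmem x hx, _, hmem y hy,
      fun e => hxa (Sym2.congr_right.1 e).symm, fun e => hya (Sym2.congr_right.1 e).symm,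
      fun e => hxy (Sym2.congr_right.1 e)⟩
    rw [hdeg b (mem_wordVerts.2 ⟨_, ha, rfl⟩)] at this
    exact lt_irrefl _ this
  obtain ⟨u, hu, hrot⟩ := exists_isRotated_append_rev h.walk h.ne_nil h.nondiag hnd hrev htwo
  have hnd' := hrot.nodup_iff.1 hnd
  have h' := h.of_isRotated hrot
  have hedges : wordEdges u = wordEdges w := by
    rw [wordEdges_of_isRotated hrot, wordEdges_append, wordEdges_rev, Finset.union_self]
  obtain ⟨p, hp⟩ := h'.walk
  obtain ⟨r, hwalk, -⟩ := isWalk_append.1 hp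
  have hmemu : ∀ d ∈ u, d ∈ w := fun d hd => hrot.mem_iff.2 (by simp [hd])
  obtain ⟨hs, hc⟩ := hwalk.isSimpleLoop hu (fun d hd => h.nondiag d (hmemu d hd)) (by
      intro j k hj hk e
      rcases dartEdge_eq_iff.1 e with e | e
      · exact (hnd'.of_append_left.getElem_inj_iff).1 e
      · have h1 : u[j] ∈ rev u := mem_rev.2 (by rw [e, Prod.swap_swap]; exact List.getElem_mem hk)
        exact absurd h1 fun h1 => (List.disjoint_of_nodup_append hnd') (List.getElem_mem hj) h1)
    (by
      intro v hv
      rw [hedges]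
      obtain ⟨d, hd, rfl⟩ := mem_wordVerts.1 hv
      exact hdeg _ (mem_wordVerts.2 ⟨d, hmemu d hd, rfl⟩))
  obtain ⟨P, Q, hPQ, φ⟩ := MinimalCycles.exists_homeomorph_pointsIdentified h'.cell hu
    (by simp [rev]) (by
      intro k hk hk' t _
      have : (rev u)[u.length - 1 - k] = (u[k]).swap := by
        simp only [rev, List.getElem_reverse, List.getElem_map, List.length_map]
        congr 2
        omega
      rw [this]
      exact seg_swap _ _ t) hs (by rw [seg_one, seg_zero, hc])
  rw [trail_seg_congr (hedges.trans (wordEdges_of_isRotated hrot)), h'.union_trail hF] at φ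
  exact ⟨P, Q, hPQ, φ⟩

/-- Unless the word is d d⁻¹, reducedness gives each boundary vertex at least two boundary edges.
Since χ ≥ 1, the boundary graph has at most as many edges as vertices, and the handshake lemma makes
all its degrees equal to two. -/
theorem IsFundamentalCycle.exists_homeomorph_of_forall (hF : IsFundamentalCycle F c)
    (h2 : ∀ e ∈ edges F, edgeDeg F e = 2)
    (hχ : (edges F).card + 1 ≤ (verts F).card + F.card) :
    Nonempty (↥(openSimplices (faceClosure F)) ≃ₜ S2) ∨
    ∃ p q : S2, p ≠ q ∧
      Nonempty (↥(openSimplices (faceClosure F)) ≃ₜ SphereWithPointsIdentified p q) := by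
  obtain ⟨w, I, J, h, hred⟩ := hF.exists_isRegion_self fun R hR hsat x y => by
    rcases eq_or_ne x y with rfl | hxy
    · exact (hF.alt.restrict R).bdry_self x
    · exact hF.bdry_restrict_of_isSaturated hR hsat hxy (h2 _)
  have hE : ∀ e ∈ wordEdges w, edgeDeg F e = 2 := fun e he => h2 e (mem_edges_iff.2
    ⟨h.not_isDiag he, by rw [← h.edgeCount_eq_edgeDeg he]; exact edgeCount_pos.2 he⟩)
  rcases hred with ⟨p, q, rfl, -⟩ | hred
  · left
    have hpq : p ≠ q := h.nondiag (p, q) (by simp)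
    have φ := nonempty_homeomorph_sphere h.cell (fun t _ => seg_swap p q t) (seg_injective hpq).injOn
    have e : wordEdges [(p, q)] = wordEdges [(p, q), (q, p)] := by
      ext e; simp [mem_wordEdges, dartEdge, Sym2.eq_swap (a := q)]
    rw [trail_seg_congr e, h.union_trail hF] at φ
    exact φ
  · right
    refine h.exists_homeomorph_pointsIdentified hF hE ?_
    have hcard := h.card_wordVerts
    refine forall_eq_of_sum_le (f := fun _ => 2) (fun v hv => ?_) ?_
    · rcases hred v hv with h3 | ⟨e, he, -, h3⟩
      · exact h3
      · exact absurd (hE e he) h3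
    · rw [h.sum_card_filter, Finset.sum_const, smul_eq_mul]
      omega

/-- Now χ ≥ 2 makes the boundary graph have more vertices than edges, while only p and q can be
leaves. So both are leaves, joined by the singular edge. The walk cannot leave this edge, which it
passes four times. -/
theorem IsFundamentalCycle.exists_homeomorph_of_exists_four (hF : IsFundamentalCycle F c)
    {p q : V} (he₀ : s(p, q) ∈ edges F) (h4 : edgeDeg F s(p, q) = 4)
    (h2 : ∀ e ∈ edges F, e ≠ s(p, q) → edgeDeg F e = 2)
    (hχ : (edges F).card + 2 ≤ (verts F).card + F.card) :
    ∃ α β : unitInterval → S2, AreAdjacentArcs α β ∧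
      Nonempty (↥(openSimplices (faceClosure F)) ≃ₜ SphereWithArcsIdentified α β) := by
  have hpq : p ≠ q := (mem_edges.1 he₀).1
  obtain ⟨w, I, J, h, hred⟩ := hF.exists_isRegion_self fun R hR hsat => by
    have hz : ∀ x y, s(x, y) ≠ s(p, q) → bdry (restrict R c) x y = 0 := by
      intro x y hne
      rcases eq_or_ne x y with rfl | hxy
      · exact (hF.alt.restrict R).bdry_self x
      · exact hF.bdry_restrict_of_isSaturated hR hsat hxy fun he => h2 _ he hne
    -- A 1-cycle cannot be supported on a single edge: ∂∂ = 0 is read off at p.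
    have hpq0 : bdry (restrict R c) p q = 0 := by
      rw [← (hF.alt.restrict R).sum_bdry p]
      refine (Finset.sum_eq_single q (fun y _ hy => hz p y ?_) (by simp)).symm
      simp [hy, hpq]
    intro x y
    by_cases he : s(x, y) = s(p, q)
    · rcases Sym2.eq_iff.1 he with ⟨rfl, rfl⟩ | ⟨rfl, rfl⟩
      · exact hpq0
      · rw [(hF.alt.restrict R).bdry_swap, hpq0, neg_zero]
    · exact hz x y he
  have hdi : ¬ (s(p, q)).IsDiag := by simpa using hpq
  have he₀w : s(p, q) ∈ wordEdges w :=
    (h.mem_inner_or_mem_wordEdges hdi (by omega)).resolve_left fun hI => by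
      have := (h.inner _ hI).2.1; omega
  have hE : ∀ e ∈ wordEdges w, e ≠ s(p, q) → edgeDeg F e = 2 := fun e he => h2 e (mem_edges_iff.2
    ⟨h.not_isDiag he, by rw [← h.edgeCount_eq_edgeDeg he]; exact edgeCount_pos.2 he⟩)
  rcases hred with ⟨a, b, rfl, hab⟩ | hred
  · exfalso
    have h3 : s(p, q) = s(a, b) := by
      obtain ⟨d, hd, e⟩ := mem_wordEdges.1 he₀w
      simp only [List.mem_cons, List.not_mem_nil, or_false] at hd
      rcases hd with rfl | rfl
      · exact e.symm
      · exact e.symm.trans Sym2.eq_swap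
    rw [← h3] at hab
    omega
  obtain ⟨d₀, hd₀, hd₀e⟩ := mem_wordEdges.1 he₀w
  have hpqw : p ∈ wordVerts w ∧ q ∈ wordVerts w := by
    have h3 : d₀.1 ∈ wordVerts w := mem_wordVerts.2 ⟨_, hd₀, rfl⟩
    have h4 := h.walk.snd_mem hd₀
    rcases Sym2.eq_iff.1 (show s(d₀.1, d₀.2) = s(p, q) from hd₀e) with ⟨h5, h6⟩ | ⟨h5, h6⟩
    · rw [h5] at h3; rw [h6] at h4; exact ⟨h3, h4⟩
    · rw [h5] at h3; rw [h6] at h4; exact ⟨h4, h3⟩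
  -- The terms for p and q raise each degree to at least two and add two to the degree sum, which
  -- then equals twice the number of vertices.
  have hdeg : ∀ v ∈ wordVerts w, ((wordEdges w).filter (v ∈ ·)).card +
      ((if v = p then 1 else 0) + if v = q then 1 else 0) = 2 := by
    have hcard := h.card_wordVerts
    refine forall_eq_of_sum_le (f := fun _ => 2) (fun v hv => ?_) ?_
    · rcases hred v hv with h3 | ⟨e, he, hve, h3⟩
      · exact h3.trans (Nat.le_add_right _ _)
      · have : e = s(p, q) := by
          by_contra hne
          exact h3 (hE e he hne)
        subst this
        have : 0 < ((wordEdges w).filter (v ∈ ·)).card :=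
          Finset.card_pos.2 ⟨_, Finset.mem_filter.2 ⟨he, hve⟩⟩
        rcases Sym2.mem_iff.1 hve with rfl | rfl
        · simp only [if_true]; omega
        · simp only [if_true]; omega
    · rw [Finset.sum_add_distrib, Finset.sum_add_distrib, h.sum_card_filter, Finset.sum_const,
        smul_eq_mul, Finset.sum_ite_eq', Finset.sum_ite_eq', if_pos hpqw.1, if_pos hpqw.2]
      omega
  have honly : ∀ d ∈ w, p ∈ dartEdge d ∨ q ∈ dartEdge d → dartEdge d = s(p, q) := by
    intro d hd hv
    have hone : ∀ v ∈ wordVerts w, v ∈ s(p, q) → v ∈ dartEdge d →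
        ((wordEdges w).filter (v ∈ ·)).card ≤ 1 → dartEdge d = s(p, q) := by
      intro v _ hv hvd hc
      exact Finset.card_le_one.1 hc _ (Finset.mem_filter.2 ⟨mem_wordEdges.2 ⟨d, hd, rfl⟩, hvd⟩) _
        (Finset.mem_filter.2 ⟨he₀w, hv⟩)
    rcases hv with hv | hv
    · have := hdeg p hpqw.1
      rw [if_pos rfl] at this
      exact hone p hpqw.1 (by simp) hv (by omega)
    · have := hdeg q hpqw.2
      rw [if_pos rfl] at this
      exact hone q hpqw.2 (by simp) hv (by omega)
  have hall : ∀ d ∈ w, d = (p, q) ∨ d = (q, p) := by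
    have hfst := h.walk.fst_mem (T := {p, q}) hd₀ (by
      have : d₀.2 ∈ s(p, q) := by rw [← hd₀e]; simp [dartEdge]
      simpa using this) (by
      intro d hd hd1
      have h3 := honly d hd (by
        rcases hd1 with h | h
        · left; rw [← h]; simp [dartEdge]
        · right; rw [← (h : d.1 = q)]; simp [dartEdge])
      have : d.2 ∈ s(p, q) := by rw [← h3]; simp [dartEdge]
      simpa using this)
    intro d hd
    have h3 := honly d hd (by
      rcases hfst d hd with h | h
      · left; rw [← h]; simp [dartEdge]
      · right; rw [← (h : d.1 = q)]; simp [dartEdge])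
    exact dartEdge_eq_iff.1 (show dartEdge d = dartEdge (p, q) from h3)
  have hlen : w.length = 4 := by
    rw [← h4, ← h.edgeCount_eq_edgeDeg he₀w, edgeCount, eq_comm, List.count_eq_length.2]
    · simp
    · intro e he
      obtain ⟨d, hd, rfl⟩ := List.mem_map.1 he
      rcases hall d hd with rfl | rfl
      · rfl
      · exact Sym2.eq_swap
  -- Consecutive letters fit together, so the two orientations of the edge must alternate.
  have hword : ∃ a b, a ≠ b ∧ w = [(a, b), (b, a), (a, b), (b, a)] := by
    obtain ⟨r, hr⟩ := h.walk
    match w, hlen, hr, hall with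
    | [d₁, d₂, d₃, d₄], _, hr, hall =>
      obtain ⟨-, e2, e3, e4, -⟩ := hr
      have a1 := hall d₁ (by simp)
      have a2 := hall d₂ (by simp)
      have a3 := hall d₃ (by simp)
      have a4 := hall d₄ (by simp)
      rcases a1 with rfl | rfl <;> rcases a2 with rfl | rfl <;> rcases a3 with rfl | rfl <;>
        rcases a4 with rfl | rfl <;> simp only at e2 e3 e4 <;>
        first
        | exact absurd e2 hpq
        | exact absurd e2 hpq.symm
        | exact absurd e3 hpq
        | exact absurd e3 hpq.symm
        | exact absurd e4 hpq
        | exact absurd e4 hpq.symm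
        | exact ⟨p, q, hpq, rfl⟩
        | exact ⟨q, p, hpq.symm, rfl⟩
  obtain ⟨a, b, hab, rfl⟩ := hword
  obtain ⟨α, β, hαβ, φ⟩ := exists_homeomorph_arcsIdentified h.cell (fun t _ => seg_swap a b t)
    (seg_injective hab).injOn
  have e : wordEdges [(a, b), (b, a)] = wordEdges [(a, b), (b, a), (a, b), (b, a)] := by
    ext e; simp [mem_wordEdges]; tauto
  rw [trail_seg_congr e, h.union_trail hF] at φ
  exact ⟨α, β, hαβ, φ⟩

end Cases

/-! ### Complexes with three singular edges -/

section Triangle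

set_option linter.unusedSectionVars false

variable {V : Type*} [Fintype V] [DecidableEq V]
variable {F R : Finset (Finset V)} {c : V → V → V → ℚ} {I : Finset (Sym2 V)} {J : Finset V}

/-- The closed walk around the triangle `p q r`. -/
def triWalk (p q r : V) : List (V × V) := [(p, q), (q, r), (r, p)]

theorem mem_wordEdges_triWalk {p q r : V} {e : Sym2 V} :
    e ∈ wordEdges (triWalk p q r) ↔ e = s(p, q) ∨ e = s(q, r) ∨ e = s(r, p) := by
  simp [triWalk, mem_wordEdges, dartEdge, eq_comm]

theorem wordEdges_triWalk_swap (p q r : V) :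
    wordEdges (triWalk q p r) = wordEdges (triWalk p q r) := by
  ext e
  rw [mem_wordEdges_triWalk, mem_wordEdges_triWalk, Sym2.eq_swap (a := q) (b := p),
    Sym2.eq_swap (a := p) (b := r), Sym2.eq_swap (a := r) (b := q)]
  tauto

theorem isSimpleLoop_triWalk {p q r : V} (hpq : p ≠ q) (hqr : q ≠ r) (hrp : r ≠ p) :
    IsSimpleLoop seg (triWalk p q r) := by
  refine isSimpleLoop_seg (by simp [triWalk, hpq, hqr, hrp]) ?_ ?_
  · intro j k hj hk e
    simp only [triWalk, List.length_cons, List.length_nil, zero_add, Nat.reduceAdd] at hj hk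
    interval_cases j <;> interval_cases k <;>
      simp [triWalk, hpq, hqr, hrp, hpq.symm, hqr.symm, hrp.symm] at e ⊢
  · intro j k hj hk e
    simp only [triWalk, List.length_cons, List.length_nil, zero_add, Nat.reduceAdd] at hj hk
    interval_cases j <;> interval_cases k <;>
      simp [triWalk, dartEdge, hpq, hqr, hrp, hpq.symm, hqr.symm, hrp.symm] at e ⊢

theorem length_eq_count_add {w : List (V × V)} {p q r : V} (hpq : p ≠ q) (hqr : q ≠ r) (hrp : r ≠ p)
    (hw : ∀ d ∈ w, d ∈ triWalk p q r) :
    w.length = w.count (p, q) + w.count (q, r) + w.count (r, p) := by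
  induction w with
  | nil => simp
  | cons d w ih =>
    have h1 := ih fun d hd => hw d (by simp [hd])
    have h2 := hw d (by simp)
    simp only [triWalk, List.mem_cons, List.not_mem_nil, or_false] at h2
    rw [List.length_cons, h1]
    rcases h2 with rfl | rfl | rfl <;>
      simp [hpq, hqr, hrp, hpq.symm, hqr.symm, hrp.symm] <;> omega

theorem IsWalk.eq_cons {w : List (V × V)} {p q r s : V} (hpq : p ≠ q) (hrp : r ≠ p)
    (h : IsWalk p w s) (hw : ∀ d ∈ w, d ∈ triWalk p q r) (hne : w ≠ []) :
    ∃ w', w = (p, q) :: w' ∧ IsWalk q w' s := by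
  obtain ⟨d, w', rfl⟩ := List.exists_cons_of_ne_nil hne
  obtain ⟨h1, h2⟩ := h
  have h3 := hw d (by simp)
  simp only [triWalk, List.mem_cons, List.not_mem_nil, or_false] at h3
  rcases h3 with rfl | rfl | rfl
  · exact ⟨w', rfl, h2⟩
  · exact absurd h1.symm hpq
  · exact absurd h1 hrp

theorem mem_triWalk_rotate {p q r : V} {d : V × V} : d ∈ triWalk q r p ↔ d ∈ triWalk p q r := by
  simp only [triWalk, List.mem_cons, List.not_mem_nil, or_false]; tauto

/-- Three steps around a triangle. -/
theorem IsWalk.eq_triWalk_append {w : List (V × V)} {p q r s : V} (hpq : p ≠ q) (hqr : q ≠ r)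
    (hrp : r ≠ p) (h : IsWalk p w s) (hw : ∀ d ∈ w, d ∈ triWalk p q r) (hl : 3 ≤ w.length) :
    ∃ w', w = triWalk p q r ++ w' ∧ IsWalk p w' s := by
  obtain ⟨w₁, rfl, h1⟩ := h.eq_cons hpq hrp hw (by rintro rfl; simp at hl)
  obtain ⟨w₂, rfl, h2⟩ := h1.eq_cons hqr hpq
    (fun d hd => mem_triWalk_rotate.2 (hw d (by simp [hd]))) (by rintro rfl; simp at hl)
  obtain ⟨w₃, rfl, h3⟩ := h2.eq_cons hrp hqr
    (fun d hd => mem_triWalk_rotate.2 (mem_triWalk_rotate.2 (hw d (by simp [hd]))))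
    (by rintro rfl; simp at hl)
  exact ⟨w₃, rfl, h3⟩

/-- Each directed letter has only one possible successor, so the walk runs k times around. The
values one and two suffice, because degree three is shared by two regions. -/
theorem IsClosedWalk.isRotated_triWalk {w : List (V × V)} {p q r : V} (hpq : p ≠ q) (hqr : q ≠ r)
    (hrp : r ≠ p) (h : IsClosedWalk w) (hw : ∀ d ∈ w, d ∈ triWalk p q r) {k : ℕ}
    (h1 : w.count (p, q) = k) (h2 : w.count (q, r) = k) (h3 : w.count (r, p) = k) :
    (k = 1 → w ~r triWalk p q r) ∧ (k = 2 → w ~r (triWalk p q r ++ triWalk p q r)) := by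
  have hlen := length_eq_count_add hpq hqr hrp hw
  have htri : (triWalk p q r).length = 3 := rfl
  rw [h1, h2, h3] at hlen
  have key : 0 < k → ∃ w₁, w ~r (triWalk p q r ++ w₁) ∧ IsWalk p w₁ p := by
    intro hk
    obtain ⟨u, hu⟩ := isRotated_of_mem (List.count_pos_iff.1 (h1 ▸ hk))
    have hu' : w ~r ([(p, q)] ++ u) := hu.trans (isRotated_append_comm _ _)
    obtain ⟨s, hs⟩ := h.of_isRotated hu'
    obtain rfl : p = s := hs.1
    obtain ⟨w₁, e, hw₁⟩ := hs.eq_triWalk_append hpq hqr hrp (fun d hd => hw d (hu'.mem_iff.2 hd))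
      (by rw [← hu'.perm.length_eq]; omega)
    exact ⟨w₁, e ▸ hu', hw₁⟩
  constructor
  · rintro rfl
    obtain ⟨w₁, hrot, -⟩ := key one_pos
    have := hrot.perm.length_eq
    rw [hlen, List.length_append] at this
    have h0 : w₁ = [] := List.length_eq_zero_iff.1 (by omega)
    simpa [h0] using hrot
  · rintro rfl
    obtain ⟨w₁, hrot, hw₁⟩ := key two_pos
    have hl := hrot.perm.length_eq
    rw [hlen, List.length_append] at hl
    have hl' : w₁.length = 3 := by omega
    obtain ⟨w₂, rfl, -⟩ := hw₁.eq_triWalk_append hpq hqr hrp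
      (fun d hd => hw d (hrot.mem_iff.2 (by simp [hd]))) hl'.ge
    have h0 : w₂ = [] := List.length_eq_zero_iff.1 (by rw [List.length_append] at hl'; omega)
    simpa [h0] using hrot

/-- The boundary of an alternating chain, if supported on the edges of a triangle, is a multiple of
the triangle. -/
theorem IsAlternating.exists_bdry_eq (hc : IsAlternating c) {p q r : V} (hpq : p ≠ q) (hqr : q ≠ r)
    (hrp : r ≠ p) (hz : ∀ x y, x ≠ y → s(x, y) ∉ wordEdges (triWalk p q r) → bdry c x y = 0) :
    ∃ a, ∀ x y, bdry c x y = a * net (triWalk p q r) x y := by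
  -- At p only the edges pq and rp can carry the boundary, so ∂∂ = 0 makes their coefficients agree.
  have key : ∀ p q r : V, p ≠ q → q ≠ r → r ≠ p →
      (∀ y, p ≠ y → y ≠ q → y ≠ r → bdry c p y = 0) → bdry c p q = bdry c r p := by
    intro p q r hpq hqr hrp hz
    have h1 := hc.sum_bdry p
    rw [Finset.sum_eq_add q r hqr (fun y _ hy => ?_) (by simp) (by simp)] at h1
    · rw [hc.bdry_swap p r]; linarith
    · rcases eq_or_ne p y with rfl | h
      · exact hc.bdry_self p
      · exact hz y h hy.1 hy.2
  have k1 := key p q r hpq hqr hrp fun y h1 h2 h3 => hz p y h1 (by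
    rw [mem_wordEdges_triWalk]; simp [hpq, hrp.symm, h2, h3])
  have k2 := key q r p hqr hrp hpq fun y h1 h2 h3 => hz q y h1 (by
    rw [mem_wordEdges_triWalk]; simp [hpq.symm, hqr, h2, h3])
  refine ⟨bdry c p q, fun x y => ?_⟩
  rcases eq_or_ne x y with rfl | hxy
  · rw [hc.bdry_self]; simp [net]
  by_cases he : s(x, y) ∈ wordEdges (triWalk p q r)
  · rw [mem_wordEdges_triWalk] at he
    have s1 := hc.bdry_swap p q
    have s2 := hc.bdry_swap q r
    have s3 := hc.bdry_swap r p
    rcases he with he | he | he <;> rcases Sym2.eq_iff.1 he with ⟨rfl, rfl⟩ | ⟨rfl, rfl⟩ <;>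
      simp [net, triWalk, hpq, hqr, hrp, hpq.symm, hqr.symm, hrp.symm] <;> linarith
  · rw [hz x y hxy he]
    have h0 : edgeCount (triWalk p q r) s(x, y) = 0 := by
      by_contra h0
      exact he (edgeCount_pos.1 (Nat.pos_of_ne_zero h0))
    rw [edgeCount_eq hxy] at h0
    simp only [net]
    rw [show (triWalk p q r).count (x, y) = 0 by omega,
      show (triWalk p q r).count (y, x) = 0 by omega]
    simp

theorem net_triWalk {p q r : V} (hpq : p ≠ q) (hqr : q ≠ r) (hrp : r ≠ p) :
    net (triWalk p q r) p q = 1 ∧ net (triWalk p q r) q r = 1 ∧ net (triWalk p q r) r p = 1 := by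
  refine ⟨?_, ?_, ?_⟩ <;> simp [net, triWalk, hpq, hqr, hrp, hpq.symm, hqr.symm, hrp.symm]

theorem edgeDeg_union {A B : Finset (Finset V)} (h : Disjoint A B) (e : Sym2 V) :
    edgeDeg (A ∪ B) e = edgeDeg A e + edgeDeg B e := by
  unfold edgeDeg
  rw [Finset.filter_union, Finset.card_union_of_disjoint (Finset.disjoint_filter_filter h)]

theorem IsAlternating.smul_sub {c c' : V → V → V → ℚ} (h : IsAlternating c) (h' : IsAlternating c')
    (a b : ℚ) : IsAlternating fun x y z => a * c x y z - b * c' x y z := by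
  refine ⟨fun x y z => ?_, fun x y z => ?_⟩
  · simp only [h.swap x y z, h'.swap x y z]; ring
  · simp only [h.rot x y z, h'.rot x y z]

theorem bdry_smul_sub (c c' : V → V → V → ℚ) (a b : ℚ) (x y : V) :
    bdry (fun x y z => a * c x y z - b * c' x y z) x y = a * bdry c x y - b * bdry c' x y := by
  simp only [bdry, Finset.sum_sub_distrib, Finset.mul_sum]

/-- The combination b·c|A − a·c|B is a cycle, and it is nonzero on A because b ≠ 0. A cycle on a
proper subset would vanish. -/
theorem IsFundamentalCycle.union_eq (hF : IsFundamentalCycle F c) {A B : Finset (Finset V)}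
    (hA : A ⊆ F) (hB : B ⊆ F) (hAB : Disjoint A B) (hne : A.Nonempty) {a b : ℚ} (hb : b ≠ 0)
    {n : V → V → ℚ} (h1 : ∀ x y, bdry (restrict A c) x y = a * n x y)
    (h2 : ∀ x y, bdry (restrict B c) x y = b * n x y) : A ∪ B = F := by
  by_contra hn
  have h0 := hF.minimal (A ∪ B) ((Finset.union_subset hA hB).ssubset_of_ne hn) _
    ((hF.alt.restrict A).smul_sub (hF.alt.restrict B) b a) (fun x y => by
      rw [bdry_smul_sub, h1, h2]; ring) (fun x y z h => by
      by_contra h3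
      rw [Finset.mem_union, not_or] at h3
      rw [restrict_eq_zero_of_notMem h3.1, restrict_eq_zero_of_notMem h3.2] at h
      simp at h)
  obtain ⟨t, ht⟩ := hne
  obtain ⟨x, y, z, -, -, -, rfl⟩ := hF.exists_triple (hA ht)
  have h3 := congrFun (congrFun (congrFun h0 x) y) z
  simp only [Pi.zero_apply] at h3
  rw [restrict_eq_zero_of_notMem (Finset.disjoint_left.1 hAB ht), restrict, if_pos ht, mul_zero,
    sub_zero] at h3
  rcases mul_eq_zero.1 h3 with h | h
  · exact hb h
  · exact (hF.supp x y z).2 (hA ht) h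

end Triangle

/-! ### Two regions bounded by the singular triangle. -/

section Singular

set_option linter.unusedSectionVars false

variable {V : Type*} [Fintype V] [DecidableEq V]
variable {F R : Finset (Finset V)} {c : V → V → V → ℚ} {I : Finset (Sym2 V)} {J : Finset V}

theorem exists_two_edges_triWalk {p q r v : V} (hpq : p ≠ q) (hqr : q ≠ r) (hrp : r ≠ p)
    (hv : v = p ∨ v = q ∨ v = r) : ∃ e₁ ∈ wordEdges (triWalk p q r),
      ∃ e₂ ∈ wordEdges (triWalk p q r), e₁ ≠ e₂ ∧ v ∈ e₁ ∧ v ∈ e₂ := by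
  simp only [mem_wordEdges_triWalk]
  rcases hv with rfl | rfl | rfl
  · exact ⟨_, Or.inl rfl, _, Or.inr (Or.inr rfl), by simp [hpq.symm, hqr, hrp.symm], by simp, by simp⟩
  · exact ⟨_, Or.inl rfl, _, Or.inr (Or.inl rfl), by simp [hpq, hrp.symm], by simp, by simp⟩
  · exact ⟨_, Or.inr (Or.inl rfl), _, Or.inr (Or.inr rfl), by simp [hqr, hpq.symm], by simp, by simp⟩

theorem mem_of_mem_triWalk {p q r v : V} {e : Sym2 V} (he : e ∈ wordEdges (triWalk p q r))
    (hv : v ∈ e) : v = p ∨ v = q ∨ v = r := by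
  rw [mem_wordEdges_triWalk] at he
  rcases he with rfl | rfl | rfl <;> simp only [Sym2.mem_iff] at hv <;> tauto

/-- For R = F the word would pass pq equally often both ways, but the degree three is odd. So the
boundary of the restricted chain is nonzero by minimality; it lives on the triangle, hence is a
multiple of it, and comparison with the region's own boundary formula gives the word. -/
theorem IsRegion.exists_net_eq (hF : IsFundamentalCycle F c) {p q r : V} (hpq : p ≠ q) (hqr : q ≠ r)
    (hrp : r ≠ p) (h3 : ∀ e ∈ wordEdges (triWalk p q r), edgeDeg F e = 3)
    (h2 : ∀ e ∈ edges F, e ∉ wordEdges (triWalk p q r) → edgeDeg F e = 2) {w : List (V × V)}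
    (h : IsRegion F c R w I J) (hsat : IsSaturated F R) (hne : R.Nonempty) :
    R ≠ F ∧ ∃ b ≠ 0, (∀ x y, MinimalCycles.bdry (restrict R c) x y = b * net (triWalk p q r) x y) ∧
      ∃ n ≠ 0, ∀ x y, net w x y = n * net (triWalk p q r) x y := by
  have hRF : R ≠ F := by
    rintro rfl
    have h0 := h.net_eq_zero hF p q
    have hpqe : edgeDeg R s(p, q) = 3 := h3 _ (mem_wordEdges_triWalk.2 (Or.inl rfl))
    have hc := h.count s(p, q) (by simpa using hpq)
    rw [if_neg (fun hI => by have := (h.inner _ hI).2.1; omega), hpqe, edgeCount_eq hpq] at hc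
    have h5 : w.count (p, q) = w.count (q, p) := by
      have := sub_eq_zero.1 h0
      exact_mod_cast this
    omega
  obtain ⟨b, hb⟩ := (hF.alt.restrict R).exists_bdry_eq hpq hqr hrp fun x y hxy he =>
    hF.bdry_restrict_of_isSaturated h.subset hsat hxy fun h4 => h2 _ h4 he
  have hb0 : b ≠ 0 := by
    rintro rfl
    exact hRF (hF.eq_of_bdry_restrict h.subset hne fun x y => by rw [hb, zero_mul])
  obtain ⟨a, ha, hab⟩ := h.bdry
  refine ⟨hRF, b, hb0, hb, b / a, div_ne_zero hb0 ha, fun x y => ?_⟩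
  have := (hab x y).symm.trans (hb x y)
  field_simp
  linarith

theorem wordEdges_triWalk_subset {p q r : V} (hpq : p ≠ q) (hqr : q ≠ r) (hrp : r ≠ p)
    {w : List (V × V)} {n : ℚ} (hn : n ≠ 0) (hnet : ∀ x y, net w x y = n * net (triWalk p q r) x y) :
    wordEdges (triWalk p q r) ⊆ wordEdges w := by
  have key : ∀ x y, x ≠ y → net w x y = n → s(x, y) ∈ wordEdges w := by
    intro x y hxy h
    refine edgeCount_pos.1 (Nat.pos_of_ne_zero fun h0 => hn ?_)
    rw [edgeCount_eq hxy] at h0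
    rw [← h, net, show w.count (x, y) = 0 by omega, show w.count (y, x) = 0 by omega]
    simp
  obtain ⟨n1, n2, n3⟩ := net_triWalk hpq hqr hrp
  intro e he
  rw [mem_wordEdges_triWalk] at he
  rcases he with rfl | rfl | rfl
  · exact key _ _ hpq (by rw [hnet, n1, mul_one])
  · exact key _ _ hqr (by rw [hnet, n2, mul_one])
  · exact key _ _ hrp (by rw [hnet, n3, mul_one])

/-- A vertex of the triangle already has two triangle edges in the word; at any other vertex all
edges have degree two and reducedness applies. -/
theorem IsRegion.two_le_card_filter {p q r : V} (hpq : p ≠ q) (hqr : q ≠ r)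
    (hrp : r ≠ p) (h3 : ∀ e ∈ wordEdges (triWalk p q r), edgeDeg F e = 3)
    (h2 : ∀ e ∈ edges F, e ∉ wordEdges (triWalk p q r) → edgeDeg F e = 2) {w : List (V × V)}
    (h : IsRegion F c R w I J) (hred : IsReduced F w)
    (hT : wordEdges (triWalk p q r) ⊆ wordEdges w) :
    ∀ v ∈ wordVerts w, 2 ≤ ((wordEdges w).filter (v ∈ ·)).card := by
  intro v hv
  rcases hred with ⟨a, b, rfl, hab⟩ | hred
  · exfalso
    have hpqT : s(p, q) ∈ wordEdges (triWalk p q r) := mem_wordEdges_triWalk.2 (Or.inl rfl)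
    obtain ⟨d, hd, e⟩ := mem_wordEdges.1 (hT hpqT)
    have h4 : dartEdge d = s(a, b) := by
      simp only [List.mem_cons, List.not_mem_nil, or_false] at hd
      rcases hd with rfl | rfl
      · rfl
      · exact Sym2.eq_swap
    rw [← h4, e, h3 _ hpqT] at hab
    omega
  · rcases hred v hv with h4 | ⟨e, he, hve, h4⟩
    · exact h4
    · have heF : e ∈ edges F := mem_edges_iff.2 ⟨h.not_isDiag he,
        (edgeCount_pos.2 he).trans_le (by
          rw [h.edgeCount_eq_edgeDeg he]; exact edgeDeg_mono h.subset e)⟩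
      have heT : e ∈ wordEdges (triWalk p q r) := by
        by_contra hn
        exact h4 (h2 e heF hn)
      obtain ⟨e₁, he₁, e₂, he₂, hne, hv₁, hv₂⟩ := exists_two_edges_triWalk hpq hqr hrp
        (mem_of_mem_triWalk heT hve)
      exact Finset.one_lt_card.2 ⟨e₁, Finset.mem_filter.2 ⟨hT he₁, hv₁⟩, e₂,
        Finset.mem_filter.2 ⟨hT he₂, hv₂⟩, hne⟩

/-- At a vertex of the triangle the two boundary edges are triangle edges, so the walk, once on the
triangle, cannot leave it. -/
theorem IsRegion.dartEdge_mem_triWalk {p q r : V} (hpq : p ≠ q) (hqr : q ≠ r) (hrp : r ≠ p)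
    {w : List (V × V)} (h : IsRegion F c R w I J) (hT : wordEdges (triWalk p q r) ⊆ wordEdges w)
    (hdeg : ∀ v ∈ wordVerts w, ((wordEdges w).filter (v ∈ ·)).card = 2) :
    ∀ d ∈ w, dartEdge d ∈ wordEdges (triWalk p q r) := by
  have honly : ∀ d ∈ w, (d.1 = p ∨ d.1 = q ∨ d.1 = r) → dartEdge d ∈ wordEdges (triWalk p q r) := by
    intro d hd hv
    by_contra hn
    obtain ⟨e₁, he₁, e₂, he₂, hne, hv₁, hv₂⟩ := exists_two_edges_triWalk hpq hqr hrp hv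
    have := (Finset.two_lt_card (s := (wordEdges w).filter (d.1 ∈ ·))).2 ⟨e₁,
      Finset.mem_filter.2 ⟨hT he₁, hv₁⟩, e₂,
      Finset.mem_filter.2 ⟨hT he₂, hv₂⟩, dartEdge d,
      Finset.mem_filter.2 ⟨mem_wordEdges.2 ⟨d, hd, rfl⟩, by simp [dartEdge]⟩, hne,
      fun e => hn (e ▸ he₁), fun e => hn (e ▸ he₂)⟩
    rw [hdeg _ (mem_wordVerts.2 ⟨d, hd, rfl⟩)] at this
    exact lt_irrefl _ this
  have hpqT : s(p, q) ∈ wordEdges (triWalk p q r) := mem_wordEdges_triWalk.2 (Or.inl rfl)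
  obtain ⟨d₀, hd₀, e₀⟩ := mem_wordEdges.1 (hT hpqT)
  have hfst := h.walk.fst_mem (T := {v | v = p ∨ v = q ∨ v = r}) hd₀
    (mem_of_mem_triWalk (e₀ ▸ hpqT) (by simp [dartEdge]))
    (fun d hd hd1 => mem_of_mem_triWalk (honly d hd hd1) (by simp [dartEdge]))
  exact fun d hd => honly d hd (hfst d hd)

/-- An edge with at most two passages and nonzero net count is passed in one direction only. The net
counts agree on the three edges, so the word runs around the triangle once or twice, in the
direction given by the sign of n. -/
theorem IsRegion.exists_isRotated_triWalk {p q r : V} (hpq : p ≠ q) (hqr : q ≠ r) (hrp : r ≠ p)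
    {w : List (V × V)} (h : IsRegion F c R w I J)
    (hd : ∀ d ∈ w, dartEdge d ∈ wordEdges (triWalk p q r)) {n : ℚ} (hn : n ≠ 0)
    (hnet : ∀ x y, net w x y = n * net (triWalk p q r) x y)
    (hle : ∀ e ∈ wordEdges (triWalk p q r), edgeCount w e ≤ 2) :
    ∃ x y z, x ≠ y ∧ y ≠ z ∧ z ≠ x ∧
      wordEdges (triWalk x y z) = wordEdges (triWalk p q r) ∧
      (edgeCount w s(p, q) = 1 → w ~r triWalk x y z) ∧
      (edgeCount w s(p, q) = 2 → w ~r (triWalk x y z ++ triWalk x y z)) := by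
  obtain ⟨n1, n2, n3⟩ := net_triWalk hpq hqr hrp
  have e1 : (w.count (p, q) : ℚ) - w.count (q, p) = n := by
    have := hnet p q; rwa [n1, mul_one] at this
  have e2 : (w.count (q, r) : ℚ) - w.count (r, q) = n := by
    have := hnet q r; rwa [n2, mul_one] at this
  have e3 : (w.count (r, p) : ℚ) - w.count (p, r) = n := by
    have := hnet r p; rwa [n3, mul_one] at this
  have i1 : (w.count (p, q) : ℤ) - w.count (q, p) ≠ 0 := by
    intro h0; apply hn; rw [← e1]; exact_mod_cast h0
  have i2 : (w.count (p, q) : ℤ) - w.count (q, p) = w.count (q, r) - w.count (r, q) := by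
    have := e1.trans e2.symm; exact_mod_cast this
  have i3 : (w.count (p, q) : ℤ) - w.count (q, p) = w.count (r, p) - w.count (p, r) := by
    have := e1.trans e3.symm; exact_mod_cast this
  have c1 := hle s(p, q) (mem_wordEdges_triWalk.2 (by simp))
  have c2 := hle s(q, r) (mem_wordEdges_triWalk.2 (by simp))
  have c3 := hle s(r, p) (mem_wordEdges_triWalk.2 (by simp))
  rw [edgeCount_eq hpq] at c1 ⊢
  rw [edgeCount_eq hqr] at c2
  rw [edgeCount_eq hrp] at c3
  have hcases : ∀ d ∈ w, d ∈ triWalk p q r ∨ d ∈ triWalk q p r := by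
    intro d hdw
    have := hd d hdw
    rw [mem_wordEdges_triWalk] at this
    obtain ⟨a, b⟩ := d
    simp only [dartEdge, Sym2.eq_iff] at this
    simp only [triWalk, List.mem_cons, List.not_mem_nil, or_false, Prod.mk.injEq]
    tauto
  have hcnt : ∀ {x y z : V}, w.count (x, y) = 0 → w.count (y, z) = 0 → w.count (z, x) = 0 →
      ∀ d ∈ w, d ∉ triWalk x y z := by
    intro x y z h1 h2 h3 d hd hdT
    simp only [triWalk, List.mem_cons, List.not_mem_nil, or_false] at hdT
    rcases hdT with rfl | rfl | rfl
    · exact List.count_eq_zero.1 h1 hd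
    · exact List.count_eq_zero.1 h2 hd
    · exact List.count_eq_zero.1 h3 hd
  rcases lt_or_ge (w.count (q, p)) (w.count (p, q)) with hlt | hge
  · have h0 := hcnt (x := q) (y := p) (z := r) (by omega) (by omega) (by omega)
    obtain ⟨r1, r2⟩ := h.walk.isRotated_triWalk hpq hqr hrp
      (fun d hd => (hcases d hd).resolve_right (h0 d hd)) (k := w.count (p, q) + w.count (q, p))
      (by omega) (by omega) (by omega)
    exact ⟨p, q, r, hpq, hqr, hrp, rfl, r1, r2⟩
  · have h0 := hcnt (x := p) (y := q) (z := r) (by omega) (by omega) (by omega)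
    obtain ⟨r1, r2⟩ := h.walk.isRotated_triWalk hpq.symm hrp.symm hqr.symm
      (fun d hd => (hcases d hd).resolve_left (h0 d hd)) (k := w.count (p, q) + w.count (q, p))
      (by omega) (by omega) (by omega)
    exact ⟨q, p, r, hpq.symm, hrp.symm, hqr.symm, wordEdges_triWalk_swap p q r, r1, r2⟩

/-- Faces of different dimension differ. A common inner edge would have degree 2 + 2 instead of two,
and a common inner vertex would lie on the word `w`. -/
theorem IsRegion.disjoint_cellFaces (hF : IsFundamentalCycle F c) {A B : Finset (Finset V)}
    {I' : Finset (Sym2 V)} {J' : Finset V} {w w' : List (V × V)} (hA : IsRegion F c A w I J)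
    (hB : IsRegion F c B w' I' J') (hAB : Disjoint A B)
    (hv : MinimalCycles.verts A ∩ MinimalCycles.verts B ⊆ wordVerts w) :
    Disjoint (cellFaces A I J) (cellFaces B I' J') := by
  rw [disjoint_left]
  have hcI : ∀ e ∈ I, e.toFinset.card = 2 := fun e he => card_toFinset_edge (hA.inner e he).1
  have hcI' : ∀ e ∈ I', e.toFinset.card = 2 := fun e he => card_toFinset_edge (hB.inner e he).1
  have hcA : ∀ t ∈ A, t.card = 3 := fun t ht => hF.card t (hA.subset ht)
  have hcB : ∀ t ∈ B, t.card = 3 := fun t ht => hF.card t (hB.subset ht)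
  rintro s (hs | ⟨e, he, rfl⟩ | ⟨v, hvJ, rfl⟩) (hs' | ⟨e', he', hs'⟩ | ⟨v', hv', hs'⟩)
  · exact Finset.disjoint_left.1 hAB hs hs'
  · have := hcA s hs; have := hcI' e' he'; rw [← hs'] at this; omega
  · have := hcA s hs; rw [hs', Finset.card_singleton] at this; omega
  · have := hcB _ hs'; have := hcI e he; omega
  · obtain rfl := toFinset_injective hs'
    obtain ⟨-, h1, h2⟩ := hA.inner e he
    obtain ⟨-, -, h3⟩ := hB.inner e he'
    have := edgeDeg_mono (Finset.union_subset hA.subset hB.subset) e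
    rw [edgeDeg_union hAB] at this
    omega
  · have := hcI e he; rw [hs', Finset.card_singleton] at this; omega
  · have := hcB _ hs'; rw [Finset.card_singleton] at this; omega
  · have := hcI' e' he'; rw [← hs', Finset.card_singleton] at this; omega
  · obtain rfl := Finset.singleton_injective hs'
    refine hA.disj v hvJ (hv (Finset.mem_inter.2 ⟨?_, ?_⟩))
    · rw [← hA.verts]; exact Finset.mem_union_right _ hvJ
    · rw [← hB.verts]; exact Finset.mem_union_right _ hv'

theorem faceClosure_union (A B : Finset (Finset V)) :
    faceClosure (A ∪ B) = faceClosure A ∪ faceClosure B := by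
  ext s
  simp only [faceClosure, mem_ofPred_eq, mem_union, Finset.mem_union, or_and_right, exists_or,
    and_or_left]

theorem IsRegion.exists_homeomorph_projectivePlaneWithDisc (hF : IsFundamentalCycle F c)
    {A B : Finset (Finset V)} {I' : Finset (Sym2 V)} {J' : Finset V} {w w' : List (V × V)}
    (hA : IsRegion F c A w I J) (hB : IsRegion F c B w' I' J') (hAB : Disjoint A B)
    (hF' : A ∪ B = F) (hv : MinimalCycles.verts A ∩ MinimalCycles.verts B ⊆ wordVerts w)
    {x y z x' y' z' : V} (hxy : x ≠ y) (hyz : y ≠ z) (hzx : z ≠ x) (hxy' : x' ≠ y') (hyz' : y' ≠ z')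
    (hzx' : z' ≠ x') (hT : wordEdges (triWalk x y z) = wordEdges (triWalk x' y' z'))
    (hw : w ~r triWalk x y z) (hw' : w' ~r (triWalk x' y' z' ++ triWalk x' y' z')) :
    ∃ φ : S1 ≃ₜ P1,
      Nonempty (↥(openSimplices (faceClosure F)) ≃ₜ ProjectivePlaneWithDisc φ) := by
  have hd := disjoint_openSimplices (hA.disjoint_cellFaces hF hB hAB hv)
  have hA' := hA.of_isRotated hw
  have hB' := hB.of_isRotated hw'
  have htr : trail seg (triWalk x' y' z' ++ triWalk x' y' z') = trail seg (triWalk x' y' z') :=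
    trail_seg_congr (by rw [wordEdges_append, Finset.union_self])
  obtain ⟨φ, hφ⟩ := MinimalCycles.exists_homeomorph_projectivePlaneWithDisc hA'.cell hB'.cell
    (by simp [triWalk]) (isSimpleLoop_triWalk hxy hyz hzx) (isSimpleLoop_triWalk hxy' hyz' hzx')
    (trail_seg_congr hT) hd
  refine ⟨φ, ?_⟩
  have e : openSimplices (cellFaces A I J) ∪ openSimplices (cellFaces B I' J') ∪
      trail seg (triWalk x' y' z') = openSimplices (faceClosure F) := by
    rw [← hF', faceClosure_union, openSimplices_union, faceClosure, faceClosure, ← hA'.union_trail hF,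
      ← hB'.union_trail hF, htr, trail_seg_congr hT]
    ext v; simp only [mem_union]; tauto
  rwa [e] at hφ

/-- A saturated region A and one B in its complement both have boundary a multiple of the triangle,
so together they exhaust `F`. Euler's count forces both boundary graphs to be the triangle. The
degree three splits as one plus two: one word goes around once, the other twice. -/
theorem IsFundamentalCycle.exists_homeomorph_of_triangle (hF : IsFundamentalCycle F c) {p q r : V}
    (hpq : p ≠ q) (hqr : q ≠ r) (hrp : r ≠ p)
    (h3 : ∀ e ∈ wordEdges (triWalk p q r), edgeDeg F e = 3)
    (h2 : ∀ e ∈ edges F, e ∉ wordEdges (triWalk p q r) → edgeDeg F e = 2)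
    (hχ : (edges F).card + 2 ≤ (verts F).card + F.card) :
    ∃ φ : S1 ≃ₜ P1,
      Nonempty (↥(openSimplices (faceClosure F)) ≃ₜ ProjectivePlaneWithDisc φ) := by
  obtain ⟨A, hA, hAne, hAsat, wA₀, IA₀, hregA₀⟩ := hF.exists_isRegion subset_rfl hF.nonempty
    (isSaturated_self F)
  obtain ⟨wA, IA, JA, hregA, hredA⟩ := hregA₀.exists_isReduced hAsat
  obtain ⟨hAF, bA, hbA, hbdA, nA, hnA, hnetA⟩ := hregA.exists_net_eq hF hpq hqr hrp h3 h2 hAsat hAne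
  have hdisj : Disjoint A (F \ A) := Finset.disjoint_sdiff
  have hsatc : IsSaturated F (F \ A) := by
    intro e he h4 hpos
    have h5 := edgeDeg_union hdisj e
    rw [Finset.union_sdiff_of_subset hA] at h5
    rcases Nat.eq_zero_or_pos (edgeDeg A e) with h6 | h6
    · omega
    · have := hAsat e he h4 h6; omega
  obtain ⟨B, hB, hBne, hBsat, wB₀, IB₀, hregB₀⟩ := hF.exists_isRegion Finset.sdiff_subset
    (Finset.sdiff_nonempty.2 fun h => hAF (hA.antisymm h)) hsatc
  obtain ⟨wB, IB, JB, hregB, hredB⟩ := hregB₀.exists_isReduced hBsat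
  obtain ⟨hBF, bB, hbB, hbdB, nB, hnB, hnetB⟩ := hregB.exists_net_eq hF hpq hqr hrp h3 h2 hBsat hBne
  have hAB : Disjoint A B := hdisj.mono_right hB
  have hU : A ∪ B = F := hF.union_eq hA hregB.subset hAB hAne hbB hbdA hbdB
  have hdegU : ∀ e, edgeDeg A e + edgeDeg B e = edgeDeg F e := fun e => by
    rw [← edgeDeg_union hAB, hU]
  have hTA := wordEdges_triWalk_subset hpq hqr hrp hnA hnetA
  have hTB := wordEdges_triWalk_subset hpq hqr hrp hnB hnetB
  have hcA : ∀ e ∈ wordEdges (triWalk p q r), edgeCount wA e = edgeDeg A e ∧ 0 < edgeDeg A e :=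
    fun e he => by
      rw [← hregA.edgeCount_eq_edgeDeg (hTA he)]; exact ⟨rfl, edgeCount_pos.2 (hTA he)⟩
  have hcB : ∀ e ∈ wordEdges (triWalk p q r), edgeCount wB e = edgeDeg B e ∧ 0 < edgeDeg B e :=
    fun e he => by
      rw [← hregB.edgeCount_eq_edgeDeg (hTB he)]; exact ⟨rfl, edgeCount_pos.2 (hTB he)⟩
  have hgeA := hregA.two_le_card_filter hpq hqr hrp h3 h2 hredA hTA
  have hgeB := hregB.two_le_card_filter hpq hqr hrp h3 h2 hredB hTB
  have hleA : (wordVerts wA).card * 2 ≤ 2 * (wordEdges wA).card := by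
    rw [← hregA.sum_card_filter, ← smul_eq_mul, ← Finset.sum_const]
    exact Finset.sum_le_sum hgeA
  have hleB : (wordVerts wB).card * 2 ≤ 2 * (wordEdges wB).card := by
    rw [← hregB.sum_card_filter, ← smul_eq_mul, ← Finset.sum_const]
    exact Finset.sum_le_sum hgeB
  have hTcard : (wordEdges (triWalk p q r)).card = 3 := by
    refine Finset.card_eq_three.2 ⟨s(p, q), s(q, r), s(r, p), ?_, ?_, ?_, ?_⟩
    · simp [hpq, hrp.symm]
    · simp [hqr, hrp.symm]
    · simp [hqr, hpq.symm]
    · ext e; simp [mem_wordEdges_triWalk]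
  -- By saturation exactly the three singular edges lie in both regions.
  have hEcard : (edges A).card + (edges B).card = (edges F).card + 3 := by
    rw [← Finset.card_union_add_card_inter, ← hTcard]
    congr 2
    · ext e
      rw [Finset.mem_union, mem_edges_iff, mem_edges_iff, mem_edges_iff, ← hdegU e, ← and_or_left]
      exact and_congr_right fun _ => by omega
    · ext e
      rw [Finset.mem_inter, mem_edges_iff, mem_edges_iff]
      constructor
      · rintro ⟨⟨h4, h5⟩, -, h6⟩
        by_contra hn
        have h7 := h2 e (mem_edges_iff.2 ⟨h4, by rw [← hdegU e]; omega⟩) hn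
        have h8 := hAsat e h4 h7 h5
        have h9 := hdegU e
        omega
      · intro he
        have := hregA.not_isDiag (hTA he)
        exact ⟨⟨this, (hcA e he).2⟩, this, (hcB e he).2⟩
  have hVcard : (verts A).card + (verts B).card = (verts F).card + (verts A ∩ verts B).card := by
    rw [← Finset.card_union_add_card_inter, ← hU]
    simp only [verts, Finset.union_biUnion]
  have htri : ∀ {R : Finset (Finset V)} {w : List (V × V)} {I : Finset (Sym2 V)} {J : Finset V},
      IsRegion F c R w I J → wordEdges (triWalk p q r) ⊆ wordEdges w →
      ({p, q, r} : Finset V) ⊆ wordVerts w := by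
    intro R w I J h hT v hv
    simp only [Finset.mem_insert, Finset.mem_singleton] at hv
    obtain ⟨e, he, -, -, -, hve, -⟩ := exists_two_edges_triWalk hpq hqr hrp hv
    obtain ⟨d, hd, rfl⟩ := mem_wordEdges.1 (hT he)
    rcases Sym2.mem_iff.1 hve with rfl | rfl
    · exact mem_wordVerts.2 ⟨d, hd, rfl⟩
    · exact h.walk.snd_mem hd
  have htriA := htri hregA hTA
  have htriB := htri hregB hTB
  have hcard3 : ({p, q, r} : Finset V).card = 3 :=
    Finset.card_eq_three.2 ⟨p, q, r, hpq, hrp.symm, hqr, rfl⟩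
  have hsubI : ({p, q, r} : Finset V) ⊆ verts A ∩ verts B := by
    refine Finset.subset_inter (htriA.trans ?_) (htriB.trans ?_)
    · rw [← hregA.verts]; exact Finset.subset_union_left
    · rw [← hregB.verts]; exact Finset.subset_union_left
  have hI3 := Finset.card_le_card hsubI
  have eA := hregA.card_wordVerts
  have eB := hregB.card_wordVerts
  have hFcard : A.card + B.card = F.card := by rw [← hU, Finset.card_union_of_disjoint hAB]
  -- Adding the two Euler counts, with at least as many edges as vertices in each boundary graph,
  -- leaves at most three common vertices. The same inequalities then become equalities.
  have hI : verts A ∩ verts B = {p, q, r} :=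
    (Finset.eq_of_subset_of_card_le hsubI (by omega)).symm
  have hdegA : ∀ v ∈ wordVerts wA, ((wordEdges wA).filter (v ∈ ·)).card = 2 := by
    refine forall_eq_of_sum_le (f := fun _ => 2) hgeA ?_
    rw [hregA.sum_card_filter, Finset.sum_const, smul_eq_mul]
    omega
  have hdegB : ∀ v ∈ wordVerts wB, ((wordEdges wB).filter (v ∈ ·)).card = 2 := by
    refine forall_eq_of_sum_le (f := fun _ => 2) hgeB ?_
    rw [hregB.sum_card_filter, Finset.sum_const, smul_eq_mul]
    omega
  obtain ⟨x, y, z, hxy, hyz, hzx, hT1, hA1, hA2⟩ := hregA.exists_isRotated_triWalk hpq hqr hrp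
    (hregA.dartEdge_mem_triWalk hpq hqr hrp hTA hdegA) hnA hnetA fun e he => by
      have h4 := hcA e he; have h5 := hcB e he; have h6 := hdegU e; rw [h3 e he] at h6; omega
  obtain ⟨x', y', z', hxy', hyz', hzx', hT1', hB1, hB2⟩ := hregB.exists_isRotated_triWalk hpq hqr hrp
    (hregB.dartEdge_mem_triWalk hpq hqr hrp hTB hdegB) hnB hnetB fun e he => by
      have h4 := hcA e he; have h5 := hcB e he; have h6 := hdegU e; rw [h3 e he] at h6; omega
  have hpqT : s(p, q) ∈ wordEdges (triWalk p q r) := mem_wordEdges_triWalk.2 (Or.inl rfl)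
  have h4 := hcA _ hpqT
  have h5 := hcB _ hpqT
  have h6 := hdegU s(p, q)
  rw [h3 _ hpqT] at h6
  obtain h7 | h7 : edgeDeg A s(p, q) = 1 ∨ edgeDeg A s(p, q) = 2 := by omega
  · exact hregA.exists_homeomorph_projectivePlaneWithDisc hF hregB hAB hU (hI ▸ htriA) hxy hyz hzx
      hxy' hyz' hzx' (hT1.trans hT1'.symm) (hA1 (by omega)) (hB2 (by omega))
  · exact hregB.exists_homeomorph_projectivePlaneWithDisc hF hregA hAB.symm
      (by rw [Finset.union_comm, hU]) (by rw [Finset.inter_comm, hI]; exact htriB) hxy' hyz' hzx'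
      hxy hyz hzx (hT1'.trans hT1.symm) (hB1 (by omega)) (hA2 (by omega))

end Singular

/-! ### The realization as a union of open simplices. -/

section Realization

variable {V : Type*} [Fintype V] [DecidableEq V]

theorem IsPure.nonempty_homeomorph_realization {K : PreAbstractSimplicialComplex V} (hK : IsPure K) :
    Nonempty (Realization K ≃ₜ ↥(openSimplices (faceClosure (triangles K)))) := by
  refine ⟨Homeomorph.setCongr (s := {x : V → ℝ | (∀ v, 0 ≤ x v) ∧ ∑ v, x v = 1 ∧
    ∃ s ∈ K.faces, ∀ v, v ∉ s → x v = 0}) ?_⟩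
  ext x
  refine and_congr_right fun h0 => and_congr_right fun h1 => ?_
  change _ ↔ (_ ∧ _)
  rw [← hK.mem_faces_iff]
  constructor
  · rintro ⟨s, hs, h⟩
    refine mem_faces_of_subset hs ?_ ?_
    · by_contra hn
      rw [Finset.not_nonempty_iff_eq_empty, Finset.filter_eq_empty_iff] at hn
      have : ∑ v, x v = 0 := Finset.sum_eq_zero fun v hv => by simpa using hn hv
      rw [this] at h1
      exact zero_ne_one h1
    · intro v hv
      by_contra hvs
      exact (Finset.mem_filter.1 hv).2 (h v hvs)
  · intro h
    exact ⟨_, h, fun v hv => by simpa using hv⟩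

end Realization

end MinimalCycles

theorem mainTheorem6 {V : Type*} [Fintype V] (Z : PreAbstractSimplicialComplex V)
    (hZ : MinimalCycles.IsMinimalCycle Z) (hμ : 1 / 2 < MinimalCycles.mu Z) :
    Nonempty (MinimalCycles.Realization Z ≃ₜ MinimalCycles.S2) ∨
    (∃ p q : MinimalCycles.S2, p ≠ q ∧
      Nonempty (MinimalCycles.Realization Z ≃ₜ
        MinimalCycles.SphereWithPointsIdentified p q)) ∨
    (∃ α β : unitInterval → MinimalCycles.S2, MinimalCycles.AreAdjacentArcs α β ∧
      Nonempty (MinimalCycles.Realization Z ≃ₜ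
        MinimalCycles.SphereWithArcsIdentified α β)) ∨
    (∃ φ : MinimalCycles.S1 ≃ₜ MinimalCycles.P1,
      Nonempty (MinimalCycles.Realization Z ≃ₜ
        MinimalCycles.ProjectivePlaneWithDisc φ)) := by
  classical
  obtain ⟨ψ⟩ := hZ.isPure.nonempty_homeomorph_realization
  obtain ⟨c, hF⟩ := hZ.exists_isFundamentalCycle
  rcases hF.edgeDeg_cases hZ.card_verts_add_le (hZ.card_triangles_lt hμ) with
    ⟨h2, hχ⟩ | ⟨e₀, he₀, h4, h2, hχ⟩ | ⟨p, q, r, hpq, hqr, hrp, d1, d2, d3, h2, hχ⟩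
  · rcases hF.exists_homeomorph_of_forall h2 hχ with h | ⟨p, q, hpq, ⟨φ⟩⟩
    · obtain ⟨φ⟩ := h
      exact Or.inl ⟨ψ.trans φ⟩
    · exact Or.inr (Or.inl ⟨p, q, hpq, ⟨ψ.trans φ⟩⟩)
  · induction e₀ with
    | h p q =>
      obtain ⟨α, β, h, ⟨φ⟩⟩ := hF.exists_homeomorph_of_exists_four he₀ h4 h2 hχ
      exact Or.inr (Or.inr (Or.inl ⟨α, β, h, ⟨ψ.trans φ⟩⟩))
  · obtain ⟨φ, ⟨ρ⟩⟩ := hF.exists_homeomorph_of_triangle hpq hqr hrp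
      (fun e he => by
        rcases MinimalCycles.mem_wordEdges_triWalk.1 he with rfl | rfl | rfl <;> assumption)
      (fun e he hn => by
        rw [MinimalCycles.mem_wordEdges_triWalk, not_or, not_or] at hn
        exact h2 e he hn.1 hn.2.1 hn.2.2) hχ
    exact Or.inr (Or.inr (Or.inr ⟨φ, ⟨ψ.trans ρ⟩⟩))
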